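/- **Theorem (logical approximation implies contextual approximation).** *Language.* Let $\mathsf F^\mu$ be the call-by-value $\lambda$-calculus with types $\tau ::= \alpha \mid \mathsf{unit} \mid \mathsf{int} \mid \mathsf{bool} \mid \tau_1\times\tau_2 \mid \tau_1+\tau_2 \mid \tau_1\to\tau_2 \mid \forall\alpha.\tau \mid \exists\alpha.\tau \mid \mu\alpha.\tau$, iso-recursive types ($\mathsf{roll}$/$\mathsf{unroll}$), type-annotated injections, $\mathsf{pack}$/$\mathsf{unpack}$, type abstraction and application, and an arbitrary stock of finitary primitive operators, each with base argument and result types and computing a total function on constants. Typing $\Gamma\vdash e:\tau$ and the left-to-right small-step reduction $e\leadsto e'$ are the standard ones. On closed terms write $e\leadsto^* e'$ for a finite reduction sequence, $e\leadsto^0 e'$ and $e\leadsto^1 e'$ if the sequence contains no, respectively exactly one, reduction $\mathsf{unroll}(\mathsf{roll}\,v)\leadsto v$; $e\Downarrow$ if $e\leadsto^* v$ for some value $v$, and $e\Downarrow^0 v$ if $e\leadsto^0 v$ and $v$ is a value. A program context $C$ is a term with one hole; $\vdash C:(\Gamma\vdash\tau)\rightsquigarrow(\Gamma'\vdash\tau')$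 is its typing judgment, whose rule for the hole is $\vdash[\cdot]:(\Gamma\vdash\tau)\rightsquigarrow(\Gamma'\vdash\tau)$ for $\Gamma\subseteq\Gamma'$, and whose other rules follow the typing rules of terms. *Contextual and ciu approximation.* $\Gamma\vdash e_1\preceq^{ctx}e_2:\tau$ means that $\Gamma\vdash e_1:\tau$, $\Gamma\vdash e_2:\tau$ and, for all $C,\tau'$ with $\vdash C:(\Gamma\vdash\tau)\rightsquigarrow(\cdot\vdash\tau')$, $C[e_1]\Downarrow$ implies $C[e_2]\Downarrow$. For closed terms, $\vdash e_1\preceq^{ciu}e_2:\tau$ is the same with $C$ restricted to evaluation contexts $E$ with $\vdash E:(\cdot\vdash\tau)\rightsquigarrow(\cdot\vdash\tau')$; $e_1\preceq e_2$ means that $\vdash e_1\preceq^{ciu}e_2:\tau$ for some $\tau$. *The logic.* LSLR is second-order intuitionistic logic over types and terms of $\mathsf F^\mu$, with relation variables $r$, atomic propositions $e_1=e_2$, $e\in\mathrm{Val}$, $e:\tau$, $e_1\leadsto^{*}e_2$, $e_1\leadsto^{0}e_2$, $e_1\leadsto^{1}e_2$, $e_1\preceq e_2$, comprehension $(\overline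 x).P$, membership $\overline e\in R$, recursive relations $\mu r.R$ (with $r$ only under $\triangleright$ in $R$), and a modality $\triangleright$. It is interpreted in the Kripke model whose worlds are the natural numbers: in world $0$ everything is true; in a world $n>0$, atomic propositions have their world-independent meaning, $P\Rightarrow Q$ holds iff $P$ implies $Q$ in all worlds $k\le n$, $\triangleright P$ holds iff $P$ holds in world $n-1$, type and term quantifiers range over closed types and terms, relation quantifiers range over world-indexed relations on closed terms that are monotone (true in $n$ implies true in all $k\le n$), $\mu r.R$ means $R[\mu r.R/r]$, and the other connectives are interpreted pointwise. $\mathcal X;\mathcal R;\mathcal P\vdash P$ means that for all worlds $n$, all closing substitutions of the type and term variables $\mathcal X$ and all monotone world-indexed interpretations of the relation variables $\mathcal R$, if all propositions of $\mathcal P$ hold in world $n$, then so does $P$. *The logical relation.* Let $\rho$ map type variables to triples $(\tau_1,\tau_2,R)$, with induced type substitutions $\rho_1,\rho_2$. Write $x\downarrow\tau$ for $x:\tau\land x\in\mathrm{Val}$, and $R:\mathrm{VRel}(\tau_1,\tau_2)$ for $\forall x_1,x_2.\,(x_1,x_2)\in R\Rightarrow x_1\downarrow\tau_1\land x_2\downarrow\tau_2$.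 By recursion on $\tau$ define binary LSLR relations: - $\mathcal V[\alpha]\rho = R$ if $\rho(\alpha)=(\tau_1,\tau_2,R)$. - In every other case $(x_1,x_2)\in\mathcal V[\tau]\rho$ requires $x_1\downarrow\rho_1\tau$ and $x_2\downarrow\rho_2\tau$ and, in addition: - for $\tau\in\{\mathsf{unit},\mathsf{int},\mathsf{bool}\}$: $x_1=x_2$; - for $\tau'\times\tau''$: $x_i=\langle x_i',x_i''\rangle$ for some $x_i',x_i''$ with $(x_1',x_2')\in\mathcal V[\tau']\rho$ and $(x_1'',x_2'')\in\mathcal V[\tau'']\rho$; - for $\tau'+\tau''$: $x_i=\mathsf{inl}\,x_i'$ for some $x_i'$ with $(x_1',x_2')\in\mathcal V[\tau']\rho$, or $x_i=\mathsf{inr}\,x_i''$ for some $x_i''$ with $(x_1'',x_2'')\in\mathcal V[\tau'']\rho$; - for $\tau'\to\tau''$: $\forall y_1,y_2.\,(y_1,y_2)\in\mathcal V[\tau']\rho\Rightarrow(x_1y_1,x_2y_2)\in\mathcal C[\tau'']\rho$; - for $\forall\alpha.\tau$: $\forall\alpha_1,\alpha_2,r.\;r:\mathrm{VRel}(\alpha_1,\alpha_2)\Rightarrow(x_1\,\alpha_1,x_2\,\alpha_2)\in\mathcal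 C[\tau](\rho,\alpha\mapsto(\alpha_1,\alpha_2,r))$; - for $\exists\alpha.\tau$: $\exists\alpha_1,\alpha_2,y_1,y_2,r.\;r:\mathrm{VRel}(\alpha_1,\alpha_2)\land x_i=\mathsf{pack}\,\alpha_i,y_i\,\mathsf{as}\,\exists\alpha.\rho_i\tau\ (i=1,2)\land(y_1,y_2)\in\mathcal V[\tau](\rho,\alpha\mapsto(\alpha_1,\alpha_2,r))$; - for $\mu\alpha.\tau$ (recursively in $r=\mathcal V[\mu\alpha.\tau]\rho$): $\exists y_1,y_2.\;x_i=\mathsf{roll}\,y_i\ (i=1,2)\land\triangleright\,(y_1,y_2)\in\mathcal V[\tau](\rho,\alpha\mapsto(\rho_1(\mu\alpha.\tau),\rho_2(\mu\alpha.\tau),r))$. - $\mathcal C[\tau]\rho=\mu r.(t_1,t_2).\;t_1:\rho_1\tau\land t_2:\rho_2\tau\land(\forall x_1.\,t_1\Downarrow^0x_1\Rightarrow\exists x_2.\,x_2\preceq t_2\land(x_1,x_2)\in\mathcal V[\tau]\rho)\land(\forall t_1'.\,t_1\leadsto^1t_1'\Rightarrow\triangleright\,(t_1',t_2)\in r)$.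 *Logical approximation.* Let $\Gamma=\alpha_1,\dots,\alpha_n,x_1{:}\tau_1,\dots,x_m{:}\tau_m$. Then $\Gamma\vdash e_1\preceq^{log}e_2:\tau$ means that $\Gamma\vdash e_1:\tau$, $\Gamma\vdash e_2:\tau$ and $$\mathcal X;\mathcal R;\mathcal P\vdash(\rho_1\gamma_1e_1,\rho_2\gamma_2e_2)\in\mathcal C[\tau]\rho,$$ where $\mathcal X=\alpha_i^1,\alpha_i^2\,(1\le i\le n),\,x_j^1,x_j^2\,(1\le j\le m)$; $\mathcal R=r_1,\dots,r_n$; $\rho=(\alpha_i\mapsto(\alpha_i^1,\alpha_i^2,r_i))_i$; $\mathcal P$ consists of $r_i:\mathrm{VRel}(\alpha_i^1,\alpha_i^2)$ for $1\le i\le n$ and $(x_j^1,x_j^2)\in\mathcal V[\tau_j]\rho$ for $1\le j\le m$; and $\gamma_l=(x_j\mapsto x_j^l)_j$ for $l=1,2$. *Claim.* If $\Gamma\vdash e_1\preceq^{log}e_2:\tau$, then $\Gamma\vdash e_1\preceq^{ctx}e_2:\tau$. -/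

import Mathlib

namespace FMu

/-! ## Primitive operators -/

/-- The base types `unit`, `int`, `bool`. -/
inductive BaseTy where
  | unit | int | bool

/-- The constants of a base type. -/
def BaseTy.Carrier : BaseTy → Type
  | .unit => Unit
  | .int => ℤ
  | .bool => Bool

/-- A stock of primitive operators on constants of base type (such as `+`, `-`, `=`, `<`, `≤` on
integers), each with its argument types, its result type and the total function it computes. -/
structure PrimSig where
  Op : Type
  arity : Op → ℕ
  dom : (o : Op) → Fin (arity o) → BaseTy
  cod : Op → BaseTy
  eval : (o : Op) → ((i : Fin (arity o)) → (dom o i).Carrier) → (cod o).Carrier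

/-! ## Syntax

Well-scoped de Bruijn syntax: `Ty k` is the set of types with free variables among `k` type
variables, `Tm S k m` the set of terms with free variables among `k` type variables and `m` term
variables.  The innermost bound variable has index `0`.  Terms are thus identified up to renaming
of bound variables, and `Ty 0`, `Tm S 0 0` are the closed types and terms. -/

/-- Extend a finite assignment by a value for the new variable `0`. -/
abbrev push {A : Type} {n : ℕ} (a : A) (f : Fin n → A) : Fin (n + 1) → A :=
  Fin.cons (α := fun _ => A) a f

/-- Lift a renaming under a binder. -/
def upRen {n n' : ℕ} (ξ : Fin n → Fin n') : Fin (n + 1) → Fin (n' + 1) :=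
  push 0 (fun i => (ξ i).succ)

inductive Ty : ℕ → Type where
  | var {k : ℕ} (i : Fin k) : Ty k
  | base {k : ℕ} (b : BaseTy) : Ty k
  | prod {k : ℕ} (τ₁ τ₂ : Ty k) : Ty k
  | sum {k : ℕ} (τ₁ τ₂ : Ty k) : Ty k
  | arr {k : ℕ} (τ₁ τ₂ : Ty k) : Ty k
  | all {k : ℕ} (τ : Ty (k + 1)) : Ty k
  | ex {k : ℕ} (τ : Ty (k + 1)) : Ty k
  | mu {k : ℕ} (τ : Ty (k + 1)) : Ty k

namespace Ty

def rename : {k k' : ℕ} → (Fin k → Fin k') → Ty k → Ty k'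
  | _, _, ξ, .var i => .var (ξ i)
  | _, _, _, .base b => .base b
  | _, _, ξ, .prod τ₁ τ₂ => .prod (τ₁.rename ξ) (τ₂.rename ξ)
  | _, _, ξ, .sum τ₁ τ₂ => .sum (τ₁.rename ξ) (τ₂.rename ξ)
  | _, _, ξ, .arr τ₁ τ₂ => .arr (τ₁.rename ξ) (τ₂.rename ξ)
  | _, _, ξ, .all τ => .all (τ.rename (upRen ξ))
  | _, _, ξ, .ex τ => .ex (τ.rename (upRen ξ))
  | _, _, ξ, .mu τ => .mu (τ.rename (upRen ξ))

/-- Lift a type substitution under a binder of a type variable. -/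
def up {k k' : ℕ} (σ : Fin k → Ty k') : Fin (k + 1) → Ty (k' + 1) :=
  push (.var 0) (fun i => (σ i).rename Fin.succ)

/-- Simultaneous capture-avoiding substitution. -/
def subst : {k k' : ℕ} → (Fin k → Ty k') → Ty k → Ty k'
  | _, _, σ, .var i => σ i
  | _, _, _, .base b => .base b
  | _, _, σ, .prod τ₁ τ₂ => .prod (τ₁.subst σ) (τ₂.subst σ)
  | _, _, σ, .sum τ₁ τ₂ => .sum (τ₁.subst σ) (τ₂.subst σ)
  | _, _, σ, .arr τ₁ τ₂ => .arr (τ₁.subst σ) (τ₂.subst σ)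
  | _, _, σ, .all τ => .all (τ.subst (up σ))
  | _, _, σ, .ex τ => .ex (τ.subst (up σ))
  | _, _, σ, .mu τ => .mu (τ.subst (up σ))

/-- `τ[σ/α]`, where `α` is the variable `0` of `τ`. -/
def inst {k : ℕ} (τ : Ty (k + 1)) (σ : Ty k) : Ty k :=
  τ.subst (push σ .var)

end Ty

/-- Terms.  `pack σ e τ` is `pack σ, e as ∃α.τ`; the annotation of `inl`, `inr`, `roll` is the
whole sum type or recursive type; in `unpack e₁ e₂` the body `e₂` binds a type variable and a
term variable. -/
inductive Tm (S : PrimSig) : ℕ → ℕ → Type where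
  | var {k m : ℕ} (x : Fin m) : Tm S k m
  | lit {k m : ℕ} (b : BaseTy) (c : b.Carrier) : Tm S k m
  | op {k m : ℕ} (o : S.Op) (args : Fin (S.arity o) → Tm S k m) : Tm S k m
  | ite {k m : ℕ} (e e₁ e₂ : Tm S k m) : Tm S k m
  | pair {k m : ℕ} (e₁ e₂ : Tm S k m) : Tm S k m
  | fst {k m : ℕ} (e : Tm S k m) : Tm S k m
  | snd {k m : ℕ} (e : Tm S k m) : Tm S k m
  | inl {k m : ℕ} (τ : Ty k) (e : Tm S k m) : Tm S k m
  | inr {k m : ℕ} (τ : Ty k) (e : Tm S k m) : Tm S k m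
  | case {k m : ℕ} (e : Tm S k m) (e₁ e₂ : Tm S k (m + 1)) : Tm S k m
  | lam {k m : ℕ} (τ : Ty k) (e : Tm S k (m + 1)) : Tm S k m
  | app {k m : ℕ} (e₁ e₂ : Tm S k m) : Tm S k m
  | tlam {k m : ℕ} (e : Tm S (k + 1) m) : Tm S k m
  | tapp {k m : ℕ} (e : Tm S k m) (τ : Ty k) : Tm S k m
  | pack {k m : ℕ} (σ : Ty k) (e : Tm S k m) (τ : Ty (k + 1)) : Tm S k m
  | unpack {k m : ℕ} (e₁ : Tm S k m) (e₂ : Tm S (k + 1) (m + 1)) : Tm S k m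
  | roll {k m : ℕ} (τ : Ty k) (e : Tm S k m) : Tm S k m
  | unroll {k m : ℕ} (e : Tm S k m) : Tm S k m

namespace Tm

variable {S : PrimSig}

def rename : {k k' m m' : ℕ} → (Fin k → Fin k') → (Fin m → Fin m') → Tm S k m → Tm S k' m'
  | _, _, _, _, _, ξ, .var x => .var (ξ x)
  | _, _, _, _, _, _, .lit b c => .lit b c
  | _, _, _, _, ζ, ξ, .op o args => .op o (fun i => (args i).rename ζ ξ)
  | _, _, _, _, ζ, ξ, .ite e e₁ e₂ => .ite (e.rename ζ ξ) (e₁.rename ζ ξ) (e₂.rename ζ ξ)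
  | _, _, _, _, ζ, ξ, .pair e₁ e₂ => .pair (e₁.rename ζ ξ) (e₂.rename ζ ξ)
  | _, _, _, _, ζ, ξ, .fst e => .fst (e.rename ζ ξ)
  | _, _, _, _, ζ, ξ, .snd e => .snd (e.rename ζ ξ)
  | _, _, _, _, ζ, ξ, .inl τ e => .inl (τ.rename ζ) (e.rename ζ ξ)
  | _, _, _, _, ζ, ξ, .inr τ e => .inr (τ.rename ζ) (e.rename ζ ξ)
  | _, _, _, _, ζ, ξ, .case e e₁ e₂ =>
      .case (e.rename ζ ξ) (e₁.rename ζ (upRen ξ)) (e₂.rename ζ (upRen ξ))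
  | _, _, _, _, ζ, ξ, .lam τ e => .lam (τ.rename ζ) (e.rename ζ (upRen ξ))
  | _, _, _, _, ζ, ξ, .app e₁ e₂ => .app (e₁.rename ζ ξ) (e₂.rename ζ ξ)
  | _, _, _, _, ζ, ξ, .tlam e => .tlam (e.rename (upRen ζ) ξ)
  | _, _, _, _, ζ, ξ, .tapp e τ => .tapp (e.rename ζ ξ) (τ.rename ζ)
  | _, _, _, _, ζ, ξ, .pack σ e τ =>
      .pack (σ.rename ζ) (e.rename ζ ξ) (τ.rename (upRen ζ))
  | _, _, _, _, ζ, ξ, .unpack e₁ e₂ =>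
      .unpack (e₁.rename ζ ξ) (e₂.rename (upRen ζ) (upRen ξ))
  | _, _, _, _, ζ, ξ, .roll τ e => .roll (τ.rename ζ) (e.rename ζ ξ)
  | _, _, _, _, ζ, ξ, .unroll e => .unroll (e.rename ζ ξ)

/-- Lift a term substitution under a binder of a term variable. -/
def up {k m m' : ℕ} (θ : Fin m → Tm S k m') : Fin (m + 1) → Tm S k (m' + 1) :=
  push (.var 0) (fun x => (θ x).rename id Fin.succ)

/-- Lift a term substitution under a binder of a type variable. -/
def upTy {k m m' : ℕ} (θ : Fin m → Tm S k m') : Fin m → Tm S (k + 1) m' :=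
  fun x => (θ x).rename Fin.succ id

/-- Simultaneous capture-avoiding substitution of types and terms. -/
def subst : {k k' m m' : ℕ} → (Fin k → Ty k') → (Fin m → Tm S k' m') → Tm S k m → Tm S k' m'
  | _, _, _, _, _, θ, .var x => θ x
  | _, _, _, _, _, _, .lit b c => .lit b c
  | _, _, _, _, σ, θ, .op o args => .op o (fun i => (args i).subst σ θ)
  | _, _, _, _, σ, θ, .ite e e₁ e₂ => .ite (e.subst σ θ) (e₁.subst σ θ) (e₂.subst σ θ)
  | _, _, _, _, σ, θ, .pair e₁ e₂ => .pair (e₁.subst σ θ) (e₂.subst σ θ)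
  | _, _, _, _, σ, θ, .fst e => .fst (e.subst σ θ)
  | _, _, _, _, σ, θ, .snd e => .snd (e.subst σ θ)
  | _, _, _, _, σ, θ, .inl τ e => .inl (τ.subst σ) (e.subst σ θ)
  | _, _, _, _, σ, θ, .inr τ e => .inr (τ.subst σ) (e.subst σ θ)
  | _, _, _, _, σ, θ, .case e e₁ e₂ =>
      .case (e.subst σ θ) (e₁.subst σ (up θ)) (e₂.subst σ (up θ))
  | _, _, _, _, σ, θ, .lam τ e => .lam (τ.subst σ) (e.subst σ (up θ))
  | _, _, _, _, σ, θ, .app e₁ e₂ => .app (e₁.subst σ θ) (e₂.subst σ θ)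
  | _, _, _, _, σ, θ, .tlam e => .tlam (e.subst (Ty.up σ) (upTy θ))
  | _, _, _, _, σ, θ, .tapp e τ => .tapp (e.subst σ θ) (τ.subst σ)
  | _, _, _, _, σ, θ, .pack ν e τ => .pack (ν.subst σ) (e.subst σ θ) (τ.subst (Ty.up σ))
  | _, _, _, _, σ, θ, .unpack e₁ e₂ =>
      .unpack (e₁.subst σ θ) (e₂.subst (Ty.up σ) (up (upTy θ)))
  | _, _, _, _, σ, θ, .roll τ e => .roll (τ.subst σ) (e.subst σ θ)
  | _, _, _, _, σ, θ, .unroll e => .unroll (e.subst σ θ)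

/-- `e[v/x]`. -/
def instTm {k m : ℕ} (e : Tm S k (m + 1)) (v : Tm S k m) : Tm S k m :=
  e.subst .var (push v .var)

/-- `e[τ/α]`. -/
def instTy {k m : ℕ} (e : Tm S (k + 1) m) (τ : Ty k) : Tm S k m :=
  e.subst (push τ .var) .var

/-- `e[τ/α][v/x]`. -/
def instBoth {k m : ℕ} (e : Tm S (k + 1) (m + 1)) (τ : Ty k) (v : Tm S k m) : Tm S k m :=
  e.subst (push τ .var) (push v .var)

/-- Values. -/
inductive IsVal : {k m : ℕ} → Tm S k m → Prop where
  | var {k m : ℕ} (x : Fin m) : IsVal (.var x : Tm S k m)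
  | lit {k m : ℕ} (b : BaseTy) (c : b.Carrier) : IsVal (.lit b c : Tm S k m)
  | pair {k m : ℕ} {v₁ v₂ : Tm S k m} : IsVal v₁ → IsVal v₂ → IsVal (.pair v₁ v₂)
  | inl {k m : ℕ} {τ : Ty k} {v : Tm S k m} : IsVal v → IsVal (.inl τ v)
  | inr {k m : ℕ} {τ : Ty k} {v : Tm S k m} : IsVal v → IsVal (.inr τ v)
  | lam {k m : ℕ} (τ : Ty k) (e : Tm S k (m + 1)) : IsVal (.lam τ e)
  | tlam {k m : ℕ} (e : Tm S (k + 1) m) : IsVal (.tlam e)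
  | pack {k m : ℕ} {σ : Ty k} {v : Tm S k m} {τ : Ty (k + 1)} : IsVal v → IsVal (.pack σ v τ)
  | roll {k m : ℕ} {τ : Ty k} {v : Tm S k m} : IsVal v → IsVal (.roll τ v)

end Tm

/-! ## Static semantics -/

/-- A typing context with `k` type variables and `m` typed term variables.  Well-formedness
`Γ ⊢ τ` of a type is membership in `Ty k`. -/
abbrev TyCtx (k m : ℕ) : Type := Fin m → Ty k

/-- `Γ, α`. -/
def TyCtx.addTy {k m : ℕ} (Γ : TyCtx k m) : TyCtx (k + 1) m :=
  fun x => (Γ x).rename Fin.succ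

/-- `Γ, x : τ`. -/
def TyCtx.addTm {k m : ℕ} (Γ : TyCtx k m) (τ : Ty k) : TyCtx k (m + 1) := push τ Γ

/-- The empty typing context. -/
def TyCtx.nil : TyCtx 0 0 := Fin.elim0

section Typing

variable {S : PrimSig}

/-- The typing judgment `Γ ⊢ e : τ`. -/
inductive HasTy : {k m : ℕ} → TyCtx k m → Tm S k m → Ty k → Prop where
  | var {k m : ℕ} {Γ : TyCtx k m} (x : Fin m) : HasTy Γ (.var x) (Γ x)
  | lit {k m : ℕ} {Γ : TyCtx k m} (b : BaseTy) (c : b.Carrier) : HasTy Γ (.lit b c) (.base b)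
  | op {k m : ℕ} {Γ : TyCtx k m} (o : S.Op) {args : Fin (S.arity o) → Tm S k m} :
      (∀ i, HasTy Γ (args i) (.base (S.dom o i))) → HasTy Γ (.op o args) (.base (S.cod o))
  | ite {k m : ℕ} {Γ : TyCtx k m} {e e₁ e₂ : Tm S k m} {τ : Ty k} :
      HasTy Γ e (.base .bool) → HasTy Γ e₁ τ → HasTy Γ e₂ τ → HasTy Γ (.ite e e₁ e₂) τ
  | pair {k m : ℕ} {Γ : TyCtx k m} {e₁ e₂ : Tm S k m} {τ₁ τ₂ : Ty k} :
      HasTy Γ e₁ τ₁ → HasTy Γ e₂ τ₂ → HasTy Γ (.pair e₁ e₂) (.prod τ₁ τ₂)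
  | fst {k m : ℕ} {Γ : TyCtx k m} {e : Tm S k m} {τ₁ τ₂ : Ty k} :
      HasTy Γ e (.prod τ₁ τ₂) → HasTy Γ (.fst e) τ₁
  | snd {k m : ℕ} {Γ : TyCtx k m} {e : Tm S k m} {τ₁ τ₂ : Ty k} :
      HasTy Γ e (.prod τ₁ τ₂) → HasTy Γ (.snd e) τ₂
  | inl {k m : ℕ} {Γ : TyCtx k m} {e : Tm S k m} {τ₁ τ₂ : Ty k} :
      HasTy Γ e τ₁ → HasTy Γ (.inl (.sum τ₁ τ₂) e) (.sum τ₁ τ₂)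
  | inr {k m : ℕ} {Γ : TyCtx k m} {e : Tm S k m} {τ₁ τ₂ : Ty k} :
      HasTy Γ e τ₂ → HasTy Γ (.inr (.sum τ₁ τ₂) e) (.sum τ₁ τ₂)
  | case {k m : ℕ} {Γ : TyCtx k m} {e : Tm S k m} {e₁ e₂ : Tm S k (m + 1)} {τ₁ τ₂ τ : Ty k} :
      HasTy Γ e (.sum τ₁ τ₂) → HasTy (Γ.addTm τ₁) e₁ τ → HasTy (Γ.addTm τ₂) e₂ τ →
      HasTy Γ (.case e e₁ e₂) τ
  | lam {k m : ℕ} {Γ : TyCtx k m} {e : Tm S k (m + 1)} {τ₁ τ₂ : Ty k} :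
      HasTy (Γ.addTm τ₁) e τ₂ → HasTy Γ (.lam τ₁ e) (.arr τ₁ τ₂)
  | app {k m : ℕ} {Γ : TyCtx k m} {e₁ e₂ : Tm S k m} {τ₂ τ : Ty k} :
      HasTy Γ e₁ (.arr τ₂ τ) → HasTy Γ e₂ τ₂ → HasTy Γ (.app e₁ e₂) τ
  | tlam {k m : ℕ} {Γ : TyCtx k m} {e : Tm S (k + 1) m} {τ : Ty (k + 1)} :
      HasTy Γ.addTy e τ → HasTy Γ (.tlam e) (.all τ)
  | tapp {k m : ℕ} {Γ : TyCtx k m} {e : Tm S k m} {τ : Ty (k + 1)} (τ₁ : Ty k) :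
      HasTy Γ e (.all τ) → HasTy Γ (.tapp e τ₁) (τ.inst τ₁)
  | pack {k m : ℕ} {Γ : TyCtx k m} {e : Tm S k m} {τ : Ty (k + 1)} {τ₁ : Ty k} :
      HasTy Γ e (τ.inst τ₁) → HasTy Γ (.pack τ₁ e τ) (.ex τ)
  | unpack {k m : ℕ} {Γ : TyCtx k m} {e₁ : Tm S k m} {e₂ : Tm S (k + 1) (m + 1)}
      {τ₁ : Ty (k + 1)} {τ : Ty k} :
      HasTy Γ e₁ (.ex τ₁) → HasTy (Γ.addTy.addTm τ₁) e₂ (τ.rename Fin.succ) →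
      HasTy Γ (.unpack e₁ e₂) τ
  | roll {k m : ℕ} {Γ : TyCtx k m} {e : Tm S k m} {τ : Ty (k + 1)} :
      HasTy Γ e (τ.inst (.mu τ)) → HasTy Γ (.roll (.mu τ) e) (.mu τ)
  | unroll {k m : ℕ} {Γ : TyCtx k m} {e : Tm S k m} {τ : Ty (k + 1)} :
      HasTy Γ e (.mu τ) → HasTy Γ (.unroll e) (τ.inst (.mu τ))

end Typing

/-! ## Program contexts -/

/-- `Ctx S k m k' m'`: program contexts whose free variables are among `k'` type variables and
`m'` term variables, with one hole for a term over `k` type variables and `m` term variables.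
In named syntax, filling the hole captures variables by name; here the hole records which of
the variables in scope at the hole each variable of the plugged term becomes.
In `op o i args C` the hole is in the `i`-th argument (the entry `args i` is ignored). -/
inductive Ctx (S : PrimSig) (k m : ℕ) : ℕ → ℕ → Type where
  | hole {k' m' : ℕ} (ζ : Fin k → Fin k') (ξ : Fin m → Fin m') : Ctx S k m k' m'
  | op {k' m' : ℕ} (o : S.Op) (i : Fin (S.arity o)) (args : Fin (S.arity o) → Tm S k' m')
      (C : Ctx S k m k' m') : Ctx S k m k' m'
  | ite₀ {k' m' : ℕ} (C : Ctx S k m k' m') (e₁ e₂ : Tm S k' m') : Ctx S k m k' m'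
  | ite₁ {k' m' : ℕ} (e : Tm S k' m') (C : Ctx S k m k' m') (e₂ : Tm S k' m') : Ctx S k m k' m'
  | ite₂ {k' m' : ℕ} (e e₁ : Tm S k' m') (C : Ctx S k m k' m') : Ctx S k m k' m'
  | pair₁ {k' m' : ℕ} (C : Ctx S k m k' m') (e₂ : Tm S k' m') : Ctx S k m k' m'
  | pair₂ {k' m' : ℕ} (e₁ : Tm S k' m') (C : Ctx S k m k' m') : Ctx S k m k' m'
  | fst {k' m' : ℕ} (C : Ctx S k m k' m') : Ctx S k m k' m'
  | snd {k' m' : ℕ} (C : Ctx S k m k' m') : Ctx S k m k' m'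
  | inl {k' m' : ℕ} (τ : Ty k') (C : Ctx S k m k' m') : Ctx S k m k' m'
  | inr {k' m' : ℕ} (τ : Ty k') (C : Ctx S k m k' m') : Ctx S k m k' m'
  | case₀ {k' m' : ℕ} (C : Ctx S k m k' m') (e₁ e₂ : Tm S k' (m' + 1)) : Ctx S k m k' m'
  | case₁ {k' m' : ℕ} (e : Tm S k' m') (C : Ctx S k m k' (m' + 1)) (e₂ : Tm S k' (m' + 1)) :
      Ctx S k m k' m'
  | case₂ {k' m' : ℕ} (e : Tm S k' m') (e₁ : Tm S k' (m' + 1)) (C : Ctx S k m k' (m' + 1)) :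
      Ctx S k m k' m'
  | lam {k' m' : ℕ} (τ : Ty k') (C : Ctx S k m k' (m' + 1)) : Ctx S k m k' m'
  | app₁ {k' m' : ℕ} (C : Ctx S k m k' m') (e₂ : Tm S k' m') : Ctx S k m k' m'
  | app₂ {k' m' : ℕ} (e₁ : Tm S k' m') (C : Ctx S k m k' m') : Ctx S k m k' m'
  | tlam {k' m' : ℕ} (C : Ctx S k m (k' + 1) m') : Ctx S k m k' m'
  | tapp {k' m' : ℕ} (C : Ctx S k m k' m') (τ : Ty k') : Ctx S k m k' m'
  | pack {k' m' : ℕ} (σ : Ty k') (C : Ctx S k m k' m') (τ : Ty (k' + 1)) : Ctx S k m k' m'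
  | unpack₁ {k' m' : ℕ} (C : Ctx S k m k' m') (e₂ : Tm S (k' + 1) (m' + 1)) : Ctx S k m k' m'
  | unpack₂ {k' m' : ℕ} (e₁ : Tm S k' m') (C : Ctx S k m (k' + 1) (m' + 1)) : Ctx S k m k' m'
  | roll {k' m' : ℕ} (τ : Ty k') (C : Ctx S k m k' m') : Ctx S k m k' m'
  | unroll {k' m' : ℕ} (C : Ctx S k m k' m') : Ctx S k m k' m'

namespace Ctx

variable {S : PrimSig} {k m : ℕ}

/-- `C[e]`. -/
def fill (t : Tm S k m) : {k' m' : ℕ} → Ctx S k m k' m' → Tm S k' m'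
  | _, _, .hole ζ ξ => t.rename ζ ξ
  | _, _, .op o i args C => .op o (Function.update args i (fill t C))
  | _, _, .ite₀ C e₁ e₂ => .ite (fill t C) e₁ e₂
  | _, _, .ite₁ e C e₂ => .ite e (fill t C) e₂
  | _, _, .ite₂ e e₁ C => .ite e e₁ (fill t C)
  | _, _, .pair₁ C e₂ => .pair (fill t C) e₂
  | _, _, .pair₂ e₁ C => .pair e₁ (fill t C)
  | _, _, .fst C => .fst (fill t C)
  | _, _, .snd C => .snd (fill t C)
  | _, _, .inl τ C => .inl τ (fill t C)
  | _, _, .inr τ C => .inr τ (fill t C)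
  | _, _, .case₀ C e₁ e₂ => .case (fill t C) e₁ e₂
  | _, _, .case₁ e C e₂ => .case e (fill t C) e₂
  | _, _, .case₂ e e₁ C => .case e e₁ (fill t C)
  | _, _, .lam τ C => .lam τ (fill t C)
  | _, _, .app₁ C e₂ => .app (fill t C) e₂
  | _, _, .app₂ e₁ C => .app e₁ (fill t C)
  | _, _, .tlam C => .tlam (fill t C)
  | _, _, .tapp C τ => .tapp (fill t C) τ
  | _, _, .pack σ C τ => .pack σ (fill t C) τ
  | _, _, .unpack₁ C e₂ => .unpack (fill t C) e₂
  | _, _, .unpack₂ e₁ C => .unpack e₁ (fill t C)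
  | _, _, .roll τ C => .roll τ (fill t C)
  | _, _, .unroll C => .unroll (fill t C)

end Ctx

section CtxTyping

variable {S : PrimSig}

/-- The typing judgment `⊢ C : (Γ ⊢ τ) ⇝ (Γ' ⊢ τ')`.  In the rule for the hole, the inclusion
`Γ ⊆ Γ'` of named contexts is an injective map of variables that preserves types. -/
inductive CtxTy {k m : ℕ} (Γ : TyCtx k m) (τ : Ty k) :
    {k' m' : ℕ} → Ctx S k m k' m' → TyCtx k' m' → Ty k' → Prop where
  | hole {k' m' : ℕ} {Γ' : TyCtx k' m'} {ζ : Fin k → Fin k'} {ξ : Fin m → Fin m'} :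
      Function.Injective ζ → Function.Injective ξ → (∀ x, Γ' (ξ x) = (Γ x).rename ζ) →
      CtxTy Γ τ (.hole ζ ξ) Γ' (τ.rename ζ)
  | op {k' m' : ℕ} {Γ' : TyCtx k' m'} (o : S.Op) (i : Fin (S.arity o))
      {args : Fin (S.arity o) → Tm S k' m'} {C : Ctx S k m k' m'} :
      (∀ j, j ≠ i → HasTy Γ' (args j) (.base (S.dom o j))) →
      CtxTy Γ τ C Γ' (.base (S.dom o i)) → CtxTy Γ τ (.op o i args C) Γ' (.base (S.cod o))
  | ite₀ {k' m' : ℕ} {Γ' : TyCtx k' m'} {C : Ctx S k m k' m'} {e₁ e₂ : Tm S k' m'} {τ' : Ty k'} :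
      CtxTy Γ τ C Γ' (.base .bool) → HasTy Γ' e₁ τ' → HasTy Γ' e₂ τ' →
      CtxTy Γ τ (.ite₀ C e₁ e₂) Γ' τ'
  | ite₁ {k' m' : ℕ} {Γ' : TyCtx k' m'} {C : Ctx S k m k' m'} {e e₂ : Tm S k' m'} {τ' : Ty k'} :
      HasTy Γ' e (.base .bool) → CtxTy Γ τ C Γ' τ' → HasTy Γ' e₂ τ' →
      CtxTy Γ τ (.ite₁ e C e₂) Γ' τ'
  | ite₂ {k' m' : ℕ} {Γ' : TyCtx k' m'} {C : Ctx S k m k' m'} {e e₁ : Tm S k' m'} {τ' : Ty k'} :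
      HasTy Γ' e (.base .bool) → HasTy Γ' e₁ τ' → CtxTy Γ τ C Γ' τ' →
      CtxTy Γ τ (.ite₂ e e₁ C) Γ' τ'
  | pair₁ {k' m' : ℕ} {Γ' : TyCtx k' m'} {C : Ctx S k m k' m'} {e₂ : Tm S k' m'}
      {τ₁ τ₂ : Ty k'} :
      CtxTy Γ τ C Γ' τ₁ → HasTy Γ' e₂ τ₂ → CtxTy Γ τ (.pair₁ C e₂) Γ' (.prod τ₁ τ₂)
  | pair₂ {k' m' : ℕ} {Γ' : TyCtx k' m'} {C : Ctx S k m k' m'} {e₁ : Tm S k' m'}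
      {τ₁ τ₂ : Ty k'} :
      HasTy Γ' e₁ τ₁ → CtxTy Γ τ C Γ' τ₂ → CtxTy Γ τ (.pair₂ e₁ C) Γ' (.prod τ₁ τ₂)
  | fst {k' m' : ℕ} {Γ' : TyCtx k' m'} {C : Ctx S k m k' m'} {τ₁ τ₂ : Ty k'} :
      CtxTy Γ τ C Γ' (.prod τ₁ τ₂) → CtxTy Γ τ (.fst C) Γ' τ₁
  | snd {k' m' : ℕ} {Γ' : TyCtx k' m'} {C : Ctx S k m k' m'} {τ₁ τ₂ : Ty k'} :
      CtxTy Γ τ C Γ' (.prod τ₁ τ₂) → CtxTy Γ τ (.snd C) Γ' τ₂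
  | inl {k' m' : ℕ} {Γ' : TyCtx k' m'} {C : Ctx S k m k' m'} {τ₁ τ₂ : Ty k'} :
      CtxTy Γ τ C Γ' τ₁ → CtxTy Γ τ (.inl (.sum τ₁ τ₂) C) Γ' (.sum τ₁ τ₂)
  | inr {k' m' : ℕ} {Γ' : TyCtx k' m'} {C : Ctx S k m k' m'} {τ₁ τ₂ : Ty k'} :
      CtxTy Γ τ C Γ' τ₂ → CtxTy Γ τ (.inr (.sum τ₁ τ₂) C) Γ' (.sum τ₁ τ₂)
  | case₀ {k' m' : ℕ} {Γ' : TyCtx k' m'} {C : Ctx S k m k' m'} {e₁ e₂ : Tm S k' (m' + 1)}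
      {τ₁ τ₂ τ' : Ty k'} :
      CtxTy Γ τ C Γ' (.sum τ₁ τ₂) → HasTy (Γ'.addTm τ₁) e₁ τ' → HasTy (Γ'.addTm τ₂) e₂ τ' →
      CtxTy Γ τ (.case₀ C e₁ e₂) Γ' τ'
  | case₁ {k' m' : ℕ} {Γ' : TyCtx k' m'} {e : Tm S k' m'} {C : Ctx S k m k' (m' + 1)}
      {e₂ : Tm S k' (m' + 1)} {τ₁ τ₂ τ' : Ty k'} :
      HasTy Γ' e (.sum τ₁ τ₂) → CtxTy Γ τ C (Γ'.addTm τ₁) τ' → HasTy (Γ'.addTm τ₂) e₂ τ' →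
      CtxTy Γ τ (.case₁ e C e₂) Γ' τ'
  | case₂ {k' m' : ℕ} {Γ' : TyCtx k' m'} {e : Tm S k' m'} {e₁ : Tm S k' (m' + 1)}
      {C : Ctx S k m k' (m' + 1)} {τ₁ τ₂ τ' : Ty k'} :
      HasTy Γ' e (.sum τ₁ τ₂) → HasTy (Γ'.addTm τ₁) e₁ τ' → CtxTy Γ τ C (Γ'.addTm τ₂) τ' →
      CtxTy Γ τ (.case₂ e e₁ C) Γ' τ'
  | lam {k' m' : ℕ} {Γ' : TyCtx k' m'} {C : Ctx S k m k' (m' + 1)} {τ₁ τ₂ : Ty k'} :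
      CtxTy Γ τ C (Γ'.addTm τ₁) τ₂ → CtxTy Γ τ (.lam τ₁ C) Γ' (.arr τ₁ τ₂)
  | app₁ {k' m' : ℕ} {Γ' : TyCtx k' m'} {C : Ctx S k m k' m'} {e₂ : Tm S k' m'}
      {τ₂ τ' : Ty k'} :
      CtxTy Γ τ C Γ' (.arr τ₂ τ') → HasTy Γ' e₂ τ₂ → CtxTy Γ τ (.app₁ C e₂) Γ' τ'
  | app₂ {k' m' : ℕ} {Γ' : TyCtx k' m'} {C : Ctx S k m k' m'} {e₁ : Tm S k' m'}
      {τ₂ τ' : Ty k'} :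
      HasTy Γ' e₁ (.arr τ₂ τ') → CtxTy Γ τ C Γ' τ₂ → CtxTy Γ τ (.app₂ e₁ C) Γ' τ'
  | tlam {k' m' : ℕ} {Γ' : TyCtx k' m'} {C : Ctx S k m (k' + 1) m'} {τ' : Ty (k' + 1)} :
      CtxTy Γ τ C Γ'.addTy τ' → CtxTy Γ τ (.tlam C) Γ' (.all τ')
  | tapp {k' m' : ℕ} {Γ' : TyCtx k' m'} {C : Ctx S k m k' m'} {τ' : Ty (k' + 1)}
      (τ₁ : Ty k') :
      CtxTy Γ τ C Γ' (.all τ') → CtxTy Γ τ (.tapp C τ₁) Γ' (τ'.inst τ₁)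
  | pack {k' m' : ℕ} {Γ' : TyCtx k' m'} {C : Ctx S k m k' m'} {τ' : Ty (k' + 1)}
      {τ₁ : Ty k'} :
      CtxTy Γ τ C Γ' (τ'.inst τ₁) → CtxTy Γ τ (.pack τ₁ C τ') Γ' (.ex τ')
  | unpack₁ {k' m' : ℕ} {Γ' : TyCtx k' m'} {C : Ctx S k m k' m'}
      {e₂ : Tm S (k' + 1) (m' + 1)} {τ₁ : Ty (k' + 1)} {τ' : Ty k'} :
      CtxTy Γ τ C Γ' (.ex τ₁) → HasTy (Γ'.addTy.addTm τ₁) e₂ (τ'.rename Fin.succ) →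
      CtxTy Γ τ (.unpack₁ C e₂) Γ' τ'
  | unpack₂ {k' m' : ℕ} {Γ' : TyCtx k' m'} {e₁ : Tm S k' m'}
      {C : Ctx S k m (k' + 1) (m' + 1)} {τ₁ : Ty (k' + 1)} {τ' : Ty k'} :
      HasTy Γ' e₁ (.ex τ₁) → CtxTy Γ τ C (Γ'.addTy.addTm τ₁) (τ'.rename Fin.succ) →
      CtxTy Γ τ (.unpack₂ e₁ C) Γ' τ'
  | roll {k' m' : ℕ} {Γ' : TyCtx k' m'} {C : Ctx S k m k' m'} {τ' : Ty (k' + 1)} :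
      CtxTy Γ τ C Γ' (τ'.inst (.mu τ')) → CtxTy Γ τ (.roll (.mu τ') C) Γ' (.mu τ')
  | unroll {k' m' : ℕ} {Γ' : TyCtx k' m'} {C : Ctx S k m k' m'} {τ' : Ty (k' + 1)} :
      CtxTy Γ τ C Γ' (.mu τ') → CtxTy Γ τ (.unroll C) Γ' (τ'.inst (.mu τ'))

end CtxTyping

/-! ## Dynamic semantics of closed terms -/

/-- Evaluation contexts (left-to-right, call-by-value).  In `op o i args E` the entry `args i`
is ignored. -/
inductive ECtx (S : PrimSig) : Type where
  | hole : ECtx S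
  | op (o : S.Op) (i : Fin (S.arity o)) (args : Fin (S.arity o) → Tm S 0 0)
      (hv : ∀ j, j < i → (args j).IsVal) (E : ECtx S) : ECtx S
  | ite (E : ECtx S) (e₁ e₂ : Tm S 0 0) : ECtx S
  | pair₁ (E : ECtx S) (e₂ : Tm S 0 0) : ECtx S
  | pair₂ (v₁ : Tm S 0 0) (hv : v₁.IsVal) (E : ECtx S) : ECtx S
  | fst (E : ECtx S) : ECtx S
  | snd (E : ECtx S) : ECtx S
  | inl (τ : Ty 0) (E : ECtx S) : ECtx S
  | inr (τ : Ty 0) (E : ECtx S) : ECtx S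
  | case (E : ECtx S) (e₁ e₂ : Tm S 0 1) : ECtx S
  | app₁ (E : ECtx S) (e₂ : Tm S 0 0) : ECtx S
  | app₂ (v₁ : Tm S 0 0) (hv : v₁.IsVal) (E : ECtx S) : ECtx S
  | tapp (E : ECtx S) (τ : Ty 0) : ECtx S
  | pack (σ : Ty 0) (E : ECtx S) (τ : Ty 1) : ECtx S
  | unpack (E : ECtx S) (e₂ : Tm S 1 1) : ECtx S
  | roll (τ : Ty 0) (E : ECtx S) : ECtx S
  | unroll (E : ECtx S) : ECtx S

namespace ECtx

variable {S : PrimSig}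

/-- `E[e]`. -/
def fill (t : Tm S 0 0) : ECtx S → Tm S 0 0
  | .hole => t
  | .op o i args _ E => .op o (Function.update args i (fill t E))
  | .ite E e₁ e₂ => .ite (fill t E) e₁ e₂
  | .pair₁ E e₂ => .pair (fill t E) e₂
  | .pair₂ v₁ _ E => .pair v₁ (fill t E)
  | .fst E => .fst (fill t E)
  | .snd E => .snd (fill t E)
  | .inl τ E => .inl τ (fill t E)
  | .inr τ E => .inr τ (fill t E)
  | .case E e₁ e₂ => .case (fill t E) e₁ e₂
  | .app₁ E e₂ => .app (fill t E) e₂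
  | .app₂ v₁ _ E => .app v₁ (fill t E)
  | .tapp E τ => .tapp (fill t E) τ
  | .pack σ E τ => .pack σ (fill t E) τ
  | .unpack E e₂ => .unpack (fill t E) e₂
  | .roll τ E => .roll τ (fill t E)
  | .unroll E => .unroll (fill t E)

/-- Evaluation contexts are program contexts. -/
def toCtx : ECtx S → Ctx S 0 0 0 0
  | .hole => .hole id id
  | .op o i args _ E => .op o i args (toCtx E)
  | .ite E e₁ e₂ => .ite₀ (toCtx E) e₁ e₂
  | .pair₁ E e₂ => .pair₁ (toCtx E) e₂
  | .pair₂ v₁ _ E => .pair₂ v₁ (toCtx E)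
  | .fst E => .fst (toCtx E)
  | .snd E => .snd (toCtx E)
  | .inl τ E => .inl τ (toCtx E)
  | .inr τ E => .inr τ (toCtx E)
  | .case E e₁ e₂ => .case₀ (toCtx E) e₁ e₂
  | .app₁ E e₂ => .app₁ (toCtx E) e₂
  | .app₂ v₁ _ E => .app₂ v₁ (toCtx E)
  | .tapp E τ => .tapp (toCtx E) τ
  | .pack σ E τ => .pack σ (toCtx E) τ
  | .unpack E e₂ => .unpack₁ (toCtx E) e₂
  | .roll τ E => .roll τ (toCtx E)
  | .unroll E => .unroll (toCtx E)

end ECtx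

section Reduction

variable {S : PrimSig}

/-- Redexes and their contracta.  The flag is `true` exactly for the `unroll`-`roll` reduction. -/
inductive Head : Bool → Tm S 0 0 → Tm S 0 0 → Prop where
  | op (o : S.Op) (c : (i : Fin (S.arity o)) → (S.dom o i).Carrier) :
      Head false (.op o (fun i => .lit (S.dom o i) (c i))) (.lit (S.cod o) (S.eval o c))
  | iteTrue (e₁ e₂ : Tm S 0 0) : Head false (.ite (.lit .bool true) e₁ e₂) e₁
  | iteFalse (e₁ e₂ : Tm S 0 0) : Head false (.ite (.lit .bool false) e₁ e₂) e₂
  | fst {v₁ v₂ : Tm S 0 0} : v₁.IsVal → v₂.IsVal → Head false (.fst (.pair v₁ v₂)) v₁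
  | snd {v₁ v₂ : Tm S 0 0} : v₁.IsVal → v₂.IsVal → Head false (.snd (.pair v₁ v₂)) v₂
  | caseInl {τ : Ty 0} {v : Tm S 0 0} {e₁ e₂ : Tm S 0 1} :
      v.IsVal → Head false (.case (.inl τ v) e₁ e₂) (e₁.instTm v)
  | caseInr {τ : Ty 0} {v : Tm S 0 0} {e₁ e₂ : Tm S 0 1} :
      v.IsVal → Head false (.case (.inr τ v) e₁ e₂) (e₂.instTm v)
  | beta {τ : Ty 0} {e : Tm S 0 1} {v : Tm S 0 0} :
      v.IsVal → Head false (.app (.lam τ e) v) (e.instTm v)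
  | tbeta (e : Tm S 1 0) (τ : Ty 0) : Head false (.tapp (.tlam e) τ) (e.instTy τ)
  | unpack {σ : Ty 0} {v : Tm S 0 0} {τ : Ty 1} {e : Tm S 1 1} :
      v.IsVal → Head false (.unpack (.pack σ v τ) e) (e.instBoth σ v)
  | unroll {τ : Ty 0} {v : Tm S 0 0} : v.IsVal → Head true (.unroll (.roll τ v)) v

/-- One step of reduction, `E[e] ⇝ E[e']` for a redex `e` with contractum `e'`. -/
inductive Step (b : Bool) : Tm S 0 0 → Tm S 0 0 → Prop where
  | intro (E : ECtx S) {e e' : Tm S 0 0} : Head b e e' → Step b (E.fill e) (E.fill e')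

/-- `StepsN j e e'`: `e` reduces to `e'` by a finite sequence of steps, exactly `j` of which are
`unroll`-`roll` reductions. -/
inductive StepsN : ℕ → Tm S 0 0 → Tm S 0 0 → Prop where
  | refl (e : Tm S 0 0) : StepsN 0 e e
  | pure {j : ℕ} {e e' e'' : Tm S 0 0} : Step false e e' → StepsN j e' e'' → StepsN j e e''
  | unroll {j : ℕ} {e e' e'' : Tm S 0 0} :
      Step true e e' → StepsN j e' e'' → StepsN (j + 1) e e''

/-- `e ⇝* e'`. -/
def Steps (e e' : Tm S 0 0) : Prop := ∃ j, StepsN j e e'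

/-- `e ⇓`. -/
def Terminates (e : Tm S 0 0) : Prop := ∃ v : Tm S 0 0, Steps e v ∧ v.IsVal

/-- Contextual approximation `Γ ⊢ e₁ ≼ctx e₂ : τ`. -/
def CtxApprox {k m : ℕ} (Γ : TyCtx k m) (e₁ e₂ : Tm S k m) (τ : Ty k) : Prop :=
  HasTy Γ e₁ τ ∧ HasTy Γ e₂ τ ∧
    ∀ (C : Ctx S k m 0 0) (τ' : Ty 0),
      CtxTy Γ τ C TyCtx.nil τ' → Terminates (C.fill e₁) → Terminates (C.fill e₂)

/-- Ciu approximation of closed terms, `⊢ e₁ ≼ciu e₂ : τ`. -/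
def CiuApprox (e₁ e₂ : Tm S 0 0) (τ : Ty 0) : Prop :=
  HasTy TyCtx.nil e₁ τ ∧ HasTy TyCtx.nil e₂ τ ∧
    ∀ (E : ECtx S) (τ' : Ty 0),
      CtxTy TyCtx.nil τ E.toCtx TyCtx.nil τ' → Terminates (E.fill e₁) → Terminates (E.fill e₂)

end Reduction

/-! ## The logic LSLR -/

/-- Relation contexts, given by the list of the arities of their relation variables. -/
abbrev RCtx : Type := List ℕ

/-- The relation variables of arity `a` in a relation context. -/
inductive RVar : RCtx → ℕ → Type where
  | here {Δ : RCtx} {a : ℕ} : RVar (a :: Δ) a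
  | there {Δ : RCtx} {a b : ℕ} (r : RVar Δ a) : RVar (b :: Δ) a

/-- The relations of LSLR: `LRel S k m Δ a` are the relations of arity `a` whose free variables
are among `k` type variables, `m` term variables and the relation variables of `Δ`.  Propositions
are the relations of arity `0`.  Quantification over a context of variables is iterated
quantification over one variable.  In `abs P`, the `n` bound variables `x₁, …, xₙ` have the
indices `0, …, n - 1`. -/
inductive LRel (S : PrimSig) : ℕ → ℕ → RCtx → ℕ → Type where
  | var {k m : ℕ} {Δ : RCtx} {a : ℕ} (r : RVar Δ a) : LRel S k m Δ a
  | eq {k m : ℕ} {Δ : RCtx} (e₁ e₂ : Tm S k m) : LRel S k m Δ 0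
  | val {k m : ℕ} {Δ : RCtx} : LRel S k m Δ 1
  | hasTy {k m : ℕ} {Δ : RCtx} (e : Tm S k m) (τ : Ty k) : LRel S k m Δ 0
  | steps {k m : ℕ} {Δ : RCtx} (e₁ e₂ : Tm S k m) : LRel S k m Δ 0
  | steps₀ {k m : ℕ} {Δ : RCtx} (e₁ e₂ : Tm S k m) : LRel S k m Δ 0
  | steps₁ {k m : ℕ} {Δ : RCtx} (e₁ e₂ : Tm S k m) : LRel S k m Δ 0
  | ciu {k m : ℕ} {Δ : RCtx} (e₁ e₂ : Tm S k m) : LRel S k m Δ 0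
  | top {k m : ℕ} {Δ : RCtx} : LRel S k m Δ 0
  | bot {k m : ℕ} {Δ : RCtx} : LRel S k m Δ 0
  | and {k m : ℕ} {Δ : RCtx} (P Q : LRel S k m Δ 0) : LRel S k m Δ 0
  | or {k m : ℕ} {Δ : RCtx} (P Q : LRel S k m Δ 0) : LRel S k m Δ 0
  | imp {k m : ℕ} {Δ : RCtx} (P Q : LRel S k m Δ 0) : LRel S k m Δ 0
  | allTy {k m : ℕ} {Δ : RCtx} (P : LRel S (k + 1) m Δ 0) : LRel S k m Δ 0
  | exTy {k m : ℕ} {Δ : RCtx} (P : LRel S (k + 1) m Δ 0) : LRel S k m Δ 0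
  | allTm {k m : ℕ} {Δ : RCtx} (P : LRel S k (m + 1) Δ 0) : LRel S k m Δ 0
  | exTm {k m : ℕ} {Δ : RCtx} (P : LRel S k (m + 1) Δ 0) : LRel S k m Δ 0
  | allRel {k m : ℕ} {Δ : RCtx} (a : ℕ) (P : LRel S k m (a :: Δ) 0) : LRel S k m Δ 0
  | exRel {k m : ℕ} {Δ : RCtx} (a : ℕ) (P : LRel S k m (a :: Δ) 0) : LRel S k m Δ 0
  | abs {k m : ℕ} {Δ : RCtx} {n : ℕ} (P : LRel S k (m + n) Δ 0) : LRel S k m Δ n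
  | mem {k m : ℕ} {Δ : RCtx} {n : ℕ} (es : Fin n → Tm S k m) (R : LRel S k m Δ n) :
      LRel S k m Δ 0
  | mu {k m : ℕ} {Δ : RCtx} {n : ℕ} (R : LRel S k m (n :: Δ) n) : LRel S k m Δ n
  | later {k m : ℕ} {Δ : RCtx} (P : LRel S k m Δ 0) : LRel S k m Δ 0

/-- Lift a renaming under `n` binders. -/
def upRenN {m m' : ℕ} (ξ : Fin m → Fin m') : (n : ℕ) → Fin (m + n) → Fin (m' + n)
  | 0 => ξ
  | n + 1 => upRen (upRenN ξ n)

/-- Lift a renaming of relation variables under a binder. -/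
def upRVar {Δ Δ' : RCtx} {b : ℕ} (η : ∀ a, RVar Δ a → RVar Δ' a) :
    ∀ a, RVar (b :: Δ) a → RVar (b :: Δ') a
  | _, .here => .here
  | _, .there r => .there (η _ r)

/-- Extend an assignment of `m` variables by values for the `n` new variables `0, …, n - 1`. -/
def pushN {A : Type} {m : ℕ} (f : Fin m → A) : (n : ℕ) → (Fin n → A) → Fin (m + n) → A
  | 0, _ => f
  | n + 1, as => push (as 0) (pushN f n (fun i => as i.succ))

namespace LRel

variable {S : PrimSig}

/-- Renaming of the type, term and relation variables of a relation. -/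
def rename : {k k' m m' : ℕ} → {Δ Δ' : RCtx} → {a : ℕ} →
    (Fin k → Fin k') → (Fin m → Fin m') → (∀ a, RVar Δ a → RVar Δ' a) →
    LRel S k m Δ a → LRel S k' m' Δ' a
  | _, _, _, _, _, _, _, _, _, η, .var r => .var (η _ r)
  | _, _, _, _, _, _, _, ζ, ξ, _, .eq e₁ e₂ => .eq (e₁.rename ζ ξ) (e₂.rename ζ ξ)
  | _, _, _, _, _, _, _, _, _, _, .val => .val
  | _, _, _, _, _, _, _, ζ, ξ, _, .hasTy e τ => .hasTy (e.rename ζ ξ) (τ.rename ζ)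
  | _, _, _, _, _, _, _, ζ, ξ, _, .steps e₁ e₂ => .steps (e₁.rename ζ ξ) (e₂.rename ζ ξ)
  | _, _, _, _, _, _, _, ζ, ξ, _, .steps₀ e₁ e₂ => .steps₀ (e₁.rename ζ ξ) (e₂.rename ζ ξ)
  | _, _, _, _, _, _, _, ζ, ξ, _, .steps₁ e₁ e₂ => .steps₁ (e₁.rename ζ ξ) (e₂.rename ζ ξ)
  | _, _, _, _, _, _, _, ζ, ξ, _, .ciu e₁ e₂ => .ciu (e₁.rename ζ ξ) (e₂.rename ζ ξ)
  | _, _, _, _, _, _, _, _, _, _, .top => .top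
  | _, _, _, _, _, _, _, _, _, _, .bot => .bot
  | _, _, _, _, _, _, _, ζ, ξ, η, .and P Q => .and (P.rename ζ ξ η) (Q.rename ζ ξ η)
  | _, _, _, _, _, _, _, ζ, ξ, η, .or P Q => .or (P.rename ζ ξ η) (Q.rename ζ ξ η)
  | _, _, _, _, _, _, _, ζ, ξ, η, .imp P Q => .imp (P.rename ζ ξ η) (Q.rename ζ ξ η)
  | _, _, _, _, _, _, _, ζ, ξ, η, .allTy P => .allTy (P.rename (upRen ζ) ξ η)
  | _, _, _, _, _, _, _, ζ, ξ, η, .exTy P => .exTy (P.rename (upRen ζ) ξ η)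
  | _, _, _, _, _, _, _, ζ, ξ, η, .allTm P => .allTm (P.rename ζ (upRen ξ) η)
  | _, _, _, _, _, _, _, ζ, ξ, η, .exTm P => .exTm (P.rename ζ (upRen ξ) η)
  | _, _, _, _, _, _, _, ζ, ξ, η, .allRel a P => .allRel a (P.rename ζ ξ (upRVar η))
  | _, _, _, _, _, _, _, ζ, ξ, η, .exRel a P => .exRel a (P.rename ζ ξ (upRVar η))
  | _, _, _, _, _, _, _, ζ, ξ, η, .abs P => .abs (P.rename ζ (upRenN ξ _) η)
  | _, _, _, _, _, _, _, ζ, ξ, η, .mem es R =>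
      .mem (fun i => (es i).rename ζ ξ) (R.rename ζ ξ η)
  | _, _, _, _, _, _, _, ζ, ξ, η, .mu R => .mu (R.rename ζ ξ (upRVar η))
  | _, _, _, _, _, _, _, ζ, ξ, η, .later P => .later (P.rename ζ ξ η)

/-- Weakening by `n` term variables. -/
def wkTm {k m : ℕ} {Δ : RCtx} {a : ℕ} (n : ℕ) (R : LRel S k m Δ a) : LRel S k (m + n) Δ a :=
  R.rename id (fun x => x.addNat n) (fun _ r => r)

/-- Weakening by `n` type variables. -/
def wkTy {k m : ℕ} {Δ : RCtx} {a : ℕ} (n : ℕ) (R : LRel S k m Δ a) : LRel S (k + n) m Δ a :=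
  R.rename (fun x => x.addNat n) id (fun _ r => r)

/-- Weakening by one relation variable of arity `b`. -/
def wkRel {k m : ℕ} {Δ : RCtx} {a : ℕ} (b : ℕ) (R : LRel S k m Δ a) : LRel S k m (b :: Δ) a :=
  R.rename id id (fun _ r => .there r)

end LRel

/-! ## The Kripke model of LSLR -/

/-- World-indexed relations of arity `a` between closed terms. -/
abbrev WRel (S : PrimSig) (a : ℕ) : Type := ℕ → (Fin a → Tm S 0 0) → Prop

/-- Monotonicity: what is true in a world is true in all future (that is, smaller) worlds. -/
def WRel.Mono {S : PrimSig} {a : ℕ} (R : WRel S a) : Prop :=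
  ∀ (n n' : ℕ) (es : Fin a → Tm S 0 0), n' ≤ n → R n es → R n' es

/-- The recursive world-indexed relation given by `F`: its meaning in world `n` is that of `F`
applied to its own meaning in the strictly future worlds. -/
def WRel.fix {S : PrimSig} {a : ℕ} (F : WRel S a → WRel S a) (n : ℕ) :
    (Fin a → Tm S 0 0) → Prop :=
  F (fun n' es => ∀ _h : n' < n, WRel.fix F n' es) n
termination_by n

/-- Interpretations of the relation variables of `Δ`. -/
abbrev REnv (S : PrimSig) (Δ : RCtx) : Type := ∀ a, RVar Δ a → WRel S a

/-- Extend an interpretation by a relation for a new relation variable. -/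
def REnv.push {S : PrimSig} {Δ : RCtx} {b : ℕ} (R : WRel S b) (δ : REnv S Δ) :
    REnv S (b :: Δ)
  | _, .here => R
  | _, .there r => δ _ r

/-- The interpretation of a relation in world `n`, under a closing substitution `σ`, `θ` of the
type and term variables and an interpretation `δ` of the relation variables.  In world `0`
everything is true.  A recursive relation `mu R` is meaningful for `R` contractive in the bound
variable `r`, that is, if `r` occurs in `R` only below `later` (all recursive relations below are
of this form): then `R` consults `r` in strictly future worlds only, and `mu R` has in every world
the same meaning as `R` with `mu R` for `r`. -/
def LRel.interp {S : PrimSig} : {k m : ℕ} → {Δ : RCtx} → {a : ℕ} → LRel S k m Δ a →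
    (Fin k → Ty 0) → (Fin m → Tm S 0 0) → REnv S Δ → WRel S a
  | _, _, _, _, _, _, _, _, 0, _ => True
  | _, _, _, _, .var r, _, _, δ, n + 1, es => δ _ r (n + 1) es
  | _, _, _, _, .eq e₁ e₂, σ, θ, _, _ + 1, _ => e₁.subst σ θ = e₂.subst σ θ
  | _, _, _, _, .val, _, _, _, _ + 1, es => (es 0).IsVal
  | _, _, _, _, .hasTy e τ, σ, θ, _, _ + 1, _ => HasTy TyCtx.nil (e.subst σ θ) (τ.subst σ)
  | _, _, _, _, .steps e₁ e₂, σ, θ, _, _ + 1, _ => Steps (e₁.subst σ θ) (e₂.subst σ θ)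
  | _, _, _, _, .steps₀ e₁ e₂, σ, θ, _, _ + 1, _ => StepsN 0 (e₁.subst σ θ) (e₂.subst σ θ)
  | _, _, _, _, .steps₁ e₁ e₂, σ, θ, _, _ + 1, _ => StepsN 1 (e₁.subst σ θ) (e₂.subst σ θ)
  | _, _, _, _, .ciu e₁ e₂, σ, θ, _, _ + 1, _ =>
      ∃ τ : Ty 0, CiuApprox (e₁.subst σ θ) (e₂.subst σ θ) τ
  | _, _, _, _, .top, _, _, _, _ + 1, _ => True
  | _, _, _, _, .bot, _, _, _, _ + 1, _ => False
  | _, _, _, _, .and P Q, σ, θ, δ, n + 1, es =>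
      P.interp σ θ δ (n + 1) es ∧ Q.interp σ θ δ (n + 1) es
  | _, _, _, _, .or P Q, σ, θ, δ, n + 1, es =>
      P.interp σ θ δ (n + 1) es ∨ Q.interp σ θ δ (n + 1) es
  | _, _, _, _, .imp P Q, σ, θ, δ, n + 1, es =>
      ∀ j ≤ n + 1, P.interp σ θ δ j es → Q.interp σ θ δ j es
  | _, _, _, _, .allTy P, σ, θ, δ, n + 1, es =>
      ∀ τ : Ty 0, P.interp (push τ σ) θ δ (n + 1) es
  | _, _, _, _, .exTy P, σ, θ, δ, n + 1, es =>
      ∃ τ : Ty 0, P.interp (push τ σ) θ δ (n + 1) es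
  | _, _, _, _, .allTm P, σ, θ, δ, n + 1, es =>
      ∀ e : Tm S 0 0, P.interp σ (push e θ) δ (n + 1) es
  | _, _, _, _, .exTm P, σ, θ, δ, n + 1, es =>
      ∃ e : Tm S 0 0, P.interp σ (push e θ) δ (n + 1) es
  | _, _, _, _, .allRel a P, σ, θ, δ, n + 1, es =>
      ∀ R : WRel S a, R.Mono → P.interp σ θ (δ.push R) (n + 1) es
  | _, _, _, _, .exRel a P, σ, θ, δ, n + 1, es =>
      ∃ R : WRel S a, R.Mono ∧ P.interp σ θ (δ.push R) (n + 1) es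
  | _, _, _, _, .abs P, σ, θ, δ, n + 1, es =>
      P.interp σ (pushN θ _ es) δ (n + 1) Fin.elim0
  | _, _, _, _, .mem es R, σ, θ, δ, n + 1, _ =>
      R.interp σ θ δ (n + 1) (fun i => (es i).subst σ θ)
  | _, _, _, _, .mu R, σ, θ, δ, n + 1, es =>
      WRel.fix (fun X => R.interp σ θ (δ.push X)) (n + 1) es
  | _, _, _, _, .later P, σ, θ, δ, n + 1, es => P.interp σ θ δ n es

/-- The judgment `𝒳; ℛ; 𝒫 ⊢ P`, where `𝒳` consists of `k` type and `m` term variables and `ℛ`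
is `Δ`. -/
def Entails {S : PrimSig} {k m : ℕ} {Δ : RCtx} (Ps : Set (LRel S k m Δ 0))
    (P : LRel S k m Δ 0) : Prop :=
  ∀ (n : ℕ) (σ : Fin k → Ty 0) (θ : Fin m → Tm S 0 0) (δ : REnv S Δ),
    (∀ a r, (δ a r).Mono) →
    (∀ Q ∈ Ps, Q.interp σ θ δ n Fin.elim0) → P.interp σ θ δ n Fin.elim0

/-! ## The logical relation -/

namespace LRel

variable {S : PrimSig} {k m : ℕ} {Δ : RCtx}

/-- `e ∈ Val`. -/
def isVal (e : Tm S k m) : LRel S k m Δ 0 := .mem ![e] .val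

/-- `e ↓ τ`. -/
def valTy (e : Tm S k m) (τ : Ty k) : LRel S k m Δ 0 := .and (.hasTy e τ) (isVal e)

/-- `e₁ ⇓⁰ e₂`. -/
def evals₀ (e₁ e₂ : Tm S k m) : LRel S k m Δ 0 := .and (.steps₀ e₁ e₂) (isVal e₂)

/-- `R : VRel(τ₁, τ₂)`. -/
def isVRel (R : LRel S k m Δ 2) (τ₁ τ₂ : Ty k) : LRel S k m Δ 0 :=
  .allTm (.allTm (.imp (.mem ![.var 1, .var 0] (R.wkTm 2))
    (.and (valTy (.var 1) τ₁) (valTy (.var 0) τ₂))))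

/-- `(x₁ : τ₁, x₂ : τ₂). P`, where `x₁`, `x₂` are the term variables `0`, `1` of `P`. -/
def absTm (τ₁ τ₂ : Ty k) (P : LRel S k (m + 2) Δ 0) : LRel S k m Δ 2 :=
  .abs (.and (.hasTy (.var 0) τ₁) (.and (.hasTy (.var 1) τ₂) P))

/-- `(x₁ ↓ τ₁, x₂ ↓ τ₂). P`, where `x₁`, `x₂` are the term variables `0`, `1` of `P`. -/
def absVal (τ₁ τ₂ : Ty k) (P : LRel S k (m + 2) Δ 0) : LRel S k m Δ 2 :=
  .abs (.and (valTy (.var 0) τ₁) (.and (valTy (.var 1) τ₂) P))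

/-- The relation on terms of types `τ₁`, `τ₂` induced by a relation `V` on values:
`μ r. (t₁ : τ₁, t₂ : τ₂).
  (∀ x₁. t₁ ⇓⁰ x₁ ⇒ ∃ x₂. x₂ ≼ t₂ ∧ (x₁, x₂) ∈ V) ∧ (∀ t₁'. t₁ ⇝¹ t₁' ⇒ ▷ (t₁', t₂) ∈ r)`. -/
def compRel (τ₁ τ₂ : Ty k) (V : LRel S k m Δ 2) : LRel S k m Δ 2 :=
  .mu (absTm τ₁ τ₂ (.and
    (.allTm (.imp (evals₀ (.var 1) (.var 0))
      (.exTm (.and (.ciu (.var 0) (.var 3))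
        (.mem ![.var 1, .var 0] ((V.wkRel 2).wkTm 4))))))
    (.allTm (.imp (.steps₁ (.var 1) (.var 0))
      (.later (.mem ![.var 0, .var 2] (.var .here)))))))

end LRel

/-- Relational interpretations `ρ` of `j` type variables: each is mapped to a triple
`(τ₁, τ₂, R)`. -/
abbrev RelInterp (S : PrimSig) (j k m : ℕ) (Δ : RCtx) : Type :=
  Fin j → Ty k × Ty k × LRel S k m Δ 2

namespace RelInterp

variable {S : PrimSig} {j k m : ℕ} {Δ : RCtx}

/-- The type substitution `ρ₁`. -/
def left (ρ : RelInterp S j k m Δ) : Fin j → Ty k := fun i => (ρ i).1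

/-- The type substitution `ρ₂`. -/
def right (ρ : RelInterp S j k m Δ) : Fin j → Ty k := fun i => (ρ i).2.1

/-- Weakening by `a` type variables, `b` term variables and one relation variable of arity 2. -/
def wk (a b : ℕ) (ρ : RelInterp S j k m Δ) : RelInterp S j (k + a) (m + b) (2 :: Δ) :=
  fun i => ((ρ i).1.rename (fun x => x.addNat a), (ρ i).2.1.rename (fun x => x.addNat a),
    (((ρ i).2.2.wkTy a).wkTm b).wkRel 2)

/-- `ρ, α ↦ (τ₁, τ₂, R)`. -/
def extend (ρ : RelInterp S j k m Δ) (τ₁ τ₂ : Ty k) (R : LRel S k m Δ 2) :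
    RelInterp S (j + 1) k m Δ :=
  push (τ₁, τ₂, R) ρ

end RelInterp

open LRel in
/-- The logical relation `𝒱⟦τ⟧ρ` on values, where `compRel (ρ₁ τ) (ρ₂ τ) (𝒱⟦τ⟧ρ)` is the logical
relation `𝒞⟦τ⟧ρ` on terms. -/
def VRel {S : PrimSig} : {j k m : ℕ} → {Δ : RCtx} → Ty j → RelInterp S j k m Δ →
    LRel S k m Δ 2
  | _, _, _, _, .var i, ρ => (ρ i).2.2
  | _, _, _, _, .base b, _ => absVal (.base b) (.base b) (.eq (.var 0) (.var 1))
  | _, _, _, _, .prod τ' τ'', ρ =>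
      absVal ((Ty.prod τ' τ'').subst ρ.left) ((Ty.prod τ' τ'').subst ρ.right)
        -- `∃ x₁' x₁'' x₂' x₂''`, with indices `3`, `2`, `1`, `0`; `x₁`, `x₂` become `4`, `5`
        (.exTm (.exTm (.exTm (.exTm
          (.and (.eq (.var 4) (.pair (.var 3) (.var 2)))
          (.and (.eq (.var 5) (.pair (.var 1) (.var 0)))
          (.and (.mem ![.var 3, .var 1] ((VRel τ' ρ).wkTm 6))
            (.mem ![.var 2, .var 0] ((VRel τ'' ρ).wkTm 6)))))))))
  | _, _, _, _, .sum τ' τ'', ρ =>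
      absVal ((Ty.sum τ' τ'').subst ρ.left) ((Ty.sum τ' τ'').subst ρ.right)
        (.or
          (.exTm (.exTm
            (.and (.eq (.var 2) (.inl ((Ty.sum τ' τ'').subst ρ.left) (.var 1)))
            (.and (.eq (.var 3) (.inl ((Ty.sum τ' τ'').subst ρ.right) (.var 0)))
              (.mem ![.var 1, .var 0] ((VRel τ' ρ).wkTm 4))))))
          (.exTm (.exTm
            (.and (.eq (.var 2) (.inr ((Ty.sum τ' τ'').subst ρ.left) (.var 1)))
            (.and (.eq (.var 3) (.inr ((Ty.sum τ' τ'').subst ρ.right) (.var 0)))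
              (.mem ![.var 1, .var 0] ((VRel τ'' ρ).wkTm 4)))))))
  | _, _, _, _, .arr τ' τ'', ρ =>
      absVal ((Ty.arr τ' τ'').subst ρ.left) ((Ty.arr τ' τ'').subst ρ.right)
        (.allTm (.allTm (.imp (.mem ![.var 1, .var 0] ((VRel τ' ρ).wkTm 4))
          (.mem ![.app (.var 2) (.var 1), .app (.var 3) (.var 0)]
            ((compRel (τ''.subst ρ.left) (τ''.subst ρ.right) (VRel τ'' ρ)).wkTm 4)))))
  | _, _, _, _, .all τ, ρ =>
      absVal ((Ty.all τ).subst ρ.left) ((Ty.all τ).subst ρ.right)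
        -- `∀ α₁ α₂`, with indices `1`, `0`
        (.allTy (.allTy (.allRel 2
          (let ρ' := (ρ.wk 2 2).extend (.var 1) (.var 0) (.var .here)
          .imp (isVRel (.var .here) (.var 1) (.var 0))
            (.mem ![.tapp (.var 0) (.var 1), .tapp (.var 1) (.var 0)]
              (compRel (τ.subst ρ'.left) (τ.subst ρ'.right) (VRel τ ρ')))))))
  | _, _, _, _, .ex τ, ρ =>
      absVal ((Ty.ex τ).subst ρ.left) ((Ty.ex τ).subst ρ.right)
        -- `∃ α₁ α₂ y₁ y₂`, with indices `1`, `0` and `1`, `0`; `x₁`, `x₂` become `2`, `3`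
        (.exTy (.exTy (.exTm (.exTm (.exRel 2
          (let ρ₀ := ρ.wk 2 4
          .and (isVRel (.var .here) (.var 1) (.var 0))
            (.and (.eq (.var 2) (.pack (.var 1) (.var 1) (τ.subst (Ty.up ρ₀.left))))
            (.and (.eq (.var 3) (.pack (.var 0) (.var 0) (τ.subst (Ty.up ρ₀.right))))
              (.mem ![.var 1, .var 0]
                (VRel τ (ρ₀.extend (.var 1) (.var 0) (.var .here))))))))))))
  | _, _, _, _, .mu τ, ρ =>
      .mu (absVal ((Ty.mu τ).subst ρ.left) ((Ty.mu τ).subst ρ.right)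
        (.exTm (.exTm
          (.and (.eq (.var 2) (.roll ((Ty.mu τ).subst ρ.left) (.var 1)))
          (.and (.eq (.var 3) (.roll ((Ty.mu τ).subst ρ.right) (.var 0)))
            (.later (.mem ![.var 1, .var 0]
              (VRel τ ((ρ.wk 0 4).extend ((Ty.mu τ).subst ρ.left) ((Ty.mu τ).subst ρ.right)
                (.var .here))))))))))

/-- The logical relation `𝒞⟦τ⟧ρ` on terms. -/
def CRel {S : PrimSig} {j k m : ℕ} {Δ : RCtx} (τ : Ty j) (ρ : RelInterp S j k m Δ) :
    LRel S k m Δ 2 :=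
  LRel.compRel (τ.subst ρ.left) (τ.subst ρ.right) (VRel τ ρ)

/-! ## Logical approximation -/

/-- The relation context `r₁, …, rₖ` of binary relation variables. -/
def binRels (k : ℕ) : RCtx := List.replicate k 2

/-- The relation variable `rᵢ` of `binRels k`. -/
def binRel : {k : ℕ} → Fin k → RVar (binRels k) 2
  | _ + 1, ⟨0, _⟩ => .here
  | _ + 1, ⟨i + 1, h⟩ => .there (binRel ⟨i, Nat.lt_of_succ_lt_succ h⟩)

section LogApprox

variable {S : PrimSig} {k m : ℕ}

/-- The variables `αᵢ¹`, `αᵢ²` are the type variables `i` and `k + i`, and `xᵢ¹`, `xᵢ²` are the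
term variables `i` and `m + i`.  This is the interpretation `αᵢ ↦ (αᵢ¹, αᵢ², rᵢ)`. -/
def canonInterp (S : PrimSig) (k m : ℕ) : RelInterp S k (k + k) (m + m) (binRels k) :=
  fun i => (.var (Fin.castAdd k i), .var (Fin.natAdd k i), .var (binRel i))

/-- The propositions `rᵢ : VRel(αᵢ¹, αᵢ²)` and `(xᵢ¹, xᵢ²) ∈ 𝒱⟦Γ(xᵢ)⟧ρ`. -/
def canonHyps (S : PrimSig) (Γ : TyCtx k m) : Set (LRel S (k + k) (m + m) (binRels k) 0) :=
  Set.range (fun i : Fin k =>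
    LRel.isVRel (.var (binRel i)) (.var (Fin.castAdd k i)) (.var (Fin.natAdd k i))) ∪
  Set.range (fun x : Fin m =>
    LRel.mem ![.var (Fin.castAdd m x), .var (Fin.natAdd m x)] (VRel (Γ x) (canonInterp S k m)))

/-- Logical approximation `Γ ⊢ e₁ ≼log e₂ : τ`. -/
def LogApprox (Γ : TyCtx k m) (e₁ e₂ : Tm S k m) (τ : Ty k) : Prop :=
  HasTy Γ e₁ τ ∧ HasTy Γ e₂ τ ∧
    Entails (canonHyps S Γ)
      (.mem ![e₁.subst (canonInterp S k m).left (fun x => .var (Fin.castAdd m x)),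
          e₂.subst (canonInterp S k m).right (fun x => .var (Fin.natAdd m x))]
        (CRel τ (canonInterp S k m)))

end LogApprox

end FMu

/-!
Logical approximation is interpreted in the model: `SV τ ρ` is the world-indexed relation on closed
values denoted by `𝒱⟦τ⟧ρ` (`interp_VRel`), for `ρ` a semantic interpretation of the type
variables, and the recursive relation `𝒞⟦τ⟧ρ` denotes `SC`, which has an explicit description: if
the left term evaluates with `i` unroll reductions, then in all worlds `w` with `w + i ≤ n` its
value is related to a value that is ciu below the right term (`fix_compStep`, by subject
reduction).

In this form the relation on terms has a bind principle for evaluation contexts (`SE.bind`). It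
rests on two facts: the evaluation of `E[e]` begins with an evaluation of `e`, whose unroll
reductions are paid for by passing to a smaller world (`StepsN.of_fill`), and ciu approximation is
transitive and preserved by evaluation contexts (`Ciu.fill`). With determinism of reduction,
monotonicity of `SV` (`SV_mono`) and its compatibility with type substitution (`SV_subst`), every
term constructor preserves semantic logical approximation `SLog`. For `unroll` the reduction
consumes exactly the world that the modality `▷` in the clause of `μα.τ` gives away
(`SE.unroll`). That this clause is contractive, so that `SV (μα.τ)` is a fixed point, is
`SV_congr`.

Hence well-typed terms approximate themselves (`HasTy.sLog`) and program contexts preserve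
approximation (`SLog.fill`). It remains to see that approximation of closed terms preserves
termination (`SLog.terminates`): an evaluation of `C[e₁]` with `i` unroll reductions yields, in
world `i + 1`, a value that is ciu below `C[e₂]`.
-/

namespace FMu

/-! ### Substitution on types -/

theorem comp_push {A B : Type} {n : ℕ} (g : A → B) (a : A) (f : Fin n → A) :
    (fun i => g (push a f i)) = push (g a) (fun i => g (f i)) := by
  funext i; refine Fin.cases ?_ (fun i => ?_) i <;> rfl

theorem push_comp_upRen {A : Type} {n n' : ℕ} (a : A) (f : Fin n' → A) (ξ : Fin n → Fin n') :
    (fun i => push a f (upRen ξ i)) = push a (fun i => f (ξ i)) := by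
  funext i; refine Fin.cases ?_ (fun i => ?_) i <;> rfl

theorem upRen_upRen {n n' n'' : ℕ} (ξ' : Fin n' → Fin n'') (ξ : Fin n → Fin n') :
    (fun i => upRen ξ' (upRen ξ i)) = upRen (fun i => ξ' (ξ i)) := by
  funext i; refine Fin.cases ?_ (fun i => ?_) i <;> rfl

theorem upRen_id {n : ℕ} : upRen (id : Fin n → Fin n) = id := by
  funext i; refine Fin.cases ?_ (fun i => ?_) i <;> rfl

namespace Ty

theorem rename_rename {k k' k'' : ℕ} (ξ' : Fin k' → Fin k'') (ξ : Fin k → Fin k') (τ : Ty k) :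
    (τ.rename ξ).rename ξ' = τ.rename (fun i => ξ' (ξ i)) := by
  induction τ generalizing k' k'' <;> simp [rename, upRen_upRen, *]

theorem rename_id {k : ℕ} (τ : Ty k) : τ.rename id = τ := by
  induction τ <;> simp [rename, upRen_id, *]

theorem up_comp_upRen {k k' k'' : ℕ} (σ : Fin k' → Ty k'') (ξ : Fin k → Fin k') :
    (fun i => up σ (upRen ξ i)) = up (fun i => σ (ξ i)) :=
  push_comp_upRen _ _ _

theorem subst_rename {k k' k'' : ℕ} (σ : Fin k' → Ty k'') (ξ : Fin k → Fin k') (τ : Ty k) :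
    (τ.rename ξ).subst σ = τ.subst (fun i => σ (ξ i)) := by
  induction τ generalizing k' k'' <;> simp [rename, subst, up_comp_upRen, *]

theorem rename_up {k k' k'' : ℕ} (ξ : Fin k' → Fin k'') (σ : Fin k → Ty k') :
    (fun i => (up σ i).rename (upRen ξ)) = up (fun i => (σ i).rename ξ) := by
  funext i; refine Fin.cases ?_ (fun i => ?_) i
  · rfl
  · simp only [up, push, Fin.cons_succ, rename_rename]; rfl

theorem rename_subst {k k' k'' : ℕ} (ξ : Fin k' → Fin k'') (σ : Fin k → Ty k') (τ : Ty k) :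
    (τ.subst σ).rename ξ = τ.subst (fun i => (σ i).rename ξ) := by
  induction τ generalizing k' k'' <;> simp [rename, subst, rename_up, *]

theorem subst_up {k k' k'' : ℕ} (σ' : Fin k' → Ty k'') (σ : Fin k → Ty k') :
    (fun i => (up σ i).subst (up σ')) = up (fun i => (σ i).subst σ') := by
  funext i; refine Fin.cases ?_ (fun i => ?_) i
  · rfl
  · simp only [up, push, Fin.cons_succ, rename_subst, subst_rename]

theorem subst_subst {k k' k'' : ℕ} (σ' : Fin k' → Ty k'') (σ : Fin k → Ty k') (τ : Ty k) :
    (τ.subst σ).subst σ' = τ.subst (fun i => (σ i).subst σ') := by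
  induction τ generalizing k' k'' <;> simp [subst, subst_up, *]

theorem up_var {k : ℕ} : up (var : Fin k → Ty k) = var := by
  funext i; refine Fin.cases ?_ (fun i => ?_) i <;> rfl

theorem subst_var {k : ℕ} (τ : Ty k) : τ.subst var = τ := by
  induction τ <;> simp [subst, up_var, *]

theorem rename_succ_injective {k : ℕ} :
    Function.Injective (rename Fin.succ : Ty k → Ty (k + 1)) := by
  intro τ τ' hτ
  have h := congrArg (subst (push (.base .unit) var)) hτ
  simp only [subst_rename, push, Fin.cons_succ] at h
  exact (subst_var τ).symm.trans (h.trans (subst_var τ'))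

theorem rename_inst {k k' : ℕ} (ξ : Fin k → Fin k') (τ : Ty (k + 1)) (τ' : Ty k) :
    (τ.inst τ').rename ξ = (τ.rename (upRen ξ)).inst (τ'.rename ξ) := by
  simp only [inst, rename_subst, subst_rename, push_comp_upRen, comp_push (rename ξ)]
  rfl

theorem subst_inst {k k' : ℕ} (σ : Fin k → Ty k') (τ : Ty (k + 1)) (τ' : Ty k) :
    (τ.inst τ').subst σ = (τ.subst (up σ)).inst (τ'.subst σ) := by
  simp only [inst, subst_subst]
  congr 1; funext i; refine Fin.cases ?_ (fun i => ?_) i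
  · rfl
  · simp only [up, push, Fin.cons_succ, subst_rename, subst_var, subst]

theorem inst_up {k k' : ℕ} (σ : Fin k → Ty k') (τ : Ty (k + 1)) (τ' : Ty k') :
    (τ.subst (up σ)).inst τ' = τ.subst (push τ' σ) := by
  simp only [inst, subst_subst]
  congr 1; funext i; refine Fin.cases ?_ (fun i => ?_) i
  · rfl
  · simp only [up, push, Fin.cons_succ, subst_rename, subst_var]

theorem inst_subst {k k' : ℕ} (τ : Ty (k + 1)) (τ' : Ty k) (σ : Fin k → Ty k') :
    (τ.inst τ').subst σ = τ.subst (push (τ'.subst σ) σ) := by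
  rw [subst_inst, inst_up]

end Ty

/-! ### Substitution on terms -/

namespace Tm

variable {S : PrimSig}

theorem rename_rename {k k' k'' m m' m'' : ℕ} (ζ' : Fin k' → Fin k'') (ξ' : Fin m' → Fin m'')
    (ζ : Fin k → Fin k') (ξ : Fin m → Fin m') (e : Tm S k m) :
    (e.rename ζ ξ).rename ζ' ξ' = e.rename (fun i => ζ' (ζ i)) (fun i => ξ' (ξ i)) := by
  induction e generalizing k' k'' m' m'' <;>
    simp [rename, upRen_upRen, Ty.rename_rename, *]

theorem up_comp_upRen {k m m' m'' : ℕ} (θ : Fin m' → Tm S k m'') (ξ : Fin m → Fin m') :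
    (fun i => up θ (upRen ξ i)) = up (fun i => θ (ξ i)) :=
  push_comp_upRen _ _ _

theorem subst_rename {k k' k'' m m' m'' : ℕ} (σ : Fin k' → Ty k'') (θ : Fin m' → Tm S k'' m'')
    (ζ : Fin k → Fin k') (ξ : Fin m → Fin m') (e : Tm S k m) :
    (e.rename ζ ξ).subst σ θ = e.subst (fun i => σ (ζ i)) (fun i => θ (ξ i)) := by
  induction e generalizing k' k'' m' m'' with
  | tlam e ih => simp [rename, subst, ih, Ty.up_comp_upRen]; rfl
  | unpack e e' ih ih' => simp [rename, subst, ih, ih', Ty.up_comp_upRen, up_comp_upRen]; rfl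
  | _ => simp [rename, subst, up_comp_upRen, Ty.up_comp_upRen, Ty.subst_rename, *]

theorem rename_up {k k' m m' m'' : ℕ} (ζ : Fin k → Fin k') (ξ : Fin m' → Fin m'')
    (θ : Fin m → Tm S k m') :
    (fun i => (up θ i).rename ζ (upRen ξ)) = up (fun i => (θ i).rename ζ ξ) := by
  funext i; refine Fin.cases ?_ (fun i => ?_) i
  · rfl
  · simp only [up, push, Fin.cons_succ, rename_rename]; rfl

theorem rename_upTy {k k' m m' m'' : ℕ} (ζ : Fin k → Fin k') (ξ : Fin m' → Fin m'')
    (θ : Fin m → Tm S k m') :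
    (fun i => (upTy θ i).rename (upRen ζ) ξ) = upTy (fun i => (θ i).rename ζ ξ) := by
  funext i
  simp only [upTy, rename_rename]; rfl

theorem rename_subst {k k' k'' m m' m'' : ℕ} (ζ : Fin k' → Fin k'') (ξ : Fin m' → Fin m'')
    (σ : Fin k → Ty k') (θ : Fin m → Tm S k' m') (e : Tm S k m) :
    (e.subst σ θ).rename ζ ξ =
      e.subst (fun i => (σ i).rename ζ) (fun i => (θ i).rename ζ ξ) := by
  induction e generalizing k' k'' m' m'' <;>
    simp [rename, subst, rename_up, rename_upTy, Ty.rename_up, Ty.rename_subst, *]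

theorem subst_up {k k' m m' m'' : ℕ} (σ : Fin k → Ty k') (θ' : Fin m' → Tm S k' m'')
    (θ : Fin m → Tm S k m') :
    (fun i => (up θ i).subst σ (up θ')) = up (fun i => (θ i).subst σ θ') := by
  funext i; refine Fin.cases ?_ (fun i => ?_) i
  · rfl
  · simp only [up, push, Fin.cons_succ, subst_rename, rename_subst, Ty.rename_id, id]

theorem subst_upTy {k k' m m' m'' : ℕ} (σ : Fin k → Ty k') (θ' : Fin m' → Tm S k' m'')
    (θ : Fin m → Tm S k m') :
    (fun i => (upTy θ i).subst (Ty.up σ) (upTy θ')) = upTy (fun i => (θ i).subst σ θ') := by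
  funext i
  simp only [upTy, subst_rename, rename_subst]; rfl

theorem subst_subst {k k' k'' m m' m'' : ℕ} (σ' : Fin k' → Ty k'') (θ' : Fin m' → Tm S k'' m'')
    (σ : Fin k → Ty k') (θ : Fin m → Tm S k' m') (e : Tm S k m) :
    (e.subst σ θ).subst σ' θ' =
      e.subst (fun i => (σ i).subst σ') (fun i => (θ i).subst σ' θ') := by
  induction e generalizing k' k'' m' m'' <;>
    simp [subst, subst_up, subst_upTy, Ty.subst_up, Ty.subst_subst, *]

theorem up_var {k m : ℕ} : up (var : Fin m → Tm S k m) = var := by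
  funext i; refine Fin.cases ?_ (fun i => ?_) i <;> rfl

theorem upTy_var {k m : ℕ} : upTy (var : Fin m → Tm S k m) = var := rfl

theorem subst_var {k m : ℕ} (e : Tm S k m) : e.subst .var .var = e := by
  induction e <;> simp [subst, up_var, upTy_var, Ty.up_var, Ty.subst_var, *]

theorem subst_closed (e : Tm S 0 0) (σ : Fin 0 → Ty 0) (θ : Fin 0 → Tm S 0 0) :
    e.subst σ θ = e := by
  rw [show σ = Ty.var from funext fun i => i.elim0, show θ = var from funext fun i => i.elim0,
    subst_var]

theorem instTm_subst_up {k k' m m' : ℕ} (σ : Fin k → Ty k') (θ : Fin m → Tm S k' m')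
    (e : Tm S k (m + 1)) (v : Tm S k' m') :
    (e.subst σ (up θ)).instTm v = e.subst σ (push v θ) := by
  simp only [instTm, subst_subst, Ty.subst_var]
  congr 1; funext i; refine Fin.cases ?_ (fun i => ?_) i
  · rfl
  · simp only [up, push, Fin.cons_succ, subst_rename, id]; exact subst_var _

theorem instTy_subst_up {k k' m m' : ℕ} (σ : Fin k → Ty k') (θ : Fin m → Tm S k' m')
    (e : Tm S (k + 1) m) (τ : Ty k') :
    (e.subst (Ty.up σ) (upTy θ)).instTy τ = e.subst (push τ σ) θ := by
  simp only [instTy, subst_subst]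
  congr 1
  · funext i; refine Fin.cases ?_ (fun i => ?_) i
    · rfl
    · simp only [Ty.up, push, Fin.cons_succ, Ty.subst_rename, Ty.subst_var]
  · funext i
    simp only [upTy, push, subst_rename, Fin.cons_succ, id]; exact subst_var _

theorem instBoth_subst_up {k k' m m' : ℕ} (σ : Fin k → Ty k') (θ : Fin m → Tm S k' m')
    (e : Tm S (k + 1) (m + 1)) (τ : Ty k') (v : Tm S k' m') :
    (e.subst (Ty.up σ) (up (upTy θ))).instBoth τ v = e.subst (push τ σ) (push v θ) := by
  simp only [instBoth, subst_subst]
  congr 1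
  · funext i; refine Fin.cases ?_ (fun i => ?_) i
    · rfl
    · simp only [Ty.up, push, Fin.cons_succ, Ty.subst_rename, Ty.subst_var]
  · funext i; refine Fin.cases ?_ (fun i => ?_) i
    · rfl
    · simp only [up, upTy, push, subst_rename, Fin.cons_succ, id]; exact subst_var _

theorem IsVal.of_lit_eq {k m : ℕ} {b : BaseTy} {c : b.Carrier} {e : Tm S k m}
    (h : e = .lit b c) : e.IsVal := h ▸ .lit b c

end Tm

/-! ### Typing -/

section
variable {S : PrimSig}

theorem TyCtx.addTm_rename {k k' m m' : ℕ} {Γ : TyCtx k m} {Γ' : TyCtx k' m'} {ζ : Fin k → Fin k'}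
    {ξ : Fin m → Fin m'} (h : ∀ x, Γ' (ξ x) = (Γ x).rename ζ) (τ : Ty k) (x : Fin (m + 1)) :
    (Γ'.addTm (τ.rename ζ)) (upRen ξ x) = ((Γ.addTm τ) x).rename ζ := by
  refine Fin.cases rfl (fun x => ?_) x
  exact h x

theorem TyCtx.addTy_rename {k k' m m' : ℕ} {Γ : TyCtx k m} {Γ' : TyCtx k' m'} {ζ : Fin k → Fin k'}
    {ξ : Fin m → Fin m'} (h : ∀ x, Γ' (ξ x) = (Γ x).rename ζ) (x : Fin m) :
    Γ'.addTy (ξ x) = (Γ.addTy x).rename (upRen ζ) := by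
  simp only [TyCtx.addTy, h, Ty.rename_rename]; rfl

theorem Ty.rename_succ_upRen {k k' : ℕ} (ζ : Fin k → Fin k') (τ : Ty k) :
    (τ.rename Fin.succ).rename (upRen ζ) = (τ.rename ζ).rename Fin.succ := by
  simp only [Ty.rename_rename]; rfl

theorem Ty.rename_succ_up {k k' : ℕ} (σ : Fin k → Ty k') (τ : Ty k) :
    (τ.rename Fin.succ).subst (Ty.up σ) = (τ.subst σ).rename Fin.succ := by
  simp only [Ty.subst_rename, Ty.rename_subst]; rfl

theorem HasTy.rename {k k' m m' : ℕ} {Γ : TyCtx k m} {Γ' : TyCtx k' m'} {e : Tm S k m} {τ : Ty k}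
    (he : HasTy Γ e τ) {ζ : Fin k → Fin k'} {ξ : Fin m → Fin m'}
    (h : ∀ x, Γ' (ξ x) = (Γ x).rename ζ) : HasTy Γ' (e.rename ζ ξ) (τ.rename ζ) := by
  induction he generalizing k' m' with
  | var x => rw [← h]; exact .var _
  | lit b c => exact .lit b c
  | op o _ ih => exact .op o fun i => ih i h
  | ite _ _ _ ih ih₁ ih₂ => exact .ite (ih h) (ih₁ h) (ih₂ h)
  | pair _ _ ih₁ ih₂ => exact .pair (ih₁ h) (ih₂ h)
  | fst _ ih => exact .fst (ih h)
  | snd _ ih => exact .snd (ih h)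
  | inl _ ih => exact .inl (ih h)
  | inr _ ih => exact .inr (ih h)
  | case _ _ _ ih ih₁ ih₂ =>
    exact .case (ih h) (ih₁ (TyCtx.addTm_rename h _)) (ih₂ (TyCtx.addTm_rename h _))
  | lam _ ih => exact .lam (ih (TyCtx.addTm_rename h _))
  | app _ _ ih₁ ih₂ => exact .app (ih₁ h) (ih₂ h)
  | tlam _ ih => exact .tlam (ih (TyCtx.addTy_rename h))
  | tapp τ₁ _ ih => rw [Ty.rename_inst]; exact .tapp _ (ih h)
  | pack _ ih => refine .pack ?_; rw [← Ty.rename_inst]; exact ih h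
  | unpack _ _ ih₁ ih₂ =>
    refine .unpack (ih₁ h) ?_
    rw [← Ty.rename_succ_upRen]
    exact ih₂ (TyCtx.addTm_rename (TyCtx.addTy_rename h) _)
  | roll _ ih =>
    refine .roll ?_
    have := ih h
    rwa [Ty.rename_inst] at this
  | unroll _ ih => rw [Ty.rename_inst]; exact .unroll (ih h)

theorem TyCtx.addTm_subst {k k' m m' : ℕ} {Γ : TyCtx k m} {Γ' : TyCtx k' m'} {σ : Fin k → Ty k'}
    {θ : Fin m → Tm S k' m'} (h : ∀ x, HasTy Γ' (θ x) ((Γ x).subst σ)) (τ : Ty k)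
    (x : Fin (m + 1)) : HasTy (Γ'.addTm (τ.subst σ)) (Tm.up θ x) ((Γ.addTm τ x).subst σ) := by
  refine Fin.cases ?_ (fun x => ?_) x
  · exact .var (Γ := Γ'.addTm (τ.subst σ)) 0
  · have := (h x).rename (Γ' := Γ'.addTm (τ.subst σ)) (ζ := id) (ξ := Fin.succ)
      (fun y => by rw [Ty.rename_id]; rfl)
    rwa [Ty.rename_id] at this

theorem TyCtx.addTy_subst {k k' m m' : ℕ} {Γ : TyCtx k m} {Γ' : TyCtx k' m'} {σ : Fin k → Ty k'}
    {θ : Fin m → Tm S k' m'} (h : ∀ x, HasTy Γ' (θ x) ((Γ x).subst σ)) (x : Fin m) :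
    HasTy Γ'.addTy (Tm.upTy θ x) ((Γ.addTy x).subst (Ty.up σ)) := by
  rw [TyCtx.addTy, Ty.rename_succ_up]
  exact (h x).rename fun _ => rfl

/-- Typing is stable under simultaneous substitution of types and well-typed terms. -/
theorem HasTy.subst {k k' m m' : ℕ} {Γ : TyCtx k m} {Γ' : TyCtx k' m'} {e : Tm S k m} {τ : Ty k}
    (he : HasTy Γ e τ) {σ : Fin k → Ty k'} {θ : Fin m → Tm S k' m'}
    (h : ∀ x, HasTy Γ' (θ x) ((Γ x).subst σ)) : HasTy Γ' (e.subst σ θ) (τ.subst σ) := by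
  induction he generalizing k' m' with
  | var x => exact h x
  | lit b c => exact .lit b c
  | op o _ ih => exact .op o fun i => ih i h
  | ite _ _ _ ih ih₁ ih₂ => exact .ite (ih h) (ih₁ h) (ih₂ h)
  | pair _ _ ih₁ ih₂ => exact .pair (ih₁ h) (ih₂ h)
  | fst _ ih => exact .fst (ih h)
  | snd _ ih => exact .snd (ih h)
  | inl _ ih => exact .inl (ih h)
  | inr _ ih => exact .inr (ih h)
  | case _ _ _ ih ih₁ ih₂ =>
    exact .case (ih h) (ih₁ (TyCtx.addTm_subst h _)) (ih₂ (TyCtx.addTm_subst h _))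
  | lam _ ih => exact .lam (ih (TyCtx.addTm_subst h _))
  | app _ _ ih₁ ih₂ => exact .app (ih₁ h) (ih₂ h)
  | tlam _ ih => exact .tlam (ih (TyCtx.addTy_subst h))
  | tapp τ₁ _ ih => rw [Ty.subst_inst]; exact .tapp _ (ih h)
  | pack _ ih => refine .pack ?_; rw [← Ty.subst_inst]; exact ih h
  | unpack _ _ ih₁ ih₂ =>
    refine .unpack (ih₁ h) ?_
    rw [← Ty.rename_succ_up]
    exact ih₂ (TyCtx.addTm_subst (TyCtx.addTy_subst h) _)
  | roll _ ih =>
    refine .roll ?_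
    have := ih h
    rwa [Ty.subst_inst] at this
  | unroll _ ih => rw [Ty.subst_inst]; exact .unroll (ih h)

theorem HasTy.unique {k m : ℕ} {Γ : TyCtx k m} {e : Tm S k m} {τ τ' : Ty k}
    (h : HasTy Γ e τ) (h' : HasTy Γ e τ') : τ = τ' := by
  induction h with
  | var x => cases h'; rfl
  | lit b c => cases h'; rfl
  | op o _ ih => cases h'; rfl
  | ite _ _ _ _ ih₁ _ => cases h' with | ite _ h₁ _ => exact ih₁ h₁
  | pair _ _ ih₁ ih₂ => cases h' with | pair h₁ h₂ => rw [ih₁ h₁, ih₂ h₂]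
  | fst _ ih => cases h' with | fst h => cases ih h; rfl
  | snd _ ih => cases h' with | snd h => cases ih h; rfl
  | inl _ ih => cases h'; rfl
  | inr _ ih => cases h'; rfl
  | case _ _ _ ih ih₁ _ =>
    cases h' with | case h h₁ _ => cases ih h; exact ih₁ h₁
  | lam _ ih => cases h' with | lam h => rw [ih h]
  | app _ _ ih₁ _ => cases h' with | app h₁ _ => cases ih₁ h₁; rfl
  | tlam _ ih => cases h' with | tlam h => rw [ih h]
  | tapp τ₁ _ ih => cases h' with | tapp _ h => cases ih h; rfl
  | pack _ ih => cases h'; rfl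
  | unpack _ _ ih₁ ih₂ =>
    cases h' with
    | unpack h₁ h₂ =>
      cases ih₁ h₁
      exact Ty.rename_succ_injective (ih₂ h₂)
  | roll _ ih => cases h'; rfl
  | unroll _ ih => cases h' with | unroll h => cases ih h; rfl

end

/-! ### Reduction -/

section
variable {S : PrimSig}

/-- Reduction given by structural congruence rules instead of evaluation contexts. It agrees with
`Step` (`Step.sstep`, `SStep.step`), and its rules can be inverted without analysing how a term
decomposes into an evaluation context and a redex. -/
inductive SStep (b : Bool) : Tm S 0 0 → Tm S 0 0 → Prop where
  | head {e e' : Tm S 0 0} : Head b e e' → SStep b e e'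
  | op (o : S.Op) (i : Fin (S.arity o)) (args : Fin (S.arity o) → Tm S 0 0) {t : Tm S 0 0} :
      (∀ j, j < i → (args j).IsVal) → SStep b (args i) t →
      SStep b (.op o args) (.op o (Function.update args i t))
  | ite {e e' : Tm S 0 0} (e₁ e₂ : Tm S 0 0) : SStep b e e' → SStep b (.ite e e₁ e₂) (.ite e' e₁ e₂)
  | pair₁ {e e' : Tm S 0 0} (e₂ : Tm S 0 0) : SStep b e e' → SStep b (.pair e e₂) (.pair e' e₂)
  | pair₂ {v e e' : Tm S 0 0} : v.IsVal → SStep b e e' → SStep b (.pair v e) (.pair v e')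
  | fst {e e' : Tm S 0 0} : SStep b e e' → SStep b (.fst e) (.fst e')
  | snd {e e' : Tm S 0 0} : SStep b e e' → SStep b (.snd e) (.snd e')
  | inl (τ : Ty 0) {e e' : Tm S 0 0} : SStep b e e' → SStep b (.inl τ e) (.inl τ e')
  | inr (τ : Ty 0) {e e' : Tm S 0 0} : SStep b e e' → SStep b (.inr τ e) (.inr τ e')
  | case {e e' : Tm S 0 0} (e₁ e₂ : Tm S 0 1) :
      SStep b e e' → SStep b (.case e e₁ e₂) (.case e' e₁ e₂)
  | app₁ {e e' : Tm S 0 0} (e₂ : Tm S 0 0) : SStep b e e' → SStep b (.app e e₂) (.app e' e₂)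
  | app₂ {v e e' : Tm S 0 0} : v.IsVal → SStep b e e' → SStep b (.app v e) (.app v e')
  | tapp {e e' : Tm S 0 0} (τ : Ty 0) : SStep b e e' → SStep b (.tapp e τ) (.tapp e' τ)
  | pack (σ : Ty 0) {e e' : Tm S 0 0} (τ : Ty 1) :
      SStep b e e' → SStep b (.pack σ e τ) (.pack σ e' τ)
  | unpack {e e' : Tm S 0 0} (e₂ : Tm S 1 1) :
      SStep b e e' → SStep b (.unpack e e₂) (.unpack e' e₂)
  | roll (τ : Ty 0) {e e' : Tm S 0 0} : SStep b e e' → SStep b (.roll τ e) (.roll τ e')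
  | unroll {e e' : Tm S 0 0} : SStep b e e' → SStep b (.unroll e) (.unroll e')

theorem SStep.fill {b : Bool} {e e' : Tm S 0 0} (h : SStep b e e') (E : ECtx S) :
    SStep b (E.fill e) (E.fill e') := by
  induction E with
  | hole => exact h
  | op o i args hv E ih =>
    have := SStep.op (b := b) o i (Function.update args i (E.fill e)) (t := E.fill e')
      (fun j hj => by rw [Function.update_of_ne hj.ne]; exact hv j hj)
      (by rw [Function.update_self]; exact ih)
    rwa [Function.update_idem] at this
  | ite E e₁ e₂ ih => exact .ite _ _ ih
  | pair₁ E e₂ ih => exact .pair₁ _ ih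
  | pair₂ v hv E ih => exact .pair₂ hv ih
  | fst E ih => exact .fst ih
  | snd E ih => exact .snd ih
  | inl τ E ih => exact .inl _ ih
  | inr τ E ih => exact .inr _ ih
  | case E e₁ e₂ ih => exact .case _ _ ih
  | app₁ E e₂ ih => exact .app₁ _ ih
  | app₂ v hv E ih => exact .app₂ hv ih
  | tapp E τ ih => exact .tapp _ ih
  | pack σ E τ ih => exact .pack _ _ ih
  | unpack E e₂ ih => exact .unpack _ ih
  | roll τ E ih => exact .roll _ ih
  | unroll E ih => exact .unroll ih

theorem Step.sstep {b : Bool} {e e' : Tm S 0 0} (h : Step b e e') : SStep b e e' := by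
  cases h with | intro E h => exact (SStep.head h).fill E

namespace ECtx

/-- Composition of evaluation contexts: `(E.comp F)[e] = E[F[e]]`. -/
def comp (F : ECtx S) : ECtx S → ECtx S
  | .hole => F
  | .op o i args hv E => .op o i args hv (comp F E)
  | .ite E e₁ e₂ => .ite (comp F E) e₁ e₂
  | .pair₁ E e₂ => .pair₁ (comp F E) e₂
  | .pair₂ v₁ hv E => .pair₂ v₁ hv (comp F E)
  | .fst E => .fst (comp F E)
  | .snd E => .snd (comp F E)
  | .inl τ E => .inl τ (comp F E)
  | .inr τ E => .inr τ (comp F E)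
  | .case E e₁ e₂ => .case (comp F E) e₁ e₂
  | .app₁ E e₂ => .app₁ (comp F E) e₂
  | .app₂ v₁ hv E => .app₂ v₁ hv (comp F E)
  | .tapp E τ => .tapp (comp F E) τ
  | .pack σ E τ => .pack σ (comp F E) τ
  | .unpack E e₂ => .unpack (comp F E) e₂
  | .roll τ E => .roll τ (comp F E)
  | .unroll E => .unroll (comp F E)

theorem fill_comp (F E : ECtx S) (e : Tm S 0 0) : (comp F E).fill e = E.fill (F.fill e) := by
  induction E <;> simp [comp, fill, *]

theorem typed_comp {F E : ECtx S} {τ τ' τ'' : Ty 0} (hF : CtxTy TyCtx.nil τ F.toCtx TyCtx.nil τ')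
    (hE : CtxTy TyCtx.nil τ' E.toCtx TyCtx.nil τ'') :
    CtxTy TyCtx.nil τ (comp F E).toCtx TyCtx.nil τ'' := by
  induction E generalizing τ'' with
  | hole =>
    cases hE with
    | hole _ _ _ => rw [Ty.rename_id]; exact hF
  | op o i args hv E ih =>
    cases hE with | op _ _ h₁ h => exact .op _ _ h₁ (ih h)
  | ite E e₁ e₂ ih => cases hE with | ite₀ h h₁ h₂ => exact .ite₀ (ih h) h₁ h₂
  | pair₁ E e₂ ih => cases hE with | pair₁ h h₁ => exact .pair₁ (ih h) h₁
  | pair₂ v hv E ih => cases hE with | pair₂ h h₁ => exact .pair₂ h (ih h₁)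
  | fst E ih => cases hE with | fst h => exact .fst (ih h)
  | snd E ih => cases hE with | snd h => exact .snd (ih h)
  | inl τ E ih => cases hE with | inl h => exact .inl (ih h)
  | inr τ E ih => cases hE with | inr h => exact .inr (ih h)
  | case E e₁ e₂ ih => cases hE with | case₀ h h₁ h₂ => exact .case₀ (ih h) h₁ h₂
  | app₁ E e₂ ih => cases hE with | app₁ h h₁ => exact .app₁ (ih h) h₁
  | app₂ v hv E ih => cases hE with | app₂ h h₁ => exact .app₂ h (ih h₁)
  | tapp E τ ih => cases hE with | tapp _ h => exact .tapp _ (ih h)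
  | pack σ E τ ih => cases hE with | pack h => exact .pack (ih h)
  | unpack E e₂ ih => cases hE with | unpack₁ h h₁ => exact .unpack₁ (ih h) h₁
  | roll τ E ih => cases hE with | roll h => exact .roll (ih h)
  | unroll E ih => cases hE with | unroll h => exact .unroll (ih h)

theorem typed_hole (τ : Ty 0) :
    CtxTy TyCtx.nil τ (hole : ECtx S).toCtx TyCtx.nil τ := by
  have := CtxTy.hole (S := S) (Γ := TyCtx.nil) (Γ' := TyCtx.nil) (τ := τ) (ζ := id) (ξ := id)
    Function.injective_id Function.injective_id (fun x => x.elim0)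
  rwa [Ty.rename_id] at this

theorem isVal_of_fill {E : ECtx S} {e : Tm S 0 0} (h : (E.fill e).IsVal) : e.IsVal := by
  induction E with
  | hole => exact h
  | pair₁ E _ ih => cases h with | pair h _ => exact ih h
  | pair₂ _ _ E ih => cases h with | pair _ h => exact ih h
  | inl _ E ih => cases h with | inl h => exact ih h
  | inr _ E ih => cases h with | inr h => exact ih h
  | pack _ E _ ih => cases h with | pack h => exact ih h
  | roll _ E ih => cases h with | roll h => exact ih h
  | _ => cases h

end ECtx

theorem Step.fill {b : Bool} {e e' : Tm S 0 0} (h : Step b e e') (E : ECtx S) :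
    Step b (E.fill e) (E.fill e') := by
  cases h with
  | intro F h => rw [← ECtx.fill_comp, ← ECtx.fill_comp]; exact .intro _ h

theorem SStep.step {b : Bool} {e e' : Tm S 0 0} (h : SStep b e e') : Step b e e' := by
  induction h with
  | head h => exact .intro .hole h
  | op o i args hv _ ih =>
    have := ih.fill (.op o i args hv .hole)
    simpa only [ECtx.fill, Function.update_eq_self] using this
  | ite e₁ e₂ _ ih => exact ih.fill (.ite .hole e₁ e₂)
  | pair₁ e₂ _ ih => exact ih.fill (.pair₁ .hole e₂)
  | pair₂ hv _ ih => exact ih.fill (.pair₂ _ hv .hole)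
  | fst _ ih => exact ih.fill (.fst .hole)
  | snd _ ih => exact ih.fill (.snd .hole)
  | inl τ _ ih => exact ih.fill (.inl τ .hole)
  | inr τ _ ih => exact ih.fill (.inr τ .hole)
  | case e₁ e₂ _ ih => exact ih.fill (.case .hole e₁ e₂)
  | app₁ e₂ _ ih => exact ih.fill (.app₁ .hole e₂)
  | app₂ hv _ ih => exact ih.fill (.app₂ _ hv .hole)
  | tapp τ _ ih => exact ih.fill (.tapp .hole τ)
  | pack σ τ _ ih => exact ih.fill (.pack σ .hole τ)
  | unpack e₂ _ ih => exact ih.fill (.unpack .hole e₂)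
  | roll τ _ ih => exact ih.fill (.roll τ .hole)
  | unroll _ ih => exact ih.fill (.unroll .hole)

theorem SStep.not_isVal {b : Bool} {e e' : Tm S 0 0} (h : SStep b e e') : ¬ e.IsVal := by
  induction h with
  | head h => intro hv; cases h <;> cases hv
  | pair₁ _ _ ih => intro hv; cases hv with | pair h _ => exact ih h
  | pair₂ _ _ ih => intro hv; cases hv with | pair _ h => exact ih h
  | inl _ _ ih => intro hv; cases hv with | inl h => exact ih h
  | inr _ _ ih => intro hv; cases hv with | inr h => exact ih h
  | pack _ _ _ ih => intro hv; cases hv with | pack h => exact ih h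
  | roll _ _ ih => intro hv; cases hv with | roll h => exact ih h
  | _ => intro hv; cases hv

theorem Head.deterministic {b b' : Bool} {e t t' : Tm S 0 0} (h : Head b e t)
    (h' : Head b' e t') : b = b' ∧ t = t' := by
  cases h with
  | op o c =>
    generalize hx : Tm.op o (fun i => Tm.lit (S.dom o i) (c i)) = x at h'
    cases h' with
    | op o' c' =>
      simp only [Tm.op.injEq] at hx
      obtain ⟨rfl, h⟩ := hx
      have := eq_of_heq h
      have : c = c' := by
        funext i
        have := congrFun this i
        simpa using this
      subst this
      exact ⟨rfl, rfl⟩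
    | _ => cases hx
  | _ => cases h'; exact ⟨rfl, rfl⟩

/-- A redex is not reducible below its root: its evaluation positions hold values. -/
theorem Head.eq_of_sstep {b b' : Bool} {e t t' : Tm S 0 0} (h : Head b e t)
    (h' : SStep b' e t') : b = b' ∧ t = t' := by
  cases h' with
  | head h' => exact h.deterministic h'
  | op o i args hv h' =>
    generalize hx : Tm.op o args = x at h
    cases h with
    | op o' c =>
      simp only [Tm.op.injEq] at hx
      obtain ⟨rfl, h⟩ := hx
      cases eq_of_heq h
      exact (h'.not_isVal (.lit _ _)).elim
    | _ => cases hx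
  | _ =>
    rename_i h'
    cases h <;> first
      | exact (h'.not_isVal (by constructor <;> assumption)).elim
      | exact (h'.not_isVal (by assumption)).elim

theorem SStep.deterministic {b b' : Bool} {e t t' : Tm S 0 0} (h : SStep b e t)
    (h' : SStep b' e t') : b = b' ∧ t = t' := by
  induction h generalizing t' with
  | head h => exact h.eq_of_sstep h'
  | op o i args hv h ih =>
    generalize hx : Tm.op o args = x at h'
    cases h' with
    | head h' =>
      subst hx
      obtain ⟨rfl, rfl⟩ := h'.eq_of_sstep (.op o i args hv h); exact ⟨rfl, rfl⟩
    | op o' i' args' hv' h' =>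
      simp only [Tm.op.injEq] at hx
      obtain ⟨rfl, hx⟩ := hx
      cases eq_of_heq hx
      rcases lt_trichotomy i i' with hlt | rfl | hlt
      · exact (h.not_isVal (hv' _ hlt)).elim
      · obtain ⟨rfl, rfl⟩ := ih h'; exact ⟨rfl, rfl⟩
      · exact (h'.not_isVal (hv _ hlt)).elim
    | _ => cases hx
  | pair₁ e₂ h ih =>
    cases h' with
    | head h' => cases h'
    | pair₁ _ h' => obtain ⟨rfl, rfl⟩ := ih h'; exact ⟨rfl, rfl⟩
    | pair₂ hv _ => exact (h.not_isVal hv).elim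
  | pair₂ hv h ih =>
    cases h' with
    | head h' => cases h'
    | pair₁ _ h' => exact (h'.not_isVal hv).elim
    | pair₂ _ h' => obtain ⟨rfl, rfl⟩ := ih h'; exact ⟨rfl, rfl⟩
  | app₁ e₂ h ih =>
    cases h' with
    | head h' => obtain ⟨rfl, rfl⟩ := h'.eq_of_sstep (.app₁ _ h); exact ⟨rfl, rfl⟩
    | app₁ _ h' => obtain ⟨rfl, rfl⟩ := ih h'; exact ⟨rfl, rfl⟩
    | app₂ hv _ => exact (h.not_isVal hv).elim
  | app₂ hv h ih =>
    cases h' with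
    | head h' => obtain ⟨rfl, rfl⟩ := h'.eq_of_sstep (.app₂ hv h); exact ⟨rfl, rfl⟩
    | app₁ _ h' => exact (h'.not_isVal hv).elim
    | app₂ _ h' => obtain ⟨rfl, rfl⟩ := ih h'; exact ⟨rfl, rfl⟩
  | _ =>
    rename_i h ih
    cases h' with
    | head h' =>
      cases h' <;> exact (h.not_isVal (by constructor <;> assumption)).elim
    | _ =>
      rename_i h'
      obtain ⟨rfl, rfl⟩ := ih h'; exact ⟨rfl, rfl⟩

/-- If `E[e]` reduces and `e` is not a value, then `e` itself reduces. -/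
theorem SStep.exists_of_fill {b : Bool} {E : ECtx S} {e t : Tm S 0 0}
    (h : SStep b (E.fill e) t) (he : ¬ e.IsVal) : ∃ e', SStep b e e' := by
  induction E generalizing t with
  | hole => exact ⟨t, h⟩
  | op o i args hv E ih =>
    have hy : ¬ (E.fill e).IsVal := fun h => he (ECtx.isVal_of_fill h)
    rw [ECtx.fill] at h
    generalize E.fill e = y at h ih hy
    generalize hx : Tm.op o (Function.update args i y) = x at h
    cases h with
    | head h =>
      cases h with
      | op o' c =>
        simp only [Tm.op.injEq] at hx
        obtain ⟨rfl, hx⟩ := hx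
        have := congrFun (eq_of_heq hx) i
        rw [Function.update_self] at this
        exact (hy (.of_lit_eq this)).elim
      | _ => cases hx
    | op o' i' args' hv' h =>
      simp only [Tm.op.injEq] at hx
      obtain ⟨rfl, hx⟩ := hx
      cases eq_of_heq hx
      rcases lt_trichotomy i i' with hlt | rfl | hlt
      · have := hv' _ hlt
        rw [Function.update_self] at this
        exact (hy this).elim
      · rw [Function.update_self] at h
        exact ih h
      · rw [Function.update_of_ne hlt.ne] at h
        exact (h.not_isVal (hv _ hlt)).elim
    | _ => cases hx
  | pair₂ v hv E ih =>
    cases h with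
    | head h => cases h
    | pair₁ _ h => exact (h.not_isVal hv).elim
    | pair₂ _ h => exact ih h
  | app₂ v hv E ih =>
    cases h with
    | head h =>
      cases h with
      | beta hv' => exact (he (ECtx.isVal_of_fill hv')).elim
    | app₁ _ h => exact (h.not_isVal hv).elim
    | app₂ _ h => exact ih h
  | _ =>
    rename_i ih
    have hE : ∀ F : ECtx S, ¬ (F.fill e).IsVal := fun F h => he (ECtx.isVal_of_fill h)
    simp only [ECtx.fill] at h
    generalize hf : ECtx.fill e _ = y at h ih
    have hy : ¬ y.IsVal := hf ▸ hE _
    cases h with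
    | head h => cases h <;> exact (hy (by constructor <;> assumption)).elim
    | _ =>
      first
        | exact ih ‹_›
        | exact (hy (by assumption)).elim

/-- In `E[e]` with `e` not a value, reduction takes place in `e`. -/
theorem Step.of_fill {b : Bool} {E : ECtx S} {e t : Tm S 0 0} (h : Step b (E.fill e) t)
    (he : ¬ e.IsVal) : ∃ e', Step b e e' ∧ t = E.fill e' := by
  obtain ⟨e', h'⟩ := h.sstep.exists_of_fill he
  exact ⟨e', h'.step, (h.sstep.deterministic (h'.fill E)).2⟩

theorem Step.not_isVal {b : Bool} {e e' : Tm S 0 0} (h : Step b e e') : ¬ e.IsVal :=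
  h.sstep.not_isVal

theorem Step.deterministic {b b' : Bool} {e t t' : Tm S 0 0} (h : Step b e t)
    (h' : Step b' e t') : b = b' ∧ t = t' :=
  h.sstep.deterministic h'.sstep

/-! ### Reduction sequences -/

namespace StepsN

theorem fill {j : ℕ} {e e' : Tm S 0 0} (h : StepsN j e e') (E : ECtx S) :
    StepsN j (E.fill e) (E.fill e') := by
  induction h with
  | refl e => exact .refl _
  | pure h _ ih => exact .pure (h.fill E) ih
  | unroll h _ ih => exact .unroll (h.fill E) ih

theorem trans {i j : ℕ} {e e' e'' : Tm S 0 0} (h : StepsN i e e') (h' : StepsN j e' e'') :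
    StepsN (i + j) e e'' := by
  induction h with
  | refl e => rwa [Nat.zero_add]
  | pure h _ ih => exact .pure h (ih h')
  | unroll h _ ih => rw [Nat.add_right_comm]; exact .unroll h (ih h')

theorem eq_of_isVal {j : ℕ} {e e' : Tm S 0 0} (h : StepsN j e e') (hv : e.IsVal) :
    j = 0 ∧ e = e' := by
  cases h with
  | refl => exact ⟨rfl, rfl⟩
  | pure h _ => exact (h.not_isVal hv).elim
  | unroll h _ => exact (h.not_isVal hv).elim

/-- A reduction sequence splits at any unroll reduction. -/
theorem split {j : ℕ} {e e'' : Tm S 0 0} (h : StepsN (j + 1) e e'') :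
    ∃ e', StepsN 1 e e' ∧ StepsN j e' e'' := by
  generalize hi : j + 1 = i at h
  induction h with
  | refl => cases hi
  | pure h _ ih =>
    obtain ⟨e', h₁, h₂⟩ := ih hi
    exact ⟨e', .pure h h₁, h₂⟩
  | unroll h h' _ => cases hi; exact ⟨_, .unroll h (.refl _), h'⟩

theorem of_head_pure {j : ℕ} {e e' v : Tm S 0 0} (h : StepsN j e v) (hv : v.IsVal)
    (hs : Head false e e') : StepsN j e' v := by
  have hs : Step false e e' := .intro .hole hs
  cases h with
  | refl => exact (hs.not_isVal hv).elim
  | pure h h' => cases (h.deterministic hs).2; exact h'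
  | unroll h _ => cases (h.deterministic hs).1

theorem of_head_unroll {j : ℕ} {e e' v : Tm S 0 0} (h : StepsN j e v) (hv : v.IsVal)
    (hs : Head true e e') : ∃ i, j = i + 1 ∧ StepsN i e' v := by
  have hs : Step true e e' := .intro .hole hs
  cases h with
  | refl => exact (hs.not_isVal hv).elim
  | pure h h' => cases (h.deterministic hs).1
  | unroll h h' => cases (h.deterministic hs).2; exact ⟨_, rfl, h'⟩

theorem of_head {b : Bool} {e e' : Tm S 0 0} (hs : Head b e e') : ∃ j, StepsN j e e' := by
  cases b
  · exact ⟨0, .pure (.intro .hole hs) (.refl _)⟩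
  · exact ⟨1, .unroll (.intro .hole hs) (.refl _)⟩

/-- Evaluation of `E[e]` starts with the evaluation of `e`. -/
theorem of_fill {j : ℕ} {E : ECtx S} {e v : Tm S 0 0} (h : StepsN j (E.fill e) v)
    (hv : v.IsVal) :
    ∃ i l x, StepsN i e x ∧ x.IsVal ∧ StepsN l (E.fill x) v ∧ i + l = j := by
  generalize ht : E.fill e = t at h
  induction h generalizing e with
  | refl =>
    subst ht
    exact ⟨0, 0, e, .refl _, ECtx.isVal_of_fill hv, .refl _, rfl⟩
  | @pure j _ _ _ h h' ih =>
    subst ht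
    by_cases he : e.IsVal
    · exact ⟨0, j, e, .refl _, he, .pure h h', Nat.zero_add _⟩
    · obtain ⟨e', hs, rfl⟩ := h.of_fill he
      obtain ⟨i, l, x, h₁, hx, h₂, hj⟩ := ih hv rfl
      exact ⟨i, l, x, .pure hs h₁, hx, h₂, hj⟩
  | @unroll j _ _ _ h h' ih =>
    subst ht
    by_cases he : e.IsVal
    · exact ⟨0, j + 1, e, .refl _, he, .unroll h h', Nat.zero_add _⟩
    · obtain ⟨e', hs, rfl⟩ := h.of_fill he
      obtain ⟨i, l, x, h₁, hx, h₂, hj⟩ := ih hv rfl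
      exact ⟨i + 1, l, x, .unroll hs h₁, hx, h₂, by omega⟩

end StepsN

/-! ### Subject reduction -/

theorem HasTy.instTm {e : Tm S 0 1} {v : Tm S 0 0} {τ τ' : Ty 0}
    (he : HasTy (TyCtx.nil.addTm τ) e τ') (hv : HasTy TyCtx.nil v τ) :
    HasTy TyCtx.nil (e.instTm v) τ' := by
  have := he.subst (Γ' := TyCtx.nil) (σ := Ty.var) (θ := push v .var) (fun x => by
    refine Fin.cases ?_ (fun x => x.elim0) x
    rw [Ty.subst_var]; exact hv)
  rwa [Ty.subst_var] at this

theorem Head.preserves {b : Bool} {e e' : Tm S 0 0} {τ : Ty 0} (h : Head b e e')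
    (he : HasTy TyCtx.nil e τ) : HasTy TyCtx.nil e' τ := by
  cases h with
  | op o c => cases he; exact .lit _ _
  | iteTrue => cases he with | ite _ h _ => exact h
  | iteFalse => cases he with | ite _ _ h => exact h
  | fst => cases he with | fst h => cases h with | pair h _ => exact h
  | snd => cases he with | snd h => cases h with | pair _ h => exact h
  | caseInl => cases he with | case h h₁ _ => cases h with | inl h => exact h₁.instTm h
  | caseInr => cases he with | case h _ h₂ => cases h with | inr h => exact h₂.instTm h
  | beta => cases he with | app h h' => cases h with | lam h => exact h.instTm h'
  | tbeta e τ =>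
    cases he with
    | tapp _ h =>
      cases h with
      | tlam h => exact h.subst (fun x => x.elim0)
  | @unpack σ v τ₁ e =>
    cases he with
    | unpack h h' =>
      cases h with
      | pack h =>
        have := h'.subst (Γ' := TyCtx.nil) (σ := push σ .var) (θ := push v .var) (fun x => by
          refine Fin.cases ?_ (fun x => x.elim0) x
          exact h)
        rw [Ty.subst_rename] at this
        rwa [← Ty.subst_var τ]
  | unroll => cases he with | unroll h => cases h with | roll h => exact h

theorem SStep.preserves {b : Bool} {e e' : Tm S 0 0} {τ : Ty 0} (h : SStep b e e')
    (he : HasTy TyCtx.nil e τ) : HasTy TyCtx.nil e' τ := by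
  induction h generalizing τ with
  | head h => exact h.preserves he
  | op o i args _ _ ih =>
    cases he with
    | op _ h =>
      refine .op o fun j => ?_
      by_cases hj : j = i
      · subst hj; rw [Function.update_self]; exact ih (h _)
      · rw [Function.update_of_ne hj]; exact h j
  | ite _ _ _ ih => cases he with | ite h h₁ h₂ => exact .ite (ih h) h₁ h₂
  | pair₁ _ _ ih => cases he with | pair h h' => exact .pair (ih h) h'
  | pair₂ _ _ ih => cases he with | pair h h' => exact .pair h (ih h')
  | fst _ ih => cases he with | fst h => exact .fst (ih h)
  | snd _ ih => cases he with | snd h => exact .snd (ih h)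
  | inl _ _ ih => cases he with | inl h => exact .inl (ih h)
  | inr _ _ ih => cases he with | inr h => exact .inr (ih h)
  | case _ _ _ ih => cases he with | case h h₁ h₂ => exact .case (ih h) h₁ h₂
  | app₁ _ _ ih => cases he with | app h h' => exact .app (ih h) h'
  | app₂ _ _ ih => cases he with | app h h' => exact .app h (ih h')
  | tapp _ _ ih => cases he with | tapp _ h => exact .tapp _ (ih h)
  | pack _ _ _ ih => cases he with | pack h => exact .pack (ih h)
  | unpack _ _ ih => cases he with | unpack h h' => exact .unpack (ih h) h'
  | roll _ _ ih => cases he with | roll h => exact .roll (ih h)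
  | unroll _ ih => cases he with | unroll h => exact .unroll (ih h)

theorem StepsN.preserves {j : ℕ} {e e' : Tm S 0 0} {τ : Ty 0} (h : StepsN j e e')
    (he : HasTy TyCtx.nil e τ) : HasTy TyCtx.nil e' τ := by
  induction h with
  | refl => exact he
  | pure h _ ih => exact ih (h.sstep.preserves he)
  | unroll h _ ih => exact ih (h.sstep.preserves he)

/-! ### Ciu approximation -/

/-- Ciu approximation at some type, the atomic proposition `e₁ ≼ e₂` of the logic. -/
def Ciu (e₁ e₂ : Tm S 0 0) : Prop := ∃ τ : Ty 0, CiuApprox e₁ e₂ τ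

theorem Terminates.of_stepsN {j : ℕ} {e e' : Tm S 0 0} (h : StepsN j e e') (h' : Terminates e') :
    Terminates e := by
  obtain ⟨v, ⟨i, hi⟩, hv⟩ := h'
  exact ⟨v, ⟨_, h.trans hi⟩, hv⟩

namespace Ciu

theorem of_stepsN {j : ℕ} {e e' : Tm S 0 0} {τ : Ty 0} (he : HasTy TyCtx.nil e τ)
    (h : StepsN j e e') : Ciu e' e :=
  ⟨τ, h.preserves he, he, fun E _ _ ht => ht.of_stepsN (h.fill E)⟩

theorem refl {e : Tm S 0 0} {τ : Ty 0} (he : HasTy TyCtx.nil e τ) : Ciu e e :=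
  of_stepsN he (.refl e)

theorem of_head {b : Bool} {e e' : Tm S 0 0} {τ : Ty 0} (he : HasTy TyCtx.nil e τ)
    (h : Head b e e') : Ciu e' e :=
  let ⟨_, hj⟩ := StepsN.of_head h
  of_stepsN he hj

theorem trans {e e' e'' : Tm S 0 0} (h : Ciu e e') (h' : Ciu e' e'') : Ciu e e'' := by
  obtain ⟨τ, h₁, h₂, h₃⟩ := h
  obtain ⟨τ', h₁', h₂', h₃'⟩ := h'
  cases h₂.unique h₁'
  exact ⟨τ, h₁, h₂', fun E τ' hE ht => h₃' E τ' hE (h₃ E τ' hE ht)⟩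

theorem terminates {e e' : Tm S 0 0} (h : Ciu e e') (ht : Terminates e) : Terminates e' := by
  obtain ⟨τ, _, _, h⟩ := h
  exact h .hole τ (ECtx.typed_hole τ) ht

end Ciu

theorem CtxTy.fill {k m : ℕ} {Γ : TyCtx k m} {τ : Ty k} {k' m' : ℕ} {C : Ctx S k m k' m'}
    {Γ' : TyCtx k' m'} {τ' : Ty k'} (hC : CtxTy Γ τ C Γ' τ') {e : Tm S k m}
    (he : HasTy Γ e τ) : HasTy Γ' (C.fill e) τ' := by
  induction hC with
  | hole _ _ h => exact he.rename h
  | op o i h _ ih =>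
    refine .op o fun j => ?_
    by_cases hj : j = i
    · subst hj; rw [Function.update_self]; exact ih
    · rw [Function.update_of_ne hj]; exact h j hj
  | ite₀ _ h₁ h₂ ih => exact .ite ih h₁ h₂
  | ite₁ h₁ _ h₂ ih => exact .ite h₁ ih h₂
  | ite₂ h₁ h₂ _ ih => exact .ite h₁ h₂ ih
  | pair₁ _ h ih => exact .pair ih h
  | pair₂ h _ ih => exact .pair h ih
  | fst _ ih => exact .fst ih
  | snd _ ih => exact .snd ih
  | inl _ ih => exact .inl ih
  | inr _ ih => exact .inr ih
  | case₀ _ h₁ h₂ ih => exact .case ih h₁ h₂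
  | case₁ h₁ _ h₂ ih => exact .case h₁ ih h₂
  | case₂ h₁ h₂ _ ih => exact .case h₁ h₂ ih
  | lam _ ih => exact .lam ih
  | app₁ _ h ih => exact .app ih h
  | app₂ h _ ih => exact .app h ih
  | tlam _ ih => exact .tlam ih
  | tapp _ _ ih => exact .tapp _ ih
  | pack _ ih => exact .pack ih
  | unpack₁ _ h ih => exact .unpack ih h
  | unpack₂ h _ ih => exact .unpack h ih
  | roll _ ih => exact .roll ih
  | unroll _ ih => exact .unroll ih

theorem ECtx.fill_toCtx (E : ECtx S) (e : Tm S 0 0) : E.toCtx.fill e = E.fill e := by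
  induction E with
  | hole =>
    rw [toCtx, fill, Ctx.fill, ← Tm.subst_closed (e.rename id id) Ty.var Tm.var, Tm.subst_rename]
    exact Tm.subst_closed _ _ _
  | _ => simp [toCtx, fill, Ctx.fill, *]

theorem CtxTy.efill {E : ECtx S} {τ τ' : Ty 0} (hE : CtxTy TyCtx.nil τ E.toCtx TyCtx.nil τ')
    {e : Tm S 0 0} (he : HasTy TyCtx.nil e τ) : HasTy TyCtx.nil (E.fill e) τ' :=
  E.fill_toCtx e ▸ hE.fill he

theorem Ciu.fill {e e' : Tm S 0 0} (h : Ciu e e') {E : ECtx S} {τ τ' : Ty 0}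
    (he : HasTy TyCtx.nil e' τ) (hE : CtxTy TyCtx.nil τ E.toCtx TyCtx.nil τ') :
    Ciu (E.fill e) (E.fill e') := by
  obtain ⟨τ₁, h₁, h₂, h₃⟩ := h
  cases he.unique h₂
  refine ⟨τ', hE.efill h₁, hE.efill h₂, fun F τ'' hF ht => ?_⟩
  rw [← ECtx.fill_comp] at ht ⊢
  exact h₃ _ _ (ECtx.typed_comp hE hF) ht

end

/-! ### World-indexed relations -/

section
variable {S : PrimSig}

namespace WRel

/-- The relation that agrees with `R` in the positive worlds and is true in world `0`. -/
def normal {a : ℕ} (R : WRel S a) : WRel S a := fun n es => 0 < n → R n es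

/-- Monotonicity up to world `N`. -/
def MonoTo {a : ℕ} (N : ℕ) (R : WRel S a) : Prop :=
  ∀ n n' es, n ≤ N → n' ≤ n → R n es → R n' es

theorem mono_iff {a : ℕ} {R : WRel S a} : R.Mono ↔ ∀ N, R.MonoTo N :=
  ⟨fun h _ n n' es _ hn => h n n' es hn, fun h n n' es hn => h n n n' es le_rfl hn⟩

theorem normal_mono {a : ℕ} {R : WRel S a} (h : R.Mono) : R.normal.Mono :=
  fun _ _ _ hn hR h0 => h _ _ _ hn (hR (h0.trans_le hn))

theorem normal_eq {a : ℕ} {R : WRel S a} (h : ∀ es, R 0 es) : R.normal = R := by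
  funext n es
  cases n with
  | zero => simp [normal, h]
  | succ n => simp [normal]

theorem normal_zero {a : ℕ} (R : WRel S a) (es : Fin a → Tm S 0 0) : R.normal 0 es :=
  fun h => absurd h (lt_irrefl _)

theorem normal_congr {a : ℕ} {R R' : WRel S a} {n : ℕ} (h : R n = R' n) :
    R.normal n = R'.normal n := by
  funext es; simp only [normal, h]

theorem fix_congr {a : ℕ} {F F' : WRel S a → WRel S a} {N : ℕ}
    (h : ∀ n ≤ N, ∀ X X' : WRel S a, (∀ v < n, X v = X' v) → F X n = F' X' n) :
    ∀ n ≤ N, fix F n = fix F' n := by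
  intro n
  induction n using Nat.strong_induction_on with
  | _ n ih =>
    intro hn
    rw [fix, fix]
    refine h n hn _ _ fun v hv => ?_
    funext es
    rw [ih v hv (hv.le.trans hn)]

/-- For contractive `F` the relation `fix F` is a fixed point of `F`. -/
theorem fix_eq {a : ℕ} {F : WRel S a → WRel S a} {n : ℕ}
    (h : ∀ X X' : WRel S a, (∀ v < n, X v = X' v) → F X n = F X' n) :
    fix F n = F (fix F) n := by
  rw [fix]
  exact h _ _ fun v hv => by funext es; simp [hv]

end WRel

/-! ### The semantic logical relation -/

/-- Semantic interpretations of `j` type variables, by two closed types and a relation. -/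
abbrev SInterp (S : PrimSig) (j : ℕ) : Type := Fin j → Ty 0 × Ty 0 × WRel S 2

namespace SInterp

variable {j : ℕ}

/-- The type substitution `ρ₁`. -/
def left (ρ : SInterp S j) : Fin j → Ty 0 := fun i => (ρ i).1

/-- The type substitution `ρ₂`. -/
def right (ρ : SInterp S j) : Fin j → Ty 0 := fun i => (ρ i).2.1

theorem left_push (p : Ty 0 × Ty 0 × WRel S 2) (ρ : SInterp S j) :
    SInterp.left (push p ρ) = push p.1 ρ.left := comp_push (fun q => q.1) p ρ

theorem right_push (p : Ty 0 × Ty 0 × WRel S 2) (ρ : SInterp S j) :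
    SInterp.right (push p ρ) = push p.2.1 ρ.right := comp_push (fun q => q.2.1) p ρ

end SInterp

/-- Pairs of closed values of types `T₁` and `T₂`. -/
def ValPair (T₁ T₂ : Ty 0) (x₁ x₂ : Tm S 0 0) : Prop :=
  (HasTy TyCtx.nil x₁ T₁ ∧ x₁.IsVal) ∧ (HasTy TyCtx.nil x₂ T₂ ∧ x₂.IsVal)

/-- The relation on terms induced by a relation `R` on values: if the left term evaluates to a
value with `i` unroll reductions, then in the worlds up to `n - i` that value is related by `R` to
a value which approximates the right term. -/
def SC (T₁ T₂ : Ty 0) (R : WRel S 2) : WRel S 2 := fun n es =>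
  0 < n → HasTy TyCtx.nil (es 0) T₁ ∧ HasTy TyCtx.nil (es 1) T₂ ∧
    ∀ w i x₁, 0 < w → w + i ≤ n → StepsN i (es 0) x₁ → x₁.IsVal →
      ∃ x₂, Ciu x₂ (es 1) ∧ R w ![x₁, x₂]

/-- The world-indexed relation on closed values denoted by `𝒱⟦τ⟧ρ`. Bound relation variables enter
through `WRel.normal`, because an atomic proposition is true in world `0` whatever the relation
assigned to its variable. -/
def SV : {j : ℕ} → Ty j → SInterp S j → WRel S 2
  | _, .var i, ρ => (ρ i).2.2
  | _, .base b, _ => fun n es =>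
      0 < n → ValPair (.base b) (.base b) (es 0) (es 1) ∧ es 0 = es 1
  | _, .prod τ τ', ρ => fun n es =>
      0 < n → ValPair ((Ty.prod τ τ').subst ρ.left) ((Ty.prod τ τ').subst ρ.right) (es 0) (es 1) ∧
        ∃ x₁ y₁ x₂ y₂, es 0 = .pair x₁ y₁ ∧ es 1 = .pair x₂ y₂ ∧
          SV τ ρ n ![x₁, x₂] ∧ SV τ' ρ n ![y₁, y₂]
  | _, .sum τ τ', ρ => fun n es =>
      0 < n → ValPair ((Ty.sum τ τ').subst ρ.left) ((Ty.sum τ τ').subst ρ.right) (es 0) (es 1) ∧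
        ((∃ x₁ x₂, es 0 = .inl ((Ty.sum τ τ').subst ρ.left) x₁ ∧
            es 1 = .inl ((Ty.sum τ τ').subst ρ.right) x₂ ∧ SV τ ρ n ![x₁, x₂]) ∨
          ∃ x₁ x₂, es 0 = .inr ((Ty.sum τ τ').subst ρ.left) x₁ ∧
            es 1 = .inr ((Ty.sum τ τ').subst ρ.right) x₂ ∧ SV τ' ρ n ![x₁, x₂])
  | _, .arr τ τ', ρ => fun n es =>
      0 < n → ValPair ((Ty.arr τ τ').subst ρ.left) ((Ty.arr τ τ').subst ρ.right) (es 0) (es 1) ∧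
        ∀ y₁ y₂, ∀ w ≤ n, SV τ ρ w ![y₁, y₂] →
          SC (τ'.subst ρ.left) (τ'.subst ρ.right) (SV τ' ρ) w ![.app (es 0) y₁, .app (es 1) y₂]
  | _, .all τ, ρ => fun n es =>
      0 < n → ValPair ((Ty.all τ).subst ρ.left) ((Ty.all τ).subst ρ.right) (es 0) (es 1) ∧
        ∀ (α₁ α₂ : Ty 0) (R : WRel S 2), R.Mono → ∀ w ≤ n,
          (∀ x₁ x₂, ∀ v ≤ w, 0 < v → R v ![x₁, x₂] → ValPair α₁ α₂ x₁ x₂) →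
          SC (τ.subst (push α₁ ρ.left)) (τ.subst (push α₂ ρ.right))
            (SV τ (push (α₁, α₂, R.normal) ρ)) w ![.tapp (es 0) α₁, .tapp (es 1) α₂]
  | _, .ex τ, ρ => fun n es =>
      0 < n → ValPair ((Ty.ex τ).subst ρ.left) ((Ty.ex τ).subst ρ.right) (es 0) (es 1) ∧
        ∃ (α₁ α₂ : Ty 0) (y₁ y₂ : Tm S 0 0) (R : WRel S 2), R.Mono ∧
          (∀ x₁ x₂, ∀ v ≤ n, 0 < v → R v ![x₁, x₂] → ValPair α₁ α₂ x₁ x₂) ∧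
          es 0 = .pack α₁ y₁ (τ.subst (Ty.up ρ.left)) ∧
          es 1 = .pack α₂ y₂ (τ.subst (Ty.up ρ.right)) ∧
          SV τ (push (α₁, α₂, R.normal) ρ) n ![y₁, y₂]
  | _, .mu τ, ρ => WRel.fix fun X n es =>
      0 < n → ValPair ((Ty.mu τ).subst ρ.left) ((Ty.mu τ).subst ρ.right) (es 0) (es 1) ∧
        ∃ y₁ y₂, es 0 = .roll ((Ty.mu τ).subst ρ.left) y₁ ∧
          es 1 = .roll ((Ty.mu τ).subst ρ.right) y₂ ∧
          SV τ (push ((Ty.mu τ).subst ρ.left, (Ty.mu τ).subst ρ.right, X.normal) ρ) (n - 1)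
            ![y₁, y₂]

theorem SC_congr {T₁ T₂ : Ty 0} {R R' : WRel S 2} {N : ℕ} (h : ∀ n ≤ N, R n = R' n) :
    ∀ n ≤ N, SC T₁ T₂ R n = SC T₁ T₂ R' n := by
  intro n hn
  funext es
  refine propext <| imp_congr_right fun _ => and_congr_right fun _ => and_congr_right fun _ =>
    forall_congr' fun w => forall_congr' fun i => forall_congr' fun x₁ => imp_congr_right fun _ =>
    imp_congr_right fun hw => ?_
  rw [h w ((Nat.le_add_right w i).trans (hw.trans hn))]

theorem SC_mono {T₁ T₂ : Ty 0} {R : WRel S 2} : (SC T₁ T₂ R).Mono := by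
  intro n n' es hn h h0
  obtain ⟨h₁, h₂, h₃⟩ := h (h0.trans_le hn)
  exact ⟨h₁, h₂, fun w i x₁ hw hi => h₃ w i x₁ hw (hi.trans hn)⟩

/-- Two interpretations with the same types whose relations agree up to world `N`. -/
def SInterp.EqTo {j : ℕ} (N : ℕ) (ρ ρ' : SInterp S j) : Prop :=
  ∀ i, (ρ i).1 = (ρ' i).1 ∧ (ρ i).2.1 = (ρ' i).2.1 ∧ ∀ n ≤ N, (ρ i).2.2 n = (ρ' i).2.2 n

namespace SInterp.EqTo

variable {j N : ℕ} {ρ ρ' : SInterp S j}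

theorem refl (N : ℕ) (ρ : SInterp S j) : EqTo N ρ ρ := fun _ => ⟨rfl, rfl, fun _ _ => rfl⟩

theorem le (h : EqTo N ρ ρ') {n : ℕ} (hn : n ≤ N) : EqTo n ρ ρ' :=
  fun i => ⟨(h i).1, (h i).2.1, fun v hv => (h i).2.2 v (hv.trans hn)⟩

theorem left (h : EqTo N ρ ρ') : ρ.left = ρ'.left := funext fun i => (h i).1

theorem right (h : EqTo N ρ ρ') : ρ.right = ρ'.right := funext fun i => (h i).2.1

theorem push (h : EqTo N ρ ρ') (T₁ T₂ : Ty 0) {R R' : WRel S 2} (hR : ∀ n ≤ N, R n = R' n) :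
    EqTo N (FMu.push (T₁, T₂, R) ρ) (FMu.push (T₁, T₂, R') ρ') := fun i =>
  Fin.cases ⟨rfl, rfl, hR⟩ h i

end SInterp.EqTo

/-- Up to world `N`, the relation `𝒱⟦τ⟧ρ` depends on the relations of `ρ` up to world `N` only.
With the decrease of the world in the clause of recursive types this makes that clause
contractive. -/
theorem SV_congr {j : ℕ} (τ : Ty j) {N : ℕ} {ρ ρ' : SInterp S j} (h : ρ.EqTo N ρ') :
    ∀ n ≤ N, SV τ ρ n = SV τ ρ' n := by
  induction τ generalizing N with
  | var i => exact (h i).2.2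
  | base b => intro n _; rfl
  | prod τ τ' ih ih' =>
    intro n hn
    funext es
    simp only [SV, h.left, h.right, ih h n hn, ih' h n hn]
  | sum τ τ' ih ih' =>
    intro n hn
    funext es
    simp only [SV, h.left, h.right, ih h n hn, ih' h n hn]
  | arr τ τ' ih ih' =>
    intro n hn
    funext es
    simp only [SV, h.left, h.right]
    congr! 7 with _ y₁ y₂ w hw
    · rw [ih h w (hw.trans hn)]
    · rw [SC_congr (ih' h) w (hw.trans hn)]
  | all τ ih =>
    intro n hn
    funext es
    simp only [SV, h.left, h.right]
    refine propext <| imp_congr_right fun _ => and_congr_right fun _ => forall_congr' fun α₁ =>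
      forall_congr' fun α₂ => forall_congr' fun R => imp_congr_right fun _ =>
      forall_congr' fun w => forall_congr' fun hw => ?_
    rw [SC_congr (ih (h.push _ _ fun _ _ => rfl)) w (hw.trans hn)]
  | ex τ ih =>
    intro n hn
    funext es
    simp only [SV, h.left, h.right]
    congr! 16 with _ α₁ α₂ y₁ y₂ R
    rw [ih (h.push _ _ fun _ _ => rfl) n hn]
  | mu τ ih =>
    refine WRel.fix_congr fun n hn X X' hX => ?_
    funext es
    simp only [h.left, h.right]
    congr! 8 with h0
    rw [ih ((h.le hn).le (Nat.sub_le n 1) |>.push _ _ fun v hv =>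
      WRel.normal_congr (hX v (by omega))) _ le_rfl]

theorem SV_mu {j : ℕ} (τ : Ty (j + 1)) (ρ : SInterp S j) (n : ℕ) (es : Fin 2 → Tm S 0 0) :
    SV (.mu τ) ρ n es ↔ (0 < n →
      ValPair ((Ty.mu τ).subst ρ.left) ((Ty.mu τ).subst ρ.right) (es 0) (es 1) ∧
        ∃ y₁ y₂, es 0 = .roll ((Ty.mu τ).subst ρ.left) y₁ ∧
          es 1 = .roll ((Ty.mu τ).subst ρ.right) y₂ ∧
          SV τ (push ((Ty.mu τ).subst ρ.left, (Ty.mu τ).subst ρ.right, (SV (.mu τ) ρ).normal) ρ)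
            (n - 1) ![y₁, y₂]) := by
  rw [SV, WRel.fix_eq]
  intro X X' hX
  funext es
  congr! 8 with h0
  rw [SV_congr τ ((SInterp.EqTo.refl (n - 1) ρ).push _ _ fun v hv =>
    WRel.normal_congr (hX v (by omega))) _ le_rfl]

theorem SV_zero {j : ℕ} (τ : Ty j) (ρ : SInterp S j) (h : ∀ i es, (ρ i).2.2 0 es)
    (es : Fin 2 → Tm S 0 0) : SV τ ρ 0 es := by
  cases τ with
  | var i => exact h i es
  | mu τ => rw [SV_mu]; intro h; exact absurd h (lt_irrefl _)
  | _ => intro h; exact absurd h (lt_irrefl _)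

theorem SV_monoTo {j : ℕ} (τ : Ty j) {N : ℕ} {ρ : SInterp S j}
    (h : ∀ i, (ρ i).2.2.MonoTo N) : (SV τ ρ).MonoTo N := by
  induction τ generalizing N with
  | var i => exact h i
  | base b => exact fun n n' es _ hn' H h0 => H (h0.trans_le hn')
  | prod τ τ' ih ih' =>
    intro n n' es hn hn' H h0
    obtain ⟨hv, x₁, y₁, x₂, y₂, e₁, e₂, hx, hy⟩ := H (h0.trans_le hn')
    exact ⟨hv, x₁, y₁, x₂, y₂, e₁, e₂, ih h n n' _ hn hn' hx, ih' h n n' _ hn hn' hy⟩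
  | sum τ τ' ih ih' =>
    intro n n' es hn hn' H h0
    obtain ⟨hv, ⟨x₁, x₂, e₁, e₂, hx⟩ | ⟨x₁, x₂, e₁, e₂, hx⟩⟩ := H (h0.trans_le hn')
    · exact ⟨hv, .inl ⟨x₁, x₂, e₁, e₂, ih h n n' _ hn hn' hx⟩⟩
    · exact ⟨hv, .inr ⟨x₁, x₂, e₁, e₂, ih' h n n' _ hn hn' hx⟩⟩
  | arr τ τ' ih ih' =>
    intro n n' es hn hn' H h0
    obtain ⟨hv, H⟩ := H (h0.trans_le hn')
    exact ⟨hv, fun y₁ y₂ w hw => H y₁ y₂ w (hw.trans hn')⟩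
  | all τ ih =>
    intro n n' es hn hn' H h0
    obtain ⟨hv, H⟩ := H (h0.trans_le hn')
    exact ⟨hv, fun α₁ α₂ R hR w hw => H α₁ α₂ R hR w (hw.trans hn')⟩
  | ex τ ih =>
    intro n n' es hn hn' H h0
    obtain ⟨hv, α₁, α₂, y₁, y₂, R, hR, hRv, e₁, e₂, hy⟩ := H (h0.trans_le hn')
    refine ⟨hv, α₁, α₂, y₁, y₂, R, hR, fun x₁ x₂ v hv' => hRv x₁ x₂ v (hv'.trans hn'), e₁, e₂,
      ih (fun i => ?_) n n' _ hn hn' hy⟩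
    exact Fin.cases (WRel.mono_iff.1 (WRel.normal_mono hR) N) h i
  | mu τ ih =>
    induction N with
    | zero =>
      intro n n' es hn hn' _
      rw [SV_mu]
      intro h0
      omega
    | succ N ihN =>
      have hN := ihN fun i n n' es hn => h i n n' es (hn.trans (Nat.le_succ N))
      intro n n' es hn hn' H
      rw [SV_mu] at H ⊢
      intro h0
      obtain ⟨hv, y₁, y₂, e₁, e₂, hy⟩ := H (h0.trans_le hn')
      refine ⟨hv, y₁, y₂, e₁, e₂, ih (N := N) (fun i => ?_) (n - 1) (n' - 1) _ (by omega)
        (by omega) hy⟩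
      refine Fin.cases ?_ (fun i n n' es hn => h i n n' es (hn.trans (Nat.le_succ N))) i
      intro m m' es' hm hm' H' hm0
      exact hN m m' es' hm hm' (H' (hm0.trans_le hm'))

theorem SV_mono {j : ℕ} (τ : Ty j) {ρ : SInterp S j} (h : ∀ i, (ρ i).2.2.Mono) :
    (SV τ ρ).Mono :=
  WRel.mono_iff.2 fun N => SV_monoTo τ fun i => WRel.mono_iff.1 (h i) N

theorem SV_rename {j j' : ℕ} (ζ : Fin j → Fin j') (τ : Ty j) (ρ : SInterp S j') :
    SV (τ.rename ζ) ρ = SV τ (fun i => ρ (ζ i)) := by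
  induction τ generalizing j' with
  | var i => rfl
  | base b => rfl
  | prod τ τ' ih ih' => simp only [Ty.rename, SV, ih, ih', Ty.subst, Ty.subst_rename]; rfl
  | sum τ τ' ih ih' => simp only [Ty.rename, SV, ih, ih', Ty.subst, Ty.subst_rename]; rfl
  | arr τ τ' ih ih' => simp only [Ty.rename, SV, ih, ih', Ty.subst, Ty.subst_rename]; rfl
  | all τ ih =>
    simp only [Ty.rename, SV, ih, Ty.subst, Ty.subst_rename, push_comp_upRen, Ty.up_comp_upRen]; rfl
  | ex τ ih =>
    simp only [Ty.rename, SV, ih, Ty.subst, Ty.subst_rename, push_comp_upRen, Ty.up_comp_upRen]; rfl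
  | mu τ ih =>
    simp only [Ty.rename, SV, ih, Ty.subst, Ty.subst_rename, push_comp_upRen, Ty.up_comp_upRen]; rfl

/-- The interpretation of the variables of `τ` in `τ.subst s` under `ρ`. -/
def SInterp.pull {j j' : ℕ} (s : Fin j → Ty j') (ρ : SInterp S j') : SInterp S j :=
  fun i => ((s i).subst ρ.left, (s i).subst ρ.right, SV (s i) ρ)

theorem SInterp.pull_up {j j' : ℕ} (s : Fin j → Ty j') (ρ : SInterp S j')
    (p : Ty 0 × Ty 0 × WRel S 2) :
    SInterp.pull (Ty.up s) (push p ρ) = push p (SInterp.pull s ρ) := by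
  funext i
  refine Fin.cases rfl (fun i => ?_) i
  simp only [pull, Ty.up, push, Fin.cons_succ, Ty.subst_rename, SV_rename]
  rfl

theorem Ty.push_up_subst {j j' j'' : ℕ} (s : Fin j → Ty j') (σ : Fin j' → Ty j'') (T : Ty j'') :
    (fun i => (Ty.up s i).subst (push T σ)) = push T (fun i => (s i).subst σ) := by
  funext i
  refine Fin.cases rfl (fun i => ?_) i
  simp only [up, push, Fin.cons_succ, Ty.subst_rename]

/-- Compositionality: type substitution corresponds to the semantic interpretation of the
substituted types. -/
theorem SV_subst {j j' : ℕ} (s : Fin j → Ty j') (τ : Ty j) (ρ : SInterp S j') :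
    SV (τ.subst s) ρ = SV τ (ρ.pull s) := by
  induction τ generalizing j' with
  | var i => rfl
  | base b => rfl
  | prod τ τ' ih ih' => simp only [SV, ih, ih', Ty.subst, Ty.subst_subst]; rfl
  | sum τ τ' ih ih' => simp only [SV, ih, ih', Ty.subst, Ty.subst_subst]; rfl
  | arr τ τ' ih ih' => simp only [SV, ih, ih', Ty.subst, Ty.subst_subst]; rfl
  | all τ ih =>
    simp only [SV, ih, Ty.subst, Ty.subst_subst, Ty.subst_up, SInterp.pull_up,
      Ty.push_up_subst]; rfl
  | ex τ ih =>
    simp only [SV, ih, Ty.subst, Ty.subst_subst, Ty.subst_up, SInterp.pull_up]; rfl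
  | mu τ ih =>
    simp only [SV, ih, Ty.subst, Ty.subst_subst, Ty.subst_up, SInterp.pull_up]; rfl

theorem SV_inst {j : ℕ} (τ : Ty (j + 1)) (τ' : Ty j) (ρ : SInterp S j) :
    SV (τ.inst τ') ρ = SV τ (push (τ'.subst ρ.left, τ'.subst ρ.right, SV τ' ρ) ρ) := by
  rw [Ty.inst, SV_subst]
  congr 1
  funext i
  exact Fin.cases rfl (fun i => rfl) i

/-- Interpretations by monotone relations which are true in world `0` and relate values of the
given types in the positive worlds up to `N`. -/
structure SInterp.Valid {j : ℕ} (N : ℕ) (ρ : SInterp S j) : Prop where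
  mono : ∀ i, (ρ i).2.2.Mono
  zero : ∀ i es, (ρ i).2.2 0 es
  val : ∀ i x₁ x₂, ∀ v ≤ N, 0 < v → (ρ i).2.2 v ![x₁, x₂] → ValPair (ρ i).1 (ρ i).2.1 x₁ x₂

theorem SInterp.Valid.le {j N n : ℕ} {ρ : SInterp S j} (h : ρ.Valid N) (hn : n ≤ N) :
    ρ.Valid n :=
  ⟨h.mono, h.zero, fun i x₁ x₂ v hv => h.val i x₁ x₂ v (hv.trans hn)⟩

theorem SInterp.Valid.push {j N : ℕ} {ρ : SInterp S j} (h : ρ.Valid N) {T₁ T₂ : Ty 0}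
    {R : WRel S 2} (hR : R.Mono)
    (hv : ∀ x₁ x₂, ∀ v ≤ N, 0 < v → R v ![x₁, x₂] → ValPair T₁ T₂ x₁ x₂) :
    SInterp.Valid N (FMu.push (T₁, T₂, R.normal) ρ) where
  mono i := Fin.cases (WRel.normal_mono hR) h.mono i
  zero i := Fin.cases (WRel.normal_zero R) h.zero i
  val i := Fin.cases (fun x₁ x₂ v hv' h0 H => hv x₁ x₂ v hv' h0 (H h0)) h.val i

theorem SV_valPair {j : ℕ} (τ : Ty j) {N : ℕ} {ρ : SInterp S j} (h : ρ.Valid N)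
    (x₁ x₂ : Tm S 0 0) (v : ℕ) (hv : v ≤ N) (h0 : 0 < v) (H : SV τ ρ v ![x₁, x₂]) :
    ValPair (τ.subst ρ.left) (τ.subst ρ.right) x₁ x₂ := by
  cases τ with
  | var i => exact h.val i x₁ x₂ v hv h0 H
  | mu τ => rw [SV_mu] at H; exact (H h0).1
  | _ => exact (H h0).1

end

/-! ### Interpretation of the logic -/

section
variable {S : PrimSig}

theorem REnv.push_upRVar {Δ Δ' : RCtx} {b : ℕ} (R : WRel S b) (δ : REnv S Δ')
    (η : ∀ a, RVar Δ a → RVar Δ' a) :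
    (fun a r => (δ.push R) a (upRVar η a r)) = REnv.push R (fun a r => δ a (η a r)) := by
  funext a r
  cases r <;> rfl

theorem pushN_upRenN {A : Type} {m m' : ℕ} (f : Fin m' → A) (ξ : Fin m → Fin m') (n : ℕ)
    (as : Fin n → A) :
    (fun i => pushN f n as (upRenN ξ n i)) = pushN (fun i => f (ξ i)) n as := by
  induction n with
  | zero => rfl
  | succ n ih => exact (push_comp_upRen _ _ _).trans (congrArg _ (ih _))

namespace LRel

theorem interp_zero {k m a : ℕ} {Δ : RCtx} (R : LRel S k m Δ a) (σ : Fin k → Ty 0)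
    (θ : Fin m → Tm S 0 0) (δ : REnv S Δ) (es : Fin a → Tm S 0 0) : R.interp σ θ δ 0 es := by
  cases R <;> trivial

theorem interp_rename {k k' m m' a : ℕ} {Δ Δ' : RCtx} (ζ : Fin k → Fin k') (ξ : Fin m → Fin m')
    (η : ∀ a, RVar Δ a → RVar Δ' a) (R : LRel S k m Δ a) (σ : Fin k' → Ty 0)
    (θ : Fin m' → Tm S 0 0) (δ : REnv S Δ') :
    (R.rename ζ ξ η).interp σ θ δ =
      R.interp (fun i => σ (ζ i)) (fun i => θ (ξ i)) (fun a r => δ a (η a r)) := by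
  funext n es
  induction R generalizing k' m' Δ' n with
  | mu R ih =>
    cases n with
    | zero => simp only [rename, interp]
    | succ n =>
      simp only [rename, interp]
      congr 2
      funext X n es
      rw [ih, REnv.push_upRVar]
  | _ =>
    cases n <;>
    simp only [rename, interp, Tm.subst_rename, Ty.subst_rename, push_comp_upRen,
      REnv.push_upRVar, pushN_upRenN, *]

theorem interp_wkTm {k m a : ℕ} {Δ : RCtx} (n : ℕ) (R : LRel S k m Δ a) (σ : Fin k → Ty 0)
    (θ : Fin (m + n) → Tm S 0 0) (δ : REnv S Δ) :
    (R.wkTm n).interp σ θ δ = R.interp σ (fun i => θ (i.addNat n)) δ :=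
  interp_rename _ _ _ _ _ _ _

theorem interp_wkTy {k m a : ℕ} {Δ : RCtx} (n : ℕ) (R : LRel S k m Δ a) (σ : Fin (k + n) → Ty 0)
    (θ : Fin m → Tm S 0 0) (δ : REnv S Δ) :
    (R.wkTy n).interp σ θ δ = R.interp (fun i => σ (i.addNat n)) θ δ :=
  interp_rename _ _ _ _ _ _ _

theorem interp_wkRel {k m a b : ℕ} {Δ : RCtx} (R : LRel S k m Δ a) (σ : Fin k → Ty 0)
    (θ : Fin m → Tm S 0 0) (δ : REnv S Δ) (X : WRel S b) :
    (R.wkRel b).interp σ θ (δ.push X) = R.interp σ θ δ :=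
  interp_rename _ _ _ _ _ _ _

theorem interp_var_here {k m b : ℕ} {Δ : RCtx} (σ : Fin k → Ty 0)
    (θ : Fin m → Tm S 0 0) (δ : REnv S Δ) (X : WRel S b) :
    (var .here : LRel S k m (b :: Δ) b).interp σ θ (δ.push X) = X.normal := by
  funext n es
  cases n with
  | zero => simp [interp, WRel.normal]
  | succ n => simp [interp, WRel.normal, REnv.push]

end LRel

/-- Brings the arguments of a membership proposition into the form of a literal vector. -/
theorem vec2_eq {A : Type} (es : Fin 2 → A) : ![es 0, es 1] = es := by
  funext i
  fin_cases i <;> rfl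

namespace LRel
variable {k m : ℕ} {Δ : RCtx}

theorem interp_valTy (e : Tm S k m) (τ : Ty k) (σ : Fin k → Ty 0) (θ : Fin m → Tm S 0 0)
    (δ : REnv S Δ) (n : ℕ) (es : Fin 0 → Tm S 0 0) :
    (valTy e τ).interp σ θ δ n es ↔
      (0 < n → HasTy TyCtx.nil (e.subst σ θ) (τ.subst σ) ∧ (e.subst σ θ).IsVal) := by
  cases n <;> simp [valTy, isVal, interp]

theorem interp_isVRel (R : LRel S k m Δ 2) (τ₁ τ₂ : Ty k) (σ : Fin k → Ty 0)
    (θ : Fin m → Tm S 0 0) (δ : REnv S Δ) (n : ℕ) (es : Fin 0 → Tm S 0 0) :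
    (isVRel R τ₁ τ₂).interp σ θ δ n es ↔ ∀ x₁ x₂, ∀ v ≤ n, 0 < v →
      R.interp σ θ δ v ![x₁, x₂] → ValPair (τ₁.subst σ) (τ₂.subst σ) x₁ x₂ := by
  cases n with
  | zero =>
    simp only [interp_zero, true_iff]
    intro x₁ x₂ v hv h0; omega
  | succ n =>
    simp only [isVRel, interp]
    refine forall_congr' fun x₁ => forall_congr' fun x₂ => forall_congr' fun v =>
      imp_congr_right fun _ => ?_
    cases v with
    | zero => simp [interp_zero]
    | succ v =>
      simp only [interp, interp_valTy, interp_wkTm, Nat.succ_pos, true_imp_iff, ValPair]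
      have : (fun i => (![Tm.var 1, Tm.var 0] i : Tm S k (m + 2)).subst σ (push x₂ (push x₁ θ))) =
          ![x₁, x₂] := by
        funext i; fin_cases i <;> rfl
      rw [this]
      rfl

theorem interp_absVal (τ₁ τ₂ : Ty k) (P : LRel S k (m + 2) Δ 0) (σ : Fin k → Ty 0)
    (θ : Fin m → Tm S 0 0) (δ : REnv S Δ) :
    (absVal τ₁ τ₂ P).interp σ θ δ = fun n es => 0 < n →
      ValPair (τ₁.subst σ) (τ₂.subst σ) (es 0) (es 1) ∧
        P.interp σ (push (es 0) (push (es 1) θ)) δ n Fin.elim0 := by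
  funext n es
  cases n with
  | zero => simp [interp_zero]
  | succ n =>
    simp only [absVal, interp, interp_valTy, Nat.succ_pos, true_imp_iff, ValPair, eq_iff_iff,
      and_assoc]
    rfl

theorem interp_absTm (τ₁ τ₂ : Ty k) (P : LRel S k (m + 2) Δ 0) (σ : Fin k → Ty 0)
    (θ : Fin m → Tm S 0 0) (δ : REnv S Δ) :
    (absTm τ₁ τ₂ P).interp σ θ δ = fun n es => 0 < n →
      HasTy TyCtx.nil (es 0) (τ₁.subst σ) ∧ HasTy TyCtx.nil (es 1) (τ₂.subst σ) ∧
        P.interp σ (push (es 0) (push (es 1) θ)) δ n Fin.elim0 := by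
  funext n es
  cases n with
  | zero => simp [interp_zero]
  | succ n =>
    simp only [absTm, interp, Nat.succ_pos, true_imp_iff]
    rfl

end LRel

/-- The clause of the recursive definition of `𝒞⟦τ⟧ρ`, for types `T₁`, `T₂` and a relation `R` on
values, as an operator on world-indexed relations. -/
def compStep (T₁ T₂ : Ty 0) (R X : WRel S 2) : WRel S 2 := fun n es =>
  0 < n → HasTy TyCtx.nil (es 0) T₁ ∧ HasTy TyCtx.nil (es 1) T₂ ∧
    (∀ x₁, ∀ v ≤ n, 0 < v → StepsN 0 (es 0) x₁ ∧ x₁.IsVal → ∃ x₂, Ciu x₂ (es 1) ∧ R v ![x₁, x₂]) ∧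
    ∀ t, ∀ v ≤ n, 0 < v → StepsN 1 (es 0) t → X.normal (v - 1) ![t, es 1]

/-- The recursive definition of the relation on terms agrees with `SC`.  By subject reduction the
typing condition need not be repeated along a reduction sequence. -/
theorem fix_compStep (T₁ T₂ : Ty 0) (R : WRel S 2) :
    WRel.fix (compStep T₁ T₂ R) = SC T₁ T₂ R := by
  funext n
  induction n using Nat.strong_induction_on with
  | _ n ih =>
    rw [WRel.fix]
    funext es
    refine propext <| imp_congr_right fun h0 => and_congr_right fun h₁ =>
      and_congr_right fun h₂ => ?_
    constructor
    · rintro ⟨hV, hX⟩ w i x₁ hw hi hs hv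
      cases i with
      | zero => exact hV x₁ w hi hw ⟨hs, hv⟩
      | succ i =>
        obtain ⟨t, ht, hs⟩ := hs.split
        have := hX t n le_rfl h0 ht (by omega) (by omega)
        rw [ih _ (by omega)] at this
        exact (this (by omega)).2.2 w i x₁ hw (by omega) hs hv
    · intro H
      refine ⟨fun x₁ v hv h0 hs => H v 0 x₁ h0 hv hs.1 hs.2, fun t v hv hv0 ht h0' hlt => ?_⟩
      rw [ih _ hlt]
      intro _
      exact ⟨ht.preserves h₁, h₂, fun w i x₁ hw hi hs hx =>
        H w (1 + i) x₁ hw (by omega) (ht.trans hs) hx⟩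

namespace LRel
variable {k m : ℕ} {Δ : RCtx}

theorem interp_compRel (τ₁ τ₂ : Ty k) (V : LRel S k m Δ 2) (σ : Fin k → Ty 0)
    (θ : Fin m → Tm S 0 0) (δ : REnv S Δ) :
    (compRel τ₁ τ₂ V).interp σ θ δ = SC (τ₁.subst σ) (τ₂.subst σ) (V.interp σ θ δ) := by
  funext n es
  cases n with
  | zero => simp [interp_zero, SC]
  | succ n =>
    rw [← fix_compStep]
    simp only [compRel, interp, interp_absTm]
    congr 2
    funext X n es
    refine propext <| imp_congr_right fun h0 => and_congr_right fun _ => and_congr_right fun _ => ?_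
    obtain ⟨n, rfl⟩ : ∃ n', n = n' + 1 := ⟨n - 1, by omega⟩
    simp only [interp]
    refine and_congr ?_ ?_
    · refine forall_congr' fun x₁ => forall_congr' fun v => imp_congr_right fun _ => ?_
      cases v with
      | zero => simp [interp_zero]
      | succ v =>
        simp only [evals₀, isVal, interp, interp_wkTm, interp_wkRel, Nat.succ_pos, true_imp_iff]
        refine imp_congr_right fun _ => exists_congr fun x₂ => and_congr_right fun _ => ?_
        rw [← vec2_eq (fun i => Tm.subst _ _ _)]
        rfl
    · refine forall_congr' fun x₁ => forall_congr' fun v => imp_congr_right fun _ => ?_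
      cases v with
      | zero => simp [interp_zero]
      | succ v =>
        simp only [interp, Nat.succ_pos, true_imp_iff, Nat.add_sub_cancel]
        refine imp_congr_right fun _ => ?_
        cases v with
        | zero => simp [interp_zero, WRel.normal]
        | succ v =>
          simp only [interp, Nat.succ_pos, true_imp_iff, WRel.normal, REnv.push]
          rw [← vec2_eq (fun i => Tm.subst _ _ _)]
          rfl

end LRel

/-- The semantic interpretation denoted by a syntactic one. -/
def RelInterp.sem {j k m : ℕ} {Δ : RCtx} (ρ : RelInterp S j k m Δ) (σ : Fin k → Ty 0)
    (θ : Fin m → Tm S 0 0) (δ : REnv S Δ) : SInterp S j :=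
  fun i => ((ρ i).1.subst σ, (ρ i).2.1.subst σ, (ρ i).2.2.interp σ θ δ)

section
variable {j k m : ℕ} {Δ : RCtx}

theorem RelInterp.sem_wk (a b : ℕ) (ρ : RelInterp S j k m Δ) (σ : Fin (k + a) → Ty 0)
    (θ : Fin (m + b) → Tm S 0 0) (δ : REnv S Δ) (X : WRel S 2) :
    (ρ.wk a b).sem σ θ (δ.push X) =
      ρ.sem (fun i => σ (i.addNat a)) (fun i => θ (i.addNat b)) δ := by
  funext i
  simp only [sem, wk, Ty.subst_rename, LRel.interp_wkRel, LRel.interp_wkTm, LRel.interp_wkTy]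

theorem RelInterp.sem_extend (ρ : RelInterp S j k m Δ) (τ₁ τ₂ : Ty k) (R : LRel S k m Δ 2)
    (σ : Fin k → Ty 0) (θ : Fin m → Tm S 0 0) (δ : REnv S Δ) :
    (ρ.extend τ₁ τ₂ R).sem σ θ δ =
      push (τ₁.subst σ, τ₂.subst σ, R.interp σ θ δ) (ρ.sem σ θ δ) := by
  funext i
  exact Fin.cases rfl (fun i => rfl) i

theorem RelInterp.subst_left (ρ : RelInterp S j k m Δ) (τ : Ty j) (σ : Fin k → Ty 0)
    (θ : Fin m → Tm S 0 0) (δ : REnv S Δ) :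
    (τ.subst ρ.left).subst σ = τ.subst (ρ.sem σ θ δ).left := Ty.subst_subst _ _ _

theorem RelInterp.subst_right (ρ : RelInterp S j k m Δ) (τ : Ty j) (σ : Fin k → Ty 0)
    (θ : Fin m → Tm S 0 0) (δ : REnv S Δ) :
    (τ.subst ρ.right).subst σ = τ.subst (ρ.sem σ θ δ).right := Ty.subst_subst _ _ _

/-- The relation `𝒱⟦τ⟧ρ` of the logic denotes the semantic relation. -/
theorem interp_VRel (τ : Ty j) (ρ : RelInterp S j k m Δ) (σ : Fin k → Ty 0)
    (θ : Fin m → Tm S 0 0) (δ : REnv S Δ) :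
    (VRel τ ρ).interp σ θ δ = SV τ (ρ.sem σ θ δ) := by
  induction τ generalizing k m Δ with
  | var i => rfl
  | base b =>
    simp only [VRel, LRel.interp_absVal, SV]
    funext n es
    refine propext <| imp_congr_right fun h0 => and_congr_right fun _ => ?_
    obtain ⟨n, rfl⟩ : ∃ n', n = n' + 1 := ⟨n - 1, by omega⟩
    rfl
  | prod τ τ' ih ih' =>
    simp only [VRel, LRel.interp_absVal, SV, ρ.subst_left _ σ θ δ, ρ.subst_right _ σ θ δ]
    funext n es
    refine propext <| imp_congr_right fun h0 => and_congr_right fun _ => ?_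
    obtain ⟨n, rfl⟩ : ∃ n', n = n' + 1 := ⟨n - 1, by omega⟩
    simp only [LRel.interp, LRel.interp_wkTm, ih, ih']
    refine exists_congr fun x₁ => exists_congr fun y₁ => exists_congr fun x₂ =>
      exists_congr fun y₂ => and_congr_right fun _ => and_congr_right fun _ => and_congr ?_ ?_
    · rw [← vec2_eq (fun i => Tm.subst _ _ _)]; rfl
    · rw [← vec2_eq (fun i => Tm.subst _ _ _)]; rfl
  | sum τ τ' ih ih' =>
    simp only [VRel, LRel.interp_absVal, SV, ρ.subst_left _ σ θ δ, ρ.subst_right _ σ θ δ]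
    funext n es
    refine propext <| imp_congr_right fun h0 => and_congr_right fun _ => ?_
    obtain ⟨n, rfl⟩ : ∃ n', n = n' + 1 := ⟨n - 1, by omega⟩
    simp only [LRel.interp, LRel.interp_wkTm, ih, ih', Tm.subst, ρ.subst_left _ σ θ δ,
      ρ.subst_right _ σ θ δ]
    refine or_congr ?_ ?_ <;>
    · refine exists_congr fun x₁ => exists_congr fun x₂ =>
        and_congr_right fun _ => and_congr_right fun _ => ?_
      rw [← vec2_eq (fun i => Tm.subst _ _ _)]; rfl
  | arr τ τ' ih ih' =>
    simp only [VRel, LRel.interp_absVal, SV, ρ.subst_left _ σ θ δ, ρ.subst_right _ σ θ δ]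
    funext n es
    refine propext <| imp_congr_right fun h0 => and_congr_right fun _ => ?_
    obtain ⟨n, rfl⟩ : ∃ n', n = n' + 1 := ⟨n - 1, by omega⟩
    simp only [LRel.interp]
    refine forall_congr' fun y₁ => forall_congr' fun y₂ => forall_congr' fun w =>
      imp_congr_right fun _ => ?_
    cases w with
    | zero => simp [LRel.interp_zero, SC]
    | succ w =>
      simp only [LRel.interp, LRel.interp_wkTm, LRel.interp_compRel, ih, ih',
        ρ.subst_left _ σ θ δ, ρ.subst_right _ σ θ δ]
      refine imp_congr ?_ ?_
      · rw [← vec2_eq (fun i => Tm.subst _ _ _)]; rfl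
      · rw [← vec2_eq (fun i => Tm.subst _ _ _)]; rfl
  | all τ ih =>
    simp only [VRel, LRel.interp_absVal, SV, ρ.subst_left _ σ θ δ, ρ.subst_right _ σ θ δ]
    funext n es
    refine propext <| imp_congr_right fun h0 => and_congr_right fun _ => ?_
    obtain ⟨n, rfl⟩ : ∃ n', n = n' + 1 := ⟨n - 1, by omega⟩
    simp only [LRel.interp]
    refine forall_congr' fun α₁ => forall_congr' fun α₂ => forall_congr' fun R =>
      imp_congr_right fun _ => forall_congr' fun w => imp_congr_right fun _ => ?_
    cases w with
    | zero => simp [LRel.interp_zero, SC]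
    | succ w =>
      have hs : ((ρ.wk 2 2).extend (.var 1) (.var 0) (.var .here)).sem
          (push α₂ (push α₁ σ)) (push (es 0) (push (es 1) θ)) (δ.push R) =
          push (α₁, α₂, R.normal) (ρ.sem σ θ δ) := by
        rw [RelInterp.sem_extend, LRel.interp_var_here, RelInterp.sem_wk]; rfl
      have hl := RelInterp.subst_left ((ρ.wk 2 2).extend (.var 1) (.var 0) (.var .here)) τ
        (push α₂ (push α₁ σ)) (push (es 0) (push (es 1) θ)) (δ.push R)
      have hr := RelInterp.subst_right ((ρ.wk 2 2).extend (.var 1) (.var 0) (.var .here)) τ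
        (push α₂ (push α₁ σ)) (push (es 0) (push (es 1) θ)) (δ.push R)
      rw [hs, SInterp.left_push] at hl
      rw [hs, SInterp.right_push] at hr
      rw [LRel.interp_isVRel, LRel.interp_var_here]
      simp only [LRel.interp, LRel.interp_compRel, ih]
      refine imp_congr ?_ ?_
      · refine forall_congr' fun x₁ => forall_congr' fun x₂ => forall_congr' fun v =>
          imp_congr_right fun _ => imp_congr_right fun hv => ?_
        exact imp_congr ⟨fun h => h hv, fun h _ => h⟩ Iff.rfl
      · rw [← vec2_eq (fun i => Tm.subst _ _ _)]
        exact iff_of_eq (congr (congrFun (congr (congr (congrArg SC hl) hr)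
          (congrArg (SV τ) hs)) _) rfl)
  | ex τ ih =>
    simp only [VRel, LRel.interp_absVal, SV, ρ.subst_left _ σ θ δ, ρ.subst_right _ σ θ δ]
    funext n es
    refine propext <| imp_congr_right fun h0 => and_congr_right fun _ => ?_
    obtain ⟨n, rfl⟩ : ∃ n', n = n' + 1 := ⟨n - 1, by omega⟩
    simp only [LRel.interp]
    refine exists_congr fun α₁ => exists_congr fun α₂ => exists_congr fun y₁ =>
      exists_congr fun y₂ => exists_congr fun R => and_congr_right fun _ => ?_
    have hs : ((ρ.wk 2 4).extend (.var 1) (.var 0) (.var .here)).sem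
        (push α₂ (push α₁ σ)) (push y₂ (push y₁ (push (es 0) (push (es 1) θ)))) (δ.push R) =
        push (α₁, α₂, R.normal) (ρ.sem σ θ δ) := by
      rw [RelInterp.sem_extend, LRel.interp_var_here, RelInterp.sem_wk]; rfl
    have hw : (ρ.wk 2 4).sem (push α₂ (push α₁ σ))
        (push y₂ (push y₁ (push (es 0) (push (es 1) θ)))) (δ.push R) = ρ.sem σ θ δ := by
      rw [RelInterp.sem_wk]; rfl
    have hl : (τ.subst (Ty.up (ρ.wk 2 4).left)).subst (Ty.up (push α₂ (push α₁ σ))) =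
        τ.subst (Ty.up (ρ.sem σ θ δ).left) := by
      rw [Ty.subst_subst, Ty.subst_up, ← hw]; rfl
    have hr : (τ.subst (Ty.up (ρ.wk 2 4).right)).subst (Ty.up (push α₂ (push α₁ σ))) =
        τ.subst (Ty.up (ρ.sem σ θ δ).right) := by
      rw [Ty.subst_subst, Ty.subst_up, ← hw]; rfl
    rw [LRel.interp_isVRel, LRel.interp_var_here]
    simp only [ih, Tm.subst, hl, hr]
    refine and_congr ?_ (and_congr_right fun _ => and_congr_right fun _ => ?_)
    · refine forall_congr' fun x₁ => forall_congr' fun x₂ => forall_congr' fun v =>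
        imp_congr_right fun _ => imp_congr_right fun hv => ?_
      exact imp_congr ⟨fun h => h hv, fun h _ => h⟩ Iff.rfl
    · rw [← vec2_eq (fun i => Tm.subst _ _ _)]
      exact iff_of_eq (congr (congrFun (congrArg (SV τ) hs) _) rfl)
  | mu τ ih =>
    funext n es
    cases n with
    | zero => rw [SV_mu]; simp [LRel.interp_zero]
    | succ n =>
      simp only [VRel, LRel.interp, LRel.interp_absVal, SV, ρ.subst_left _ σ θ δ,
        ρ.subst_right _ σ θ δ]
      congr 2
      funext X n es
      refine propext <| imp_congr_right fun h0 => and_congr_right fun _ => ?_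
      obtain ⟨n, rfl⟩ : ∃ n', n = n' + 1 := ⟨n - 1, by omega⟩
      simp only [LRel.interp, Tm.subst, ρ.subst_left _ σ θ δ, ρ.subst_right _ σ θ δ]
      refine exists_congr fun y₁ => exists_congr fun y₂ => and_congr_right fun _ =>
        and_congr_right fun _ => ?_
      have hs : ((ρ.wk 0 4).extend ((Ty.mu τ).subst ρ.left) ((Ty.mu τ).subst ρ.right)
          (.var .here)).sem σ (push y₂ (push y₁ (push (es 0) (push (es 1) θ)))) (δ.push X) =
          push ((Ty.mu τ).subst (ρ.sem σ θ δ).left, (Ty.mu τ).subst (ρ.sem σ θ δ).right,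
            X.normal) (ρ.sem σ θ δ) := by
        rw [RelInterp.sem_extend, LRel.interp_var_here, RelInterp.sem_wk, ρ.subst_left _ σ θ δ,
          ρ.subst_right _ σ θ δ]
        rfl
      cases n with
      | zero =>
        refine iff_of_true (LRel.interp_zero _ _ _ _ _) (SV_zero τ _ (fun i => ?_) _)
        exact Fin.cases (WRel.normal_zero X) (fun i es => LRel.interp_zero _ _ _ _ _) i
      | succ n =>
        simp only [LRel.interp, ih]
        rw [← vec2_eq (fun i => Tm.subst _ _ _)]
        exact iff_of_eq (congr (congrFun (congrArg (SV τ) hs) _) rfl)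

theorem interp_CRel (τ : Ty j) (ρ : RelInterp S j k m Δ) (σ : Fin k → Ty 0)
    (θ : Fin m → Tm S 0 0) (δ : REnv S Δ) :
    (CRel τ ρ).interp σ θ δ =
      SC (τ.subst (ρ.sem σ θ δ).left) (τ.subst (ρ.sem σ θ δ).right) (SV τ (ρ.sem σ θ δ)) := by
  rw [CRel, LRel.interp_compRel, interp_VRel, ρ.subst_left _ σ θ δ, ρ.subst_right _ σ θ δ]

end

/-! ### Semantic logical approximation -/

/-- Related closing substitutions for the term variables of `Γ`. -/
def SEnv {k m : ℕ} (Γ : TyCtx k m) (ρ : SInterp S k) (n : ℕ) (γ₁ γ₂ : Fin m → Tm S 0 0) : Prop :=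
  ∀ x, SV (Γ x) ρ n ![γ₁ x, γ₂ x]

/-- The relation `𝒞⟦τ⟧ρ` on closed terms. -/
abbrev SE {k : ℕ} (τ : Ty k) (ρ : SInterp S k) : WRel S 2 :=
  SC (τ.subst ρ.left) (τ.subst ρ.right) (SV τ ρ)

/-- Logical approximation in the model: closed instances by related substitutions are related. -/
def SLog {k m : ℕ} (Γ : TyCtx k m) (e₁ e₂ : Tm S k m) (τ : Ty k) : Prop :=
  HasTy Γ e₁ τ ∧ HasTy Γ e₂ τ ∧ ∀ (n : ℕ) (ρ : SInterp S k) (γ₁ γ₂ : Fin m → Tm S 0 0),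
    ρ.Valid n → SEnv Γ ρ n γ₁ γ₂ → SE τ ρ n ![e₁.subst ρ.left γ₁, e₂.subst ρ.right γ₂]

/-- The interpretation of the relation variables `r₁, …, rₖ` by given relations. -/
def binEnv : (k : ℕ) → (Fin k → WRel S 2) → REnv S (binRels k)
  | 0, _ => fun _ r => nomatch r
  | k + 1, R => REnv.push (R 0) (binEnv k fun i => R i.succ)

theorem binEnv_binRel {k : ℕ} (R : Fin k → WRel S 2) (i : Fin k) :
    binEnv k R 2 (binRel i) = R i := by
  induction k with
  | zero => exact i.elim0
  | succ k ih =>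
    obtain ⟨i, hi⟩ := i
    cases i with
    | zero => rfl
    | succ i => exact ih (fun i => R i.succ) ⟨i, Nat.lt_of_succ_lt_succ hi⟩

theorem binEnv_mono {k : ℕ} (R : Fin k → WRel S 2) (h : ∀ i, (R i).Mono) (a : ℕ)
    (r : RVar (binRels k) a) : (binEnv k R a r).Mono := by
  induction k with
  | zero => cases r
  | succ k ih =>
    cases r with
    | here => exact h 0
    | there r => exact ih (fun i => R i.succ) (fun i => h i.succ) r

/-- Every valid interpretation and every pair of related substitutions are instances of the
variables quantified in the entailment that defines logical approximation. -/
theorem LogApprox.sLog {k m : ℕ} {Γ : TyCtx k m} {e₁ e₂ : Tm S k m} {τ : Ty k}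
    (h : LogApprox Γ e₁ e₂ τ) : SLog Γ e₁ e₂ τ := by
  obtain ⟨h₁, h₂, h⟩ := h
  refine ⟨h₁, h₂, fun n ρ γ₁ γ₂ hρ hγ => ?_⟩
  cases n with
  | zero => intro h; exact absurd h (lt_irrefl _)
  | succ n =>
    let σ : Fin (k + k) → Ty 0 := Fin.append ρ.left ρ.right
    let θ : Fin (m + m) → Tm S 0 0 := Fin.append γ₁ γ₂
    let δ := binEnv k fun i => (ρ i).2.2
    have hsem : (canonInterp S k m).sem σ θ δ = ρ := by
      funext i
      refine Prod.ext ?_ (Prod.ext ?_ ?_)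
      · exact Fin.append_left ρ.left ρ.right i
      · exact Fin.append_right ρ.left ρ.right i
      · funext n es
        cases n with
        | zero => simp [RelInterp.sem, LRel.interp_zero, hρ.zero]
        | succ n => simp [RelInterp.sem, canonInterp, LRel.interp, δ, binEnv_binRel]
    have hl : ∀ x, Fin.append γ₁ γ₂ (Fin.castAdd m x) = γ₁ x := Fin.append_left γ₁ γ₂
    have hr : ∀ x, Fin.append γ₁ γ₂ (Fin.natAdd m x) = γ₂ x := Fin.append_right γ₁ γ₂
    have := h (n + 1) σ θ δ (binEnv_mono _ hρ.mono) (by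
      rintro Q (⟨i, rfl⟩ | ⟨x, rfl⟩)
      · rw [LRel.interp_isVRel]
        intro x₁ x₂ v hv h0 H
        have hi := hρ.val i x₁ x₂ v hv h0
        rw [← hsem] at hi
        exact hi H
      · simp only [LRel.interp, interp_VRel, hsem]
        rw [← vec2_eq (fun i => Tm.subst _ _ _)]
        have := hγ x
        rw [← hl, ← hr] at this
        exact this)
    simp only [LRel.interp, interp_CRel, hsem] at this
    rw [← vec2_eq (fun i => Tm.subst _ _ _)] at this
    have e1 : (e₁.subst (canonInterp S k m).left fun x => .var (Fin.castAdd m x)).subst σ θ =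
        e₁.subst ρ.left γ₁ := by
      rw [Tm.subst_subst, ← hsem]
      congr 1
      funext x; exact hl x
    have e2 : (e₂.subst (canonInterp S k m).right fun x => .var (Fin.natAdd m x)).subst σ θ =
        e₂.subst ρ.right γ₂ := by
      rw [Tm.subst_subst, ← hsem]
      congr 1
      funext x; exact hr x
    rw [← e1, ← e2]
    exact this

end

/-! ### Compatibility of the relation on closed terms -/

section
variable {S : PrimSig}

namespace Tm.IsVal

theorem of_pair {v₁ v₂ : Tm S 0 0} (h : (Tm.pair v₁ v₂).IsVal) : v₁.IsVal ∧ v₂.IsVal := by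
  cases h with | pair h₁ h₂ => exact ⟨h₁, h₂⟩

theorem of_inl {τ : Ty 0} {v : Tm S 0 0} (h : (Tm.inl τ v).IsVal) : v.IsVal := by
  cases h with | inl h => exact h

theorem of_inr {τ : Ty 0} {v : Tm S 0 0} (h : (Tm.inr τ v).IsVal) : v.IsVal := by
  cases h with | inr h => exact h

theorem of_pack {σ : Ty 0} {v : Tm S 0 0} {τ : Ty 1} (h : (Tm.pack σ v τ).IsVal) : v.IsVal := by
  cases h with | pack h => exact h

theorem of_roll {τ : Ty 0} {v : Tm S 0 0} (h : (Tm.roll τ v).IsVal) : v.IsVal := by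
  cases h with | roll h => exact h

end Tm.IsVal

theorem HasTy.eq_lit {v : Tm S 0 0} {b : BaseTy} (h : HasTy TyCtx.nil v (.base b))
    (hv : v.IsVal) : ∃ c, v = .lit b c := by
  cases hv with
  | var x => exact x.elim0
  | lit b c => cases h; exact ⟨c, rfl⟩
  | _ => cases h

theorem SC.of_isVal {T₁ T₂ : Ty 0} {R : WRel S 2} (hR : R.Mono) {n : ℕ} {x₁ x₂ : Tm S 0 0}
    (h : ValPair T₁ T₂ x₁ x₂) (hx : R n ![x₁, x₂]) : SC T₁ T₂ R n ![x₁, x₂] := by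
  refine fun _ => ⟨h.1.1, h.2.1, fun w i v hw hi hs hv => ?_⟩
  obtain ⟨rfl, rfl⟩ := StepsN.eq_of_isVal hs h.1.2
  exact ⟨x₂, Ciu.refl h.2.1, hR _ _ _ hi hx⟩

/-- Closure under expansion: by a pure step on the left, by any step on the right. -/
theorem SC.of_head {b : Bool} {T₁ T₂ : Ty 0} {R : WRel S 2} {n : ℕ} {t₁ t₂ t₁' t₂' : Tm S 0 0}
    (h₁ : HasTy TyCtx.nil t₁ T₁) (h₂ : HasTy TyCtx.nil t₂ T₂) (hs₁ : Head false t₁ t₁')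
    (hs₂ : Head b t₂ t₂') (h : SC T₁ T₂ R n ![t₁', t₂']) : SC T₁ T₂ R n ![t₁, t₂] := by
  refine fun h0 => ⟨h₁, h₂, fun w i v hw hi hs hv => ?_⟩
  obtain ⟨x, hx, hR⟩ := (h h0).2.2 w i v hw hi (StepsN.of_head_pure hs hv hs₁) hv
  exact ⟨x, hx.trans (.of_head h₂ hs₂), hR⟩

namespace SE

variable {j : ℕ} {ρ : SInterp S j} {n : ℕ}

theorem of_pos {T₁ T₂ : Ty 0} {R : WRel S 2} {es : Fin 2 → Tm S 0 0}
    (h : 0 < n → SC T₁ T₂ R n es) : SC T₁ T₂ R n es := fun h0 => h h0 h0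

theorem of_val {τ : Ty j} (hρ : ρ.Valid n) (h0 : 0 < n) {x₁ x₂ : Tm S 0 0}
    (h : SV τ ρ n ![x₁, x₂]) : SE τ ρ n ![x₁, x₂] :=
  SC.of_isVal (SV_mono τ hρ.mono) (SV_valPair τ hρ _ _ n le_rfl h0 h) h

/-- To relate `E₁[e₁]` and `E₂[e₂]` for related terms `e₁` and `e₂`, it is enough to relate
`E₁[x₁]` and `E₂[x₂]` for related values `x₁` and `x₂`. -/
theorem bind {τ : Ty j} {T₁ T₂ : Ty 0} {R : WRel S 2} {e₁ e₂ : Tm S 0 0} (E₁ E₂ : ECtx S)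
    (hρ : ρ.Valid n) (h : SE τ ρ n ![e₁, e₂]) (h₁ : HasTy TyCtx.nil (E₁.fill e₁) T₁)
    (hE₂ : CtxTy TyCtx.nil (τ.subst ρ.right) E₂.toCtx TyCtx.nil T₂)
    (hk : ∀ w ≤ n, 0 < w → ∀ x₁ x₂, SV τ ρ w ![x₁, x₂] →
      ValPair (τ.subst ρ.left) (τ.subst ρ.right) x₁ x₂ →
      SC T₁ T₂ R w ![E₁.fill x₁, E₂.fill x₂]) :
    SC T₁ T₂ R n ![E₁.fill e₁, E₂.fill e₂] := by
  intro h0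
  obtain ⟨t₁, t₂, H⟩ := h h0
  refine ⟨h₁, hE₂.efill t₂, fun w i v hw hi hs hv => ?_⟩
  obtain ⟨i, l, x₁, hs₁, hx₁, hs₂, rfl⟩ := StepsN.of_fill (E := E₁) hs hv
  obtain ⟨x₂, hc, hV⟩ := H (n - i) i x₁ (by omega) (by omega) hs₁ hx₁
  have := hk (n - i) (by omega) (by omega) x₁ x₂ hV
    (SV_valPair τ hρ _ _ _ (by omega) (by omega) hV)
  obtain ⟨y, hc', hy⟩ := (this (by omega)).2.2 w l v hw (by omega) hs₂ hv
  exact ⟨y, hc'.trans (hc.fill t₂ hE₂), hy⟩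

theorem lit (hρ : ρ.Valid n) (b : BaseTy) (c : b.Carrier) :
    SE (.base b) ρ n ![.lit b c, .lit b c] :=
  of_pos fun h0 => of_val hρ h0 fun _ =>
    ⟨⟨⟨.lit b c, .lit b c⟩, ⟨.lit b c, .lit b c⟩⟩, rfl⟩

/-- The arguments are evaluated from left to right: the first `p` of them are constants. -/
theorem op_aux (o : S.Op) (q : ℕ) : ∀ (p : ℕ), p + q = S.arity o → ∀ (n : ℕ),
    ρ.Valid n → ∀ (a₁ a₂ : Fin (S.arity o) → Tm S 0 0),
    (∀ i : Fin (S.arity o), i.val < p → ∃ c, a₁ i = .lit (S.dom o i) c ∧ a₂ i = .lit _ c) →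
    (∀ i, SE (.base (S.dom o i)) ρ n ![a₁ i, a₂ i]) →
    SE (.base (S.cod o)) ρ n ![.op o a₁, .op o a₂] := by
  induction q with
  | zero =>
    intro p hp n hρ a₁ a₂ hc _
    choose c hc₁ hc₂ using fun i => hc i (by omega)
    obtain rfl : a₁ = fun i => .lit _ (c i) := funext hc₁
    obtain rfl : a₂ = fun i => .lit _ (c i) := funext hc₂
    have ht : HasTy TyCtx.nil (Tm.op o fun i => .lit (S.dom o i) (c i)) (.base (S.cod o)) :=
      .op o fun i => .lit _ _
    exact SC.of_head ht ht (.op o c) (.op o c) (lit hρ _ _)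
  | succ q ih =>
    intro p hp n hρ a₁ a₂ hc h
    refine of_pos fun h0 => ?_
    let i : Fin (S.arity o) := ⟨p, by omega⟩
    have hv : ∀ i' : Fin (S.arity o), i' < i → (a₁ i').IsVal ∧ (a₂ i').IsVal := fun i' hi => by
      obtain ⟨c, h₁, h₂⟩ := hc i' hi
      exact ⟨.of_lit_eq h₁, .of_lit_eq h₂⟩
    have ht : HasTy TyCtx.nil (Tm.op o a₁) (.base (S.cod o)) := .op o fun i => (h i h0).1
    have := bind (T₁ := .base (S.cod o)) (T₂ := .base (S.cod o)) (R := SV (.base (S.cod o)) ρ)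
      (.op o i a₁ (fun i' hi => (hv i' hi).1) .hole) (.op o i a₂ (fun i' hi => (hv i' hi).2) .hole)
      hρ (h i) (by simpa only [ECtx.fill, Function.update_eq_self] using ht)
      (.op o i (fun i' _ => (h i' h0).2.1) (ECtx.typed_hole _)) fun w hw hw0 x₁ x₂ hx hT => ?_
    · simp only [ECtx.fill, Function.update_eq_self] at this
      exact this
    · obtain ⟨c, rfl⟩ := hT.1.1.eq_lit hT.1.2
      obtain rfl : Tm.lit _ c = x₂ := (hx hw0).2
      refine ih (p + 1) (by omega) w (hρ.le hw) _ _ (fun i' hi' => ?_) (fun i' => ?_)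
      · by_cases h' : i' = i
        · subst h'
          exact ⟨c, Function.update_self .., Function.update_self ..⟩
        · rw [ECtx.fill, Function.update_of_ne h', Function.update_of_ne h']
          refine hc i' (lt_of_le_of_ne (Nat.le_of_lt_succ hi') fun he => h' (Fin.ext he))
      · by_cases h' : i' = i
        · subst h'
          rw [ECtx.fill, Function.update_self, Function.update_self]
          exact lit (hρ.le hw) _ _
        · rw [ECtx.fill, Function.update_of_ne h', Function.update_of_ne h']
          exact SC_mono _ _ _ hw (h i')

theorem op (hρ : ρ.Valid n) (o : S.Op) {a₁ a₂ : Fin (S.arity o) → Tm S 0 0}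
    (h : ∀ i, SE (.base (S.dom o i)) ρ n ![a₁ i, a₂ i]) :
    SE (.base (S.cod o)) ρ n ![.op o a₁, .op o a₂] :=
  op_aux o _ 0 (Nat.zero_add _) n hρ a₁ a₂ (fun _ hi => absurd hi (Nat.not_lt_zero _)) h

variable {a₁ a₂ b₁ b₂ c₁ c₂ : Tm S 0 0}

theorem ite (hρ : ρ.Valid n) {τ : Ty j} (ha : SE (.base .bool) ρ n ![a₁, a₂])
    (hb : SE τ ρ n ![b₁, b₂]) (hc : SE τ ρ n ![c₁, c₂]) :
    SE τ ρ n ![.ite a₁ b₁ c₁, .ite a₂ b₂ c₂] := by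
  refine of_pos fun h0 => bind (.ite .hole b₁ c₁) (.ite .hole b₂ c₂) hρ ha
    (.ite (ha h0).1 (hb h0).1 (hc h0).1)
    (.ite₀ (ECtx.typed_hole _) (hb h0).2.1 (hc h0).2.1) fun w hw hw0 x₁ x₂ hx hT => ?_
  obtain ⟨c, rfl⟩ := hT.1.1.eq_lit hT.1.2
  obtain rfl : Tm.lit _ c = x₂ := (hx hw0).2
  have h₁ := HasTy.ite hT.1.1 (hb h0).1 (hc h0).1
  have h₂ := HasTy.ite hT.1.1 (hb h0).2.1 (hc h0).2.1
  cases c with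
  | true => exact SC.of_head h₁ h₂ (.iteTrue _ _) (.iteTrue _ _) (SC_mono _ _ _ hw hb)
  | false => exact SC.of_head h₁ h₂ (.iteFalse _ _) (.iteFalse _ _) (SC_mono _ _ _ hw hc)

theorem pair (hρ : ρ.Valid n) {τ τ' : Ty j} (ha : SE τ ρ n ![a₁, a₂])
    (hb : SE τ' ρ n ![b₁, b₂]) : SE (.prod τ τ') ρ n ![.pair a₁ b₁, .pair a₂ b₂] := by
  refine of_pos fun h0 => bind (.pair₁ .hole b₁) (.pair₁ .hole b₂) hρ ha
    (.pair (ha h0).1 (hb h0).1) (.pair₁ (ECtx.typed_hole _) (hb h0).2.1)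
    fun w hw hw0 x₁ x₂ hx hT => ?_
  refine bind (.pair₂ x₁ hT.1.2 .hole) (.pair₂ x₂ hT.2.2 .hole) (hρ.le hw) (SC_mono _ _ _ hw hb)
    (.pair hT.1.1 (hb h0).1) (.pair₂ hT.2.1 (ECtx.typed_hole _)) fun v hv hv0 y₁ y₂ hy hT' => ?_
  exact of_val (hρ.le (hv.trans hw)) hv0 fun _ =>
    ⟨⟨⟨.pair hT.1.1 hT'.1.1, .pair hT.1.2 hT'.1.2⟩, ⟨.pair hT.2.1 hT'.2.1, .pair hT.2.2 hT'.2.2⟩⟩,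
      x₁, y₁, x₂, y₂, rfl, rfl, SV_mono τ hρ.mono _ _ _ hv hx, hy⟩

theorem fst (hρ : ρ.Valid n) {τ τ' : Ty j} (ha : SE (.prod τ τ') ρ n ![a₁, a₂]) :
    SE τ ρ n ![.fst a₁, .fst a₂] := by
  refine of_pos fun h0 => bind (.fst .hole) (.fst .hole) hρ ha (.fst (ha h0).1)
    (.fst (ECtx.typed_hole _)) fun w hw hw0 x₁ x₂ hx hT => ?_
  obtain ⟨_, x₁, y₁, x₂, y₂, rfl, rfl, hx, -⟩ := hx hw0
  obtain ⟨⟨t₁, hv₁⟩, t₂, hv₂⟩ := hT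
  exact SC.of_head (.fst t₁) (.fst t₂) (.fst hv₁.of_pair.1 hv₁.of_pair.2)
    (.fst hv₂.of_pair.1 hv₂.of_pair.2) (of_val (hρ.le hw) hw0 hx)

theorem snd (hρ : ρ.Valid n) {τ τ' : Ty j} (ha : SE (.prod τ τ') ρ n ![a₁, a₂]) :
    SE τ' ρ n ![.snd a₁, .snd a₂] := by
  refine of_pos fun h0 => bind (.snd .hole) (.snd .hole) hρ ha (.snd (ha h0).1)
    (.snd (ECtx.typed_hole _)) fun w hw hw0 x₁ x₂ hx hT => ?_
  obtain ⟨_, x₁, y₁, x₂, y₂, rfl, rfl, -, hy⟩ := hx hw0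
  obtain ⟨⟨t₁, hv₁⟩, t₂, hv₂⟩ := hT
  exact SC.of_head (.snd t₁) (.snd t₂) (.snd hv₁.of_pair.1 hv₁.of_pair.2)
    (.snd hv₂.of_pair.1 hv₂.of_pair.2) (of_val (hρ.le hw) hw0 hy)

theorem inl (hρ : ρ.Valid n) {τ τ' : Ty j} (ha : SE τ ρ n ![a₁, a₂]) :
    SE (.sum τ τ') ρ n ![.inl ((Ty.sum τ τ').subst ρ.left) a₁,
      .inl ((Ty.sum τ τ').subst ρ.right) a₂] := by
  refine of_pos fun h0 => bind (.inl _ .hole) (.inl _ .hole) hρ ha (.inl (ha h0).1)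
    (.inl (ECtx.typed_hole _)) fun w hw hw0 x₁ x₂ hx hT => ?_
  exact of_val (hρ.le hw) hw0 fun _ =>
    ⟨⟨⟨.inl hT.1.1, .inl hT.1.2⟩, ⟨.inl hT.2.1, .inl hT.2.2⟩⟩, .inl ⟨x₁, x₂, rfl, rfl, hx⟩⟩

theorem inr (hρ : ρ.Valid n) {τ τ' : Ty j} (ha : SE τ' ρ n ![a₁, a₂]) :
    SE (.sum τ τ') ρ n ![.inr ((Ty.sum τ τ').subst ρ.left) a₁,
      .inr ((Ty.sum τ τ').subst ρ.right) a₂] := by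
  refine of_pos fun h0 => bind (.inr _ .hole) (.inr _ .hole) hρ ha (.inr (ha h0).1)
    (.inr (ECtx.typed_hole _)) fun w hw hw0 x₁ x₂ hx hT => ?_
  exact of_val (hρ.le hw) hw0 fun _ =>
    ⟨⟨⟨.inr hT.1.1, .inr hT.1.2⟩, ⟨.inr hT.2.1, .inr hT.2.2⟩⟩, .inr ⟨x₁, x₂, rfl, rfl, hx⟩⟩

/-- Typing of the two sides of a pair of terms with one free term variable of type `τ`. -/
def Body (ρ : SInterp S j) (τ τ' : Ty j) (d₁ d₂ : Tm S 0 1) : Prop :=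
  HasTy (TyCtx.nil.addTm (τ.subst ρ.left)) d₁ (τ'.subst ρ.left) ∧
    HasTy (TyCtx.nil.addTm (τ.subst ρ.right)) d₂ (τ'.subst ρ.right)

theorem case (hρ : ρ.Valid n) {τ τ' τ'' : Ty j} {d₁ d₂ d₁' d₂' : Tm S 0 1}
    (ha : SE (.sum τ τ') ρ n ![a₁, a₂]) (hd : Body ρ τ τ'' d₁ d₂) (hd' : Body ρ τ' τ'' d₁' d₂')
    (h : ∀ w ≤ n, 0 < w → ∀ x₁ x₂, SV τ ρ w ![x₁, x₂] →
      SE τ'' ρ w ![d₁.instTm x₁, d₂.instTm x₂])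
    (h' : ∀ w ≤ n, 0 < w → ∀ x₁ x₂, SV τ' ρ w ![x₁, x₂] →
      SE τ'' ρ w ![d₁'.instTm x₁, d₂'.instTm x₂]) :
    SE τ'' ρ n ![.case a₁ d₁ d₁', .case a₂ d₂ d₂'] := by
  refine of_pos fun h0 => bind (.case .hole d₁ d₁') (.case .hole d₂ d₂') hρ ha
    (.case (ha h0).1 hd.1 hd'.1) (.case₀ (ECtx.typed_hole _) hd.2 hd'.2)
    fun w hw hw0 x₁ x₂ hx hT => ?_
  have t₁ := HasTy.case hT.1.1 hd.1 hd'.1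
  have t₂ := HasTy.case hT.2.1 hd.2 hd'.2
  obtain ⟨_, ⟨x₁, x₂, rfl, rfl, hx'⟩ | ⟨x₁, x₂, rfl, rfl, hx'⟩⟩ := hx hw0
  · exact SC.of_head t₁ t₂ (.caseInl hT.1.2.of_inl) (.caseInl hT.2.2.of_inl) (h w hw hw0 _ _ hx')
  · exact SC.of_head t₁ t₂ (.caseInr hT.1.2.of_inr) (.caseInr hT.2.2.of_inr) (h' w hw hw0 _ _ hx')

theorem lam (hρ : ρ.Valid n) {τ τ' : Ty j} {d₁ d₂ : Tm S 0 1} (hd : Body ρ τ τ' d₁ d₂)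
    (h : ∀ w ≤ n, 0 < w → ∀ x₁ x₂, SV τ ρ w ![x₁, x₂] →
      SE τ' ρ w ![d₁.instTm x₁, d₂.instTm x₂]) :
    SE (.arr τ τ') ρ n ![.lam (τ.subst ρ.left) d₁, .lam (τ.subst ρ.right) d₂] := by
  refine of_pos fun h0 => of_val hρ h0 fun _ =>
    ⟨⟨⟨.lam hd.1, .lam _ _⟩, ⟨.lam hd.2, .lam _ _⟩⟩, fun y₁ y₂ w hw hy => of_pos fun hw0 => ?_⟩
  have hT := SV_valPair τ hρ y₁ y₂ w hw hw0 hy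
  exact SC.of_head (.app (.lam hd.1) hT.1.1) (.app (.lam hd.2) hT.2.1) (.beta hT.1.2)
    (.beta hT.2.2) (h w hw hw0 _ _ hy)

theorem app (hρ : ρ.Valid n) {τ τ' : Ty j} (ha : SE (.arr τ τ') ρ n ![a₁, a₂])
    (hb : SE τ ρ n ![b₁, b₂]) : SE τ' ρ n ![.app a₁ b₁, .app a₂ b₂] := by
  refine of_pos fun h0 => bind (.app₁ .hole b₁) (.app₁ .hole b₂) hρ ha
    (.app (ha h0).1 (hb h0).1) (.app₁ (ECtx.typed_hole _) (hb h0).2.1)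
    fun w hw hw0 x₁ x₂ hx hT => ?_
  refine bind (.app₂ x₁ hT.1.2 .hole) (.app₂ x₂ hT.2.2 .hole) (hρ.le hw) (SC_mono _ _ _ hw hb)
    (.app hT.1.1 (hb h0).1) (.app₂ hT.2.1 (ECtx.typed_hole _)) fun v hv hv0 y₁ y₂ hy hT' => ?_
  exact (hx hw0).2 y₁ y₂ v hv hy

/-- Relations that interpret a new type variable, up to world `n`, by values of types `α₁`, `α₂`. -/
def IsVRel (n : ℕ) (α₁ α₂ : Ty 0) (R : WRel S 2) : Prop :=
  R.Mono ∧ ∀ x₁ x₂, ∀ v ≤ n, 0 < v → R v ![x₁, x₂] → ValPair α₁ α₂ x₁ x₂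

theorem tlam (hρ : ρ.Valid n) {τ : Ty (j + 1)} {d₁ d₂ : Tm S 1 0}
    (hd₁ : HasTy TyCtx.nil.addTy d₁ (τ.subst (Ty.up ρ.left)))
    (hd₂ : HasTy TyCtx.nil.addTy d₂ (τ.subst (Ty.up ρ.right)))
    (h : ∀ w ≤ n, 0 < w → ∀ α₁ α₂ R, IsVRel w α₁ α₂ R →
      SE τ (push (α₁, α₂, R.normal) ρ) w ![d₁.instTy α₁, d₂.instTy α₂]) :
    SE (.all τ) ρ n ![.tlam d₁, .tlam d₂] := by
  refine of_pos fun h0 => of_val hρ h0 fun _ =>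
    ⟨⟨⟨.tlam hd₁, .tlam _⟩, ⟨.tlam hd₂, .tlam _⟩⟩, fun α₁ α₂ R hR w hw hv => of_pos fun hw0 => ?_⟩
  have t₁ := HasTy.tapp α₁ (.tlam hd₁)
  have t₂ := HasTy.tapp α₂ (.tlam hd₂)
  rw [Ty.inst_up] at t₁ t₂
  refine SC.of_head t₁ t₂ (.tbeta _ _) (.tbeta _ _) ?_
  have := h w hw hw0 α₁ α₂ R ⟨hR, hv⟩
  rwa [SE, SInterp.left_push, SInterp.right_push] at this

theorem tapp (hρ : ρ.Valid n) {τ : Ty (j + 1)} (τ' : Ty j) (ha : SE (.all τ) ρ n ![a₁, a₂]) :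
    SE (τ.inst τ') ρ n ![.tapp a₁ (τ'.subst ρ.left), .tapp a₂ (τ'.subst ρ.right)] := by
  have hl := Ty.subst_inst ρ.left τ τ'
  have hr := Ty.subst_inst ρ.right τ τ'
  refine of_pos fun h0 => bind (.tapp .hole _) (.tapp .hole _) hρ ha
    (hl ▸ .tapp _ (ha h0).1) (hr ▸ .tapp _ (ECtx.typed_hole _)) fun w hw hw0 x₁ x₂ hx hT => ?_
  have := (hx hw0).2 (τ'.subst ρ.left) (τ'.subst ρ.right) (SV τ' ρ) (SV_mono τ' hρ.mono) w le_rfl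
    (fun x₁ x₂ v hv hv0 H => SV_valPair τ' hρ x₁ x₂ v (hv.trans hw) hv0 H)
  rw [WRel.normal_eq (SV_zero τ' ρ hρ.zero)] at this
  rw [SV_inst, Ty.inst_subst, Ty.inst_subst]
  exact this

theorem pack (hρ : ρ.Valid n) {τ : Ty (j + 1)} {τ' : Ty j} (ha : SE (τ.inst τ') ρ n ![a₁, a₂]) :
    SE (.ex τ) ρ n ![.pack (τ'.subst ρ.left) a₁ (τ.subst (Ty.up ρ.left)),
      .pack (τ'.subst ρ.right) a₂ (τ.subst (Ty.up ρ.right))] := by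
  have hl := Ty.subst_inst ρ.left τ τ'
  have hr := Ty.subst_inst ρ.right τ τ'
  refine of_pos fun h0 => bind (.pack _ .hole _) (.pack _ .hole _) hρ ha
    (.pack (hl ▸ (ha h0).1)) (.pack (hr ▸ ECtx.typed_hole _)) fun w hw hw0 x₁ x₂ hx hT => ?_
  rw [hl, hr] at hT
  refine of_val (hρ.le hw) hw0 fun _ =>
    ⟨⟨⟨.pack hT.1.1, .pack hT.1.2⟩, ⟨.pack hT.2.1, .pack hT.2.2⟩⟩,
      τ'.subst ρ.left, τ'.subst ρ.right, x₁, x₂, SV τ' ρ, SV_mono τ' hρ.mono,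
      fun x₁ x₂ v hv hv0 H => SV_valPair τ' hρ x₁ x₂ v (hv.trans hw) hv0 H, rfl, rfl, ?_⟩
  rw [WRel.normal_eq (SV_zero τ' ρ hρ.zero), ← SV_inst]
  exact hx

theorem unpack (hρ : ρ.Valid n) {τ : Ty (j + 1)} {τ' : Ty j} {d₁ d₂ : Tm S 1 1}
    (ha : SE (.ex τ) ρ n ![a₁, a₂])
    (hd₁ : HasTy (TyCtx.nil.addTy.addTm (τ.subst (Ty.up ρ.left))) d₁
      ((τ'.subst ρ.left).rename Fin.succ))
    (hd₂ : HasTy (TyCtx.nil.addTy.addTm (τ.subst (Ty.up ρ.right))) d₂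
      ((τ'.subst ρ.right).rename Fin.succ))
    (h : ∀ w ≤ n, 0 < w → ∀ α₁ α₂ R, IsVRel w α₁ α₂ R → ∀ x₁ x₂,
      SV τ (push (α₁, α₂, R.normal) ρ) w ![x₁, x₂] →
      SE τ' ρ w ![d₁.instBoth α₁ x₁, d₂.instBoth α₂ x₂]) :
    SE τ' ρ n ![.unpack a₁ d₁, .unpack a₂ d₂] := by
  refine of_pos fun h0 => bind (.unpack .hole d₁) (.unpack .hole d₂) hρ ha
    (.unpack (ha h0).1 hd₁) (.unpack₁ (ECtx.typed_hole _) hd₂) fun w hw hw0 x₁ x₂ hx hT => ?_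
  have t₁ := HasTy.unpack hT.1.1 hd₁
  have t₂ := HasTy.unpack hT.2.1 hd₂
  obtain ⟨_, α₁, α₂, y₁, y₂, R, hR, hv, rfl, rfl, hy⟩ := hx hw0
  exact SC.of_head t₁ t₂ (.unpack hT.1.2.of_pack) (.unpack hT.2.2.of_pack)
    (h w hw hw0 α₁ α₂ R ⟨hR, hv⟩ _ _ hy)

theorem roll (hρ : ρ.Valid n) {τ : Ty (j + 1)} (ha : SE (τ.inst (.mu τ)) ρ n ![a₁, a₂]) :
    SE (.mu τ) ρ n ![.roll ((Ty.mu τ).subst ρ.left) a₁, .roll ((Ty.mu τ).subst ρ.right) a₂] := by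
  have hl := Ty.subst_inst ρ.left τ (.mu τ)
  have hr := Ty.subst_inst ρ.right τ (.mu τ)
  refine of_pos fun h0 => bind (.roll _ .hole) (.roll _ .hole) hρ ha
    (.roll (hl ▸ (ha h0).1)) (.roll (hr ▸ ECtx.typed_hole _)) fun w hw hw0 x₁ x₂ hx hT => ?_
  rw [hl, hr] at hT
  refine of_val (hρ.le hw) hw0 ((SV_mu τ ρ w _).2 fun _ =>
    ⟨⟨⟨.roll hT.1.1, .roll hT.1.2⟩, ⟨.roll hT.2.1, .roll hT.2.2⟩⟩, x₁, x₂, rfl, rfl, ?_⟩)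
  rw [WRel.normal_eq (SV_zero _ ρ hρ.zero), ← SV_inst]
  exact SV_mono _ hρ.mono _ _ _ (Nat.sub_le w 1) hx

/-- The unroll reduction consumes the world that the clause of recursive types gives away. -/
theorem unroll (hρ : ρ.Valid n) {τ : Ty (j + 1)} (ha : SE (.mu τ) ρ n ![a₁, a₂]) :
    SE (τ.inst (.mu τ)) ρ n ![.unroll a₁, .unroll a₂] := by
  have hl := Ty.subst_inst ρ.left τ (.mu τ)
  have hr := Ty.subst_inst ρ.right τ (.mu τ)
  refine of_pos fun h0 => bind (.unroll .hole) (.unroll .hole) hρ ha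
    (hl ▸ .unroll (ha h0).1) (hr ▸ .unroll (ECtx.typed_hole _)) fun w hw hw0 x₁ x₂ hx hT => ?_
  rw [hl, hr]
  rw [SV_mu] at hx
  have t₁ := HasTy.unroll hT.1.1
  have t₂ := HasTy.unroll hT.2.1
  obtain ⟨_, y₁, y₂, rfl, rfl, hy⟩ := hx hw0
  rw [WRel.normal_eq (SV_zero _ ρ hρ.zero), ← SV_inst] at hy
  have hv₁ := hT.1.2.of_roll
  have hv₂ := hT.2.2.of_roll
  refine fun _ => ⟨t₁, t₂, fun v i x hv hi hs hx => ?_⟩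
  obtain ⟨i, rfl, hs'⟩ := StepsN.of_head_unroll hs hx (.unroll hv₁)
  obtain ⟨rfl, rfl⟩ := hs'.eq_of_isVal hv₁
  exact ⟨y₂, .of_head t₂ (.unroll hv₂), SV_mono _ hρ.mono _ _ _ (by omega) hy⟩

end SE

end

/-! ### Logical approximation is a congruence -/

section
variable {S : PrimSig} {k m : ℕ} {Γ : TyCtx k m}

namespace SEnv

variable {ρ : SInterp S k} {n : ℕ} {γ₁ γ₂ : Fin m → Tm S 0 0}

theorem hasTy_left (h : SEnv Γ ρ n γ₁ γ₂) (hρ : ρ.Valid n) (h0 : 0 < n) (x : Fin m) :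
    HasTy TyCtx.nil (γ₁ x) ((Γ x).subst ρ.left) :=
  (SV_valPair _ hρ _ _ n le_rfl h0 (h x)).1.1

theorem hasTy_right (h : SEnv Γ ρ n γ₁ γ₂) (hρ : ρ.Valid n) (h0 : 0 < n) (x : Fin m) :
    HasTy TyCtx.nil (γ₂ x) ((Γ x).subst ρ.right) :=
  (SV_valPair _ hρ _ _ n le_rfl h0 (h x)).2.1

theorem le (h : SEnv Γ ρ n γ₁ γ₂) (hρ : ρ.Valid n) {w : ℕ} (hw : w ≤ n) : SEnv Γ ρ w γ₁ γ₂ :=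
  fun x => SV_mono _ hρ.mono _ _ _ hw (h x)

theorem addTm (h : SEnv Γ ρ n γ₁ γ₂) {τ : Ty k} {x₁ x₂ : Tm S 0 0} (hx : SV τ ρ n ![x₁, x₂]) :
    SEnv (Γ.addTm τ) ρ n (push x₁ γ₁) (push x₂ γ₂) := fun x => Fin.cases hx h x

theorem addTy (h : SEnv Γ ρ n γ₁ γ₂) (p : Ty 0 × Ty 0 × WRel S 2) :
    SEnv Γ.addTy (push p ρ) n γ₁ γ₂ := fun x => by
  rw [TyCtx.addTy, SV_rename]; exact h x

end SEnv

namespace SLog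

/-- It suffices to relate closed instances in the positive worlds. -/
theorem intro {e₁ e₂ : Tm S k m} {τ : Ty k} (h₁ : HasTy Γ e₁ τ) (h₂ : HasTy Γ e₂ τ)
    (h : ∀ (n : ℕ) (ρ : SInterp S k) (γ₁ γ₂ : Fin m → Tm S 0 0), 0 < n →
      ρ.Valid n → SEnv Γ ρ n γ₁ γ₂ → SE τ ρ n ![e₁.subst ρ.left γ₁, e₂.subst ρ.right γ₂]) :
    SLog Γ e₁ e₂ τ :=
  ⟨h₁, h₂, fun n ρ γ₁ γ₂ hρ hγ => SE.of_pos fun h0 => h n ρ γ₁ γ₂ h0 hρ hγ⟩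

/-- Weakening. -/
theorem rename {e₁ e₂ : Tm S k m} {τ : Ty k} (h : SLog Γ e₁ e₂ τ) {k' m' : ℕ}
    {Γ' : TyCtx k' m'} {ζ : Fin k → Fin k'} {ξ : Fin m → Fin m'}
    (hΓ : ∀ x, Γ' (ξ x) = (Γ x).rename ζ) :
    SLog Γ' (e₁.rename ζ ξ) (e₂.rename ζ ξ) (τ.rename ζ) := by
  refine ⟨h.1.rename hΓ, h.2.1.rename hΓ, fun n ρ γ₁ γ₂ hρ hγ => ?_⟩
  have := h.2.2 n (fun i => ρ (ζ i)) (fun x => γ₁ (ξ x)) (fun x => γ₂ (ξ x))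
    ⟨fun i => hρ.mono _, fun i => hρ.zero _, fun i => hρ.val _⟩
    (fun x => by have := hγ (ξ x); rwa [hΓ, SV_rename] at this)
  rw [SE, Ty.subst_rename, Ty.subst_rename, SV_rename, Tm.subst_rename, Tm.subst_rename]
  exact this

theorem var (x : Fin m) : SLog Γ (.var x : Tm S k m) (.var x) (Γ x) :=
  intro (.var x) (.var x) fun _ _ _ _ h0 hρ hγ => SE.of_val hρ h0 (hγ x)

theorem lit (b : BaseTy) (c : b.Carrier) : SLog Γ (.lit b c : Tm S k m) (.lit b c) (.base b) :=
  intro (.lit b c) (.lit b c) fun _ _ _ _ _ hρ _ => SE.lit hρ b c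

theorem op (o : S.Op) {a₁ a₂ : Fin (S.arity o) → Tm S k m}
    (h : ∀ i, SLog Γ (a₁ i) (a₂ i) (.base (S.dom o i))) :
    SLog Γ (.op o a₁) (.op o a₂) (.base (S.cod o)) :=
  intro (.op o fun i => (h i).1) (.op o fun i => (h i).2.1) fun n ρ γ₁ γ₂ _ hρ hγ =>
    SE.op hρ o fun i => (h i).2.2 n ρ γ₁ γ₂ hρ hγ

variable {a₁ a₂ b₁ b₂ c₁ c₂ : Tm S k m}

theorem ite {τ : Ty k} (ha : SLog Γ a₁ a₂ (.base .bool)) (hb : SLog Γ b₁ b₂ τ)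
    (hc : SLog Γ c₁ c₂ τ) : SLog Γ (.ite a₁ b₁ c₁) (.ite a₂ b₂ c₂) τ :=
  intro (.ite ha.1 hb.1 hc.1) (.ite ha.2.1 hb.2.1 hc.2.1) fun n ρ γ₁ γ₂ _ hρ hγ =>
    SE.ite hρ (ha.2.2 n ρ γ₁ γ₂ hρ hγ) (hb.2.2 n ρ γ₁ γ₂ hρ hγ) (hc.2.2 n ρ γ₁ γ₂ hρ hγ)

theorem pair {τ τ' : Ty k} (ha : SLog Γ a₁ a₂ τ) (hb : SLog Γ b₁ b₂ τ') :
    SLog Γ (.pair a₁ b₁) (.pair a₂ b₂) (.prod τ τ') :=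
  intro (.pair ha.1 hb.1) (.pair ha.2.1 hb.2.1) fun n ρ γ₁ γ₂ _ hρ hγ =>
    SE.pair hρ (ha.2.2 n ρ γ₁ γ₂ hρ hγ) (hb.2.2 n ρ γ₁ γ₂ hρ hγ)

theorem fst {τ τ' : Ty k} (ha : SLog Γ a₁ a₂ (.prod τ τ')) : SLog Γ (.fst a₁) (.fst a₂) τ :=
  intro (.fst ha.1) (.fst ha.2.1) fun n ρ γ₁ γ₂ _ hρ hγ => SE.fst hρ (ha.2.2 n ρ γ₁ γ₂ hρ hγ)

theorem snd {τ τ' : Ty k} (ha : SLog Γ a₁ a₂ (.prod τ τ')) : SLog Γ (.snd a₁) (.snd a₂) τ' :=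
  intro (.snd ha.1) (.snd ha.2.1) fun n ρ γ₁ γ₂ _ hρ hγ => SE.snd hρ (ha.2.2 n ρ γ₁ γ₂ hρ hγ)

theorem inl {τ τ' : Ty k} (ha : SLog Γ a₁ a₂ τ) :
    SLog Γ (.inl (.sum τ τ') a₁) (.inl (.sum τ τ') a₂) (.sum τ τ') :=
  intro (.inl ha.1) (.inl ha.2.1) fun n ρ γ₁ γ₂ _ hρ hγ => SE.inl hρ (ha.2.2 n ρ γ₁ γ₂ hρ hγ)

theorem inr {τ τ' : Ty k} (ha : SLog Γ a₁ a₂ τ') :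
    SLog Γ (.inr (.sum τ τ') a₁) (.inr (.sum τ τ') a₂) (.sum τ τ') :=
  intro (.inr ha.1) (.inr ha.2.1) fun n ρ γ₁ γ₂ _ hρ hγ => SE.inr hρ (ha.2.2 n ρ γ₁ γ₂ hρ hγ)

theorem body {τ τ' : Ty k} {d₁ d₂ : Tm S k (m + 1)} (hd : SLog (Γ.addTm τ) d₁ d₂ τ') {n : ℕ}
    {ρ : SInterp S k} {γ₁ γ₂ : Fin m → Tm S 0 0} (h0 : 0 < n) (hρ : ρ.Valid n)
    (hγ : SEnv Γ ρ n γ₁ γ₂) :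
    SE.Body ρ τ τ' (d₁.subst ρ.left (Tm.up γ₁)) (d₂.subst ρ.right (Tm.up γ₂)) :=
  ⟨hd.1.subst (TyCtx.addTm_subst (hγ.hasTy_left hρ h0) τ),
    hd.2.1.subst (TyCtx.addTm_subst (hγ.hasTy_right hρ h0) τ)⟩

theorem instTm {τ τ' : Ty k} {d₁ d₂ : Tm S k (m + 1)} (hd : SLog (Γ.addTm τ) d₁ d₂ τ') {n : ℕ}
    {ρ : SInterp S k} {γ₁ γ₂ : Fin m → Tm S 0 0} (hρ : ρ.Valid n) (hγ : SEnv Γ ρ n γ₁ γ₂)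
    (w : ℕ) (hw : w ≤ n) (_ : 0 < w) (x₁ x₂ : Tm S 0 0) (hx : SV τ ρ w ![x₁, x₂]) :
    SE τ' ρ w
      ![(d₁.subst ρ.left (Tm.up γ₁)).instTm x₁, (d₂.subst ρ.right (Tm.up γ₂)).instTm x₂] := by
  rw [Tm.instTm_subst_up, Tm.instTm_subst_up]
  exact hd.2.2 w ρ _ _ (hρ.le hw) ((hγ.le hρ hw).addTm hx)

theorem case {τ τ' τ'' : Ty k} {d₁ d₂ d₁' d₂' : Tm S k (m + 1)} (ha : SLog Γ a₁ a₂ (.sum τ τ'))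
    (hd : SLog (Γ.addTm τ) d₁ d₂ τ'') (hd' : SLog (Γ.addTm τ') d₁' d₂' τ'') :
    SLog Γ (.case a₁ d₁ d₁') (.case a₂ d₂ d₂') τ'' :=
  intro (.case ha.1 hd.1 hd'.1) (.case ha.2.1 hd.2.1 hd'.2.1) fun n ρ γ₁ γ₂ h0 hρ hγ =>
    SE.case hρ (ha.2.2 n ρ γ₁ γ₂ hρ hγ) (hd.body h0 hρ hγ) (hd'.body h0 hρ hγ)
      (hd.instTm hρ hγ) (hd'.instTm hρ hγ)

theorem lam {τ τ' : Ty k} {d₁ d₂ : Tm S k (m + 1)} (hd : SLog (Γ.addTm τ) d₁ d₂ τ') :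
    SLog Γ (.lam τ d₁) (.lam τ d₂) (.arr τ τ') :=
  intro (.lam hd.1) (.lam hd.2.1) fun _ _ _ _ h0 hρ hγ =>
    SE.lam hρ (hd.body h0 hρ hγ) (hd.instTm hρ hγ)

theorem app {τ τ' : Ty k} (ha : SLog Γ a₁ a₂ (.arr τ τ')) (hb : SLog Γ b₁ b₂ τ) :
    SLog Γ (.app a₁ b₁) (.app a₂ b₂) τ' :=
  intro (.app ha.1 hb.1) (.app ha.2.1 hb.2.1) fun n ρ γ₁ γ₂ _ hρ hγ =>
    SE.app hρ (ha.2.2 n ρ γ₁ γ₂ hρ hγ) (hb.2.2 n ρ γ₁ γ₂ hρ hγ)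

theorem tlam {τ : Ty (k + 1)} {d₁ d₂ : Tm S (k + 1) m} (hd : SLog Γ.addTy d₁ d₂ τ) :
    SLog Γ (.tlam d₁) (.tlam d₂) (.all τ) := by
  refine intro (.tlam hd.1) (.tlam hd.2.1) fun n ρ γ₁ γ₂ h0 hρ hγ =>
    SE.tlam hρ (hd.1.subst (TyCtx.addTy_subst (hγ.hasTy_left hρ h0)))
      (hd.2.1.subst (TyCtx.addTy_subst (hγ.hasTy_right hρ h0))) fun w hw _ α₁ α₂ R hR => ?_
  rw [Tm.instTy_subst_up, Tm.instTy_subst_up]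
  have := hd.2.2 w _ γ₁ γ₂ ((hρ.le hw).push hR.1 hR.2) ((hγ.le hρ hw).addTy _)
  rwa [SInterp.left_push, SInterp.right_push] at this

theorem tapp {τ : Ty (k + 1)} (τ' : Ty k) (ha : SLog Γ a₁ a₂ (.all τ)) :
    SLog Γ (.tapp a₁ τ') (.tapp a₂ τ') (τ.inst τ') :=
  intro (.tapp _ ha.1) (.tapp _ ha.2.1) fun n ρ γ₁ γ₂ _ hρ hγ =>
    SE.tapp hρ τ' (ha.2.2 n ρ γ₁ γ₂ hρ hγ)

theorem pack {τ : Ty (k + 1)} {τ' : Ty k} (ha : SLog Γ a₁ a₂ (τ.inst τ')) :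
    SLog Γ (.pack τ' a₁ τ) (.pack τ' a₂ τ) (.ex τ) :=
  intro (.pack ha.1) (.pack ha.2.1) fun n ρ γ₁ γ₂ _ hρ hγ =>
    SE.pack hρ (ha.2.2 n ρ γ₁ γ₂ hρ hγ)

theorem unpack {τ : Ty (k + 1)} {τ' : Ty k} {d₁ d₂ : Tm S (k + 1) (m + 1)}
    (ha : SLog Γ a₁ a₂ (.ex τ)) (hd : SLog (Γ.addTy.addTm τ) d₁ d₂ (τ'.rename Fin.succ)) :
    SLog Γ (.unpack a₁ d₁) (.unpack a₂ d₂) τ' := by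
  refine intro (.unpack ha.1 hd.1) (.unpack ha.2.1 hd.2.1) fun n ρ γ₁ γ₂ h0 hρ hγ =>
    SE.unpack hρ (ha.2.2 n ρ γ₁ γ₂ hρ hγ) ?_ ?_ fun w hw _ α₁ α₂ R hR x₁ x₂ hx => ?_
  · rw [← Ty.rename_succ_up]
    exact hd.1.subst (TyCtx.addTm_subst (TyCtx.addTy_subst (hγ.hasTy_left hρ h0)) τ)
  · rw [← Ty.rename_succ_up]
    exact hd.2.1.subst (TyCtx.addTm_subst (TyCtx.addTy_subst (hγ.hasTy_right hρ h0)) τ)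
  · rw [Tm.instBoth_subst_up, Tm.instBoth_subst_up]
    have := hd.2.2 w _ _ _ ((hρ.le hw).push hR.1 hR.2) (((hγ.le hρ hw).addTy _).addTm hx)
    rw [SE, SV_rename, Ty.subst_rename, Ty.subst_rename, SInterp.left_push,
      SInterp.right_push] at this
    exact this

theorem roll {τ : Ty (k + 1)} (ha : SLog Γ a₁ a₂ (τ.inst (.mu τ))) :
    SLog Γ (.roll (.mu τ) a₁) (.roll (.mu τ) a₂) (.mu τ) :=
  intro (.roll ha.1) (.roll ha.2.1) fun n ρ γ₁ γ₂ _ hρ hγ => SE.roll hρ (ha.2.2 n ρ γ₁ γ₂ hρ hγ)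

theorem unroll {τ : Ty (k + 1)} (ha : SLog Γ a₁ a₂ (.mu τ)) :
    SLog Γ (.unroll a₁) (.unroll a₂) (τ.inst (.mu τ)) :=
  intro (.unroll ha.1) (.unroll ha.2.1) fun n ρ γ₁ γ₂ _ hρ hγ =>
    SE.unroll hρ (ha.2.2 n ρ γ₁ γ₂ hρ hγ)

end SLog

/-- The fundamental theorem of the logical relation: well-typed terms approximate themselves. -/
theorem HasTy.sLog {e : Tm S k m} {τ : Ty k} (h : HasTy Γ e τ) : SLog Γ e e τ := by
  induction h with
  | var x => exact .var x
  | lit b c => exact .lit b c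
  | op o _ ih => exact .op o ih
  | ite _ _ _ ih ih₁ ih₂ => exact .ite ih ih₁ ih₂
  | pair _ _ ih₁ ih₂ => exact .pair ih₁ ih₂
  | fst _ ih => exact .fst ih
  | snd _ ih => exact .snd ih
  | inl _ ih => exact .inl ih
  | inr _ ih => exact .inr ih
  | case _ _ _ ih ih₁ ih₂ => exact .case ih ih₁ ih₂
  | lam _ ih => exact .lam ih
  | app _ _ ih₁ ih₂ => exact .app ih₁ ih₂
  | tlam _ ih => exact .tlam ih
  | tapp τ₁ _ ih => exact .tapp τ₁ ih
  | pack _ ih => exact .pack ih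
  | unpack _ _ ih₁ ih₂ => exact .unpack ih₁ ih₂
  | roll _ ih => exact .roll ih
  | unroll _ ih => exact .unroll ih

/-- Logical approximation is preserved by program contexts. -/
theorem SLog.fill {τ : Ty k} {e₁ e₂ : Tm S k m} (h : SLog Γ e₁ e₂ τ) {k' m' : ℕ}
    {C : Ctx S k m k' m'} {Γ' : TyCtx k' m'} {τ' : Ty k'} (hC : CtxTy Γ τ C Γ' τ') :
    SLog Γ' (C.fill e₁) (C.fill e₂) τ' := by
  induction hC with
  | hole _ _ hΓ => exact h.rename hΓ
  | op o i ht _ ih =>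
    refine .op o fun j => ?_
    by_cases hj : j = i
    · subst hj; rw [Function.update_self, Function.update_self]; exact ih
    · rw [Function.update_of_ne hj, Function.update_of_ne hj]; exact (ht j hj).sLog
  | ite₀ _ h₁ h₂ ih => exact .ite ih h₁.sLog h₂.sLog
  | ite₁ h₁ _ h₂ ih => exact .ite h₁.sLog ih h₂.sLog
  | ite₂ h₁ h₂ _ ih => exact .ite h₁.sLog h₂.sLog ih
  | pair₁ _ h ih => exact .pair ih h.sLog
  | pair₂ h _ ih => exact .pair h.sLog ih
  | fst _ ih => exact .fst ih
  | snd _ ih => exact .snd ih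
  | inl _ ih => exact .inl ih
  | inr _ ih => exact .inr ih
  | case₀ _ h₁ h₂ ih => exact .case ih h₁.sLog h₂.sLog
  | case₁ h₁ _ h₂ ih => exact .case h₁.sLog ih h₂.sLog
  | case₂ h₁ h₂ _ ih => exact .case h₁.sLog h₂.sLog ih
  | lam _ ih => exact .lam ih
  | app₁ _ h ih => exact .app ih h.sLog
  | app₂ h _ ih => exact .app h.sLog ih
  | tlam _ ih => exact .tlam ih
  | tapp τ₁ _ ih => exact .tapp τ₁ ih
  | pack _ ih => exact .pack ih
  | unpack₁ _ h ih => exact .unpack ih h.sLog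
  | unpack₂ h _ ih => exact .unpack h.sLog ih
  | roll _ ih => exact .roll ih
  | unroll _ ih => exact .unroll ih

/-- Adequacy: an evaluation of `e₁` with `i` unroll reductions is matched in world `i + 1`. -/
theorem SLog.terminates {e₁ e₂ : Tm S 0 0} {τ : Ty 0} (h : SLog TyCtx.nil e₁ e₂ τ)
    (ht : Terminates e₁) : Terminates e₂ := by
  obtain ⟨v, ⟨i, hi⟩, hv⟩ := ht
  have hρ : SInterp.Valid (S := S) (i + 1) (Fin.elim0 : SInterp S 0) :=
    ⟨fun i => i.elim0, fun i => i.elim0, fun i => i.elim0⟩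
  have := h.2.2 (i + 1) Fin.elim0 Fin.elim0 Fin.elim0 hρ (fun x => x.elim0)
  rw [Tm.subst_closed, Tm.subst_closed] at this
  obtain ⟨x, hx, hV⟩ := (this i.succ_pos).2.2 1 i v Nat.one_pos (Nat.add_comm 1 i).le hi hv
  have hT := SV_valPair τ hρ v x 1 (Nat.le_add_left 1 i) Nat.one_pos hV
  exact hx.terminates ⟨x, ⟨0, .refl x⟩, hT.2.2⟩

end

end FMu

theorem mainTheorem3 (S : FMu.PrimSig) {k m : ℕ} (Γ : FMu.TyCtx k m)
    (e₁ e₂ : FMu.Tm S k m) (τ : FMu.Ty k) (h : FMu.LogApprox Γ e₁ e₂ τ) :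
    FMu.CtxApprox Γ e₁ e₂ τ :=
  ⟨h.1, h.2.1, fun _ _ hC ht => (h.sLog.fill hC).terminates ht⟩
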